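/- Throughout, $\log x=\max\{1,\log_2x\}$, and $n$, $p$ are powers of two. **Machine.** $M(v)$ has processing elements (PEs) $0,\dots,v-1$ ($v$ a power of two) and works in supersteps; in a superstep every PE computes locally, sends constant-size messages, and then takes part in a barrier. A superstep with label $i$, $0\le i<\log v$ (an $i$-superstep), exchanges messages only between PEs whose indices share the $i$ most significant bits. An algorithm is static if the sequence of labels and the numbers of messages between PEs in each superstep depend only on the input size. Folding on $p\le v$ processors lets processor $j$ carry out the operations of the $v/p$ consecutive PEs starting at $jv/p$; supersteps with label at least $\log p$ become local computation. Let $h^s(n,p)$ be the maximum number of messages sent, or received, by a processor to/from other processors in superstep $s$ of the folding, $F^i(n,p)$ the sum of $h^s(n,p)$ over all $i$-supersteps $s$, and $S^i(n)$ the number of $i$-supersteps. The communication complexity on $M(p,\sigma)$, $p>1$, $\sigma\ge0$, is $H(n,p,\sigma)=\sum_{i<\log p}(F^i(n,p)+S^i(n)\sigma)$. An algorithm is $(\alpha,p)$-wise if $\sum_{i<j}F^i(n,2^j)\ge\alpha\frac{p}{2^j}\sum_{i<j}F^i(n,p)$ for $1\le j\le\log p$. **Problem and class.** The $n$-sort problem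 asks to label $n$ distinct keys with their ranks (numbers of smaller keys), keys being accessible only through comparisons between keys held by the same PE. For constants $\kappa,c\in\mathbb N$ and $\varepsilon\in(0,1)$ let $\mathscr C$ be the class of static $n$-sort algorithms in which a message carries at most $\kappa$ keys, no input key is initially replicated and there are never more than $c$ copies of a key, and no PE performs more than $\varepsilon n\log n$ comparisons, all this also for the foldings on at least two processors. **Algorithm.** Recursive Columnsort sorts $n=2^k\ge2$ keys on $M(n)$, initially one key per PE. A segment of $N=2^m$ consecutive PEs with $m\ge3$ is regarded as an $R\times S$ matrix in column-major order, $R=2^{\lceil 2m/3\rceil}$, $S=N/R$. Phases 1, 3, 5, 7 sort all columns recursively in parallel. Phase 2 picks the keys up in column-major and sets them down in row-major order; phase 4 picks them up antidiagonal by antidiagonal and sets them down in column-major order; phase 6 is a cyclic shift by $R/2$ positions, after which the keys in the first half of the first column are considered smaller than those in its second half; phase 8 undoes the shift. Each of phases 2, 4, 6, 8 is one superstep. Segments of $N\le4$ PEs exchange all their keys in one superstep; in a second one, each PE sorts these keys and retains the one of its own position. Supersteps acting on segments of length $N$ have label $\log_2(n/N)$, and in each of them PE $j$ also sends a dummy message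 to PE $j+N/2$, for $0\le j<N/2$. **Theorem.** 1. For every $n=2^k\ge 2$ this is a legal static algorithm that solves the $n$-sort problem; each message carries at most one key, no key is initially replicated, and there are never more than $O(1)$ copies of a key. When folded on $p\le n$ processors, each processor performs $O\big(\frac np(\log n)^{\log_{3/2}4}\big)$ comparisons. 2. For all $1<p\le n$ and $\sigma\ge0$, $$H_{\rm sort}(n,p,\sigma)=O\left(\Big(\frac np+\sigma\Big)\Big(\frac{\log n}{\log(n/p)}\Big)^{\log_{3/2}4}\right).$$ 3. There is a constant $\alpha\in(0,1]$ such that the algorithm is $(\alpha,n)$-wise for every $n\ge 2$. 4. It is $\Theta(1)$-optimal with respect to $\mathscr C$ for $p=O(n^{1-\delta})$ and all $\sigma\ge0$: for all constants $\kappa,c$, $\varepsilon,\delta\in(0,1)$, $M>0$ there are $\beta\in(0,1]$ and $n_0$ such that for all $n\ge n_0$, all $1<p\le n$ with $p\le Mn^{1-\delta}$, all $\sigma\ge0$ and every algorithm $\mathcal B\in\mathscr C$ for $n$ keys on $p$ PEs, $H_{\rm sort}(n,p,\sigma)\le\frac1\beta H_{\mathcal B}(n,p,\sigma)$. -/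

import Mathlib

namespace NetSort

/-- The convention `log x = max {1, log₂ x}`. -/
noncomputable def lg (x : ℝ) : ℝ := max 1 (Real.logb 2 x)

/-! ### Comparison-based local computation

Keys are opaque: a key is named by its position `i : Fin n` in the input, and its value is
accessible only through comparisons. -/

/-- A sequential comparison-based computation returning an element of `α`: the node
`cmp i j t e` compares keys `i` and `j`, continuing as `t` if key `i` is smaller than key `j`
and as `e` otherwise. -/
inductive CompTree (n : ℕ) (α : Type) : Type
  | done : α → CompTree n α
  | cmp : Fin n → Fin n → CompTree n α → CompTree n α → CompTree n α

namespace CompTree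

/-- The result of the computation on the input keys `x`. -/
def eval {n : ℕ} {α K : Type} [LinearOrder K] (x : Fin n → K) : CompTree n α → α
  | done a => a
  | cmp i j t e => if x i < x j then t.eval x else e.eval x

/-- The comparisons performed on the input keys `x`, in order. -/
def path {n : ℕ} {α K : Type} [LinearOrder K] (x : Fin n → K) :
    CompTree n α → List (Fin n × Fin n)
  | done _ => []
  | cmp i j t e => (i, j) :: if x i < x j then t.path x else e.path x

/-- Sequential composition. -/
def bind {n : ℕ} {α β : Type} : CompTree n α → (α → CompTree n β) → CompTree n β
  | done a, f => f a
  | cmp i j t e, f => cmp i j (t.bind f) (e.bind f)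

end CompTree

/-! ### Static comparison algorithms on the machine with `v` processing elements -/

/-- A collection of (copies of) keys together with non-key data. It is used both for the
contents of a local memory and for the contents of a message. -/
structure Store (n : ℕ) (D : Type) where
  keys : List (Fin n)
  data : D

/-- A superstep. Labels and the numbers of messages between processing elements do not depend on
the input, whereas the contents of the messages may. -/
structure Superstep (n v : ℕ) (D : Type) where
  /-- the label of the terminating synchronization -/
  label : ℕ
  /-- `count r q` messages are sent by `r` to `q` -/
  count : Fin v → Fin v → ℕ
  /-- The local computation of a processing element: from its memory it computes what it retains
  and, for every `q` and every `k < count r q`, the contents of the `k`-th message for `q`. -/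
  work : Fin v → Store n D → CompTree n (Store n D × (Fin v → ℕ → Store n D))
  /-- The non-key data after the barrier, computed from what was retained and from the received
  messages (with their senders). -/
  recv : Fin v → Store n D → List (Fin v × Store n D) → D

/-- The contents of all local memories. -/
abbrev Config (n v : ℕ) (D : Type) : Type := Fin v → Store n D

namespace Superstep

variable {n v : ℕ} {D K : Type} [LinearOrder K]

/-- What `r` retains, and the messages that `r` sends, in configuration `c`. -/
def outcome (S : Superstep n v D) (x : Fin n → K) (c : Config n v D) (r : Fin v) :
    Store n D × (Fin v → ℕ → Store n D) :=
  (S.work r (c r)).eval x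

/-- The messages available to `r` after the barrier. -/
def inbox (S : Superstep n v D) (x : Fin n → K) (c : Config n v D) (r : Fin v) :
    List (Fin v × Store n D) :=
  (List.finRange v).flatMap fun q =>
    (List.range (S.count q r)).map fun k => (q, (S.outcome x c q).2 r k)

/-- The configuration after the superstep. -/
def exec (S : Superstep n v D) (x : Fin n → K) (c : Config n v D) : Config n v D := fun r =>
  { keys := (S.outcome x c r).1.keys ++ (S.inbox x c r).flatMap fun m => m.2.keys
    data := S.recv r (S.outcome x c r).1 (S.inbox x c r) }

/-- Every processing element compares, retains and sends only keys that are in its local memory,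
and no message carries more than `κ` keys. -/
def Legal (S : Superstep n v D) (κ : ℕ) (x : Fin n → K) (c : Config n v D) : Prop :=
  ∀ r : Fin v,
    (∀ ij ∈ (S.work r (c r)).path x, ij.1 ∈ (c r).keys ∧ ij.2 ∈ (c r).keys) ∧
    (∀ i ∈ (S.outcome x c r).1.keys, i ∈ (c r).keys) ∧
    ∀ q : Fin v, ∀ k < S.count r q,
      (∀ i ∈ ((S.outcome x c r).2 q k).keys, i ∈ (c r).keys) ∧
      ((S.outcome x c r).2 q k).keys.length ≤ κ

end Superstep

/-- Under folding on `p` processors, each processor carries out the operations of `v / p`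
consecutive processing elements; `proc v p r` is the processor in charge of `r`. -/
def proc (v p : ℕ) (r : Fin v) : ℕ := r.val / (v / p)

namespace Superstep

variable {n v : ℕ} {D : Type}

/-- Messages leaving processor `j` in the folding on `p` processors. -/
def sent (S : Superstep n v D) (p j : ℕ) : ℕ :=
  ∑ r : Fin v, ∑ q : Fin v, if proc v p r = j ∧ proc v p q ≠ j then S.count r q else 0

/-- Messages entering processor `j` in the folding on `p` processors. -/
def received (S : Superstep n v D) (p j : ℕ) : ℕ :=
  ∑ r : Fin v, ∑ q : Fin v, if proc v p r ≠ j ∧ proc v p q = j then S.count r q else 0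

/-- The degree `h(n, p)` of the superstep in the folding on `p` processors. -/
def degree (S : Superstep n v D) (p : ℕ) : ℕ :=
  (Finset.range p).sup fun j => max (S.sent p j) (S.received p j)

end Superstep

/-- A static comparison algorithm for `n` input keys on `v` processing elements. At the end,
`output r` lists the pairs (key, label) produced by `r`. -/
structure StaticAlgorithm (n v : ℕ) where
  Data : Type
  init : Config n v Data
  steps : List (Superstep n v Data)
  output : Fin v → Store n Data → List (Fin n × ℕ)

/-- The rank of the `i`-th key: the number of smaller keys. -/
def rank {n : ℕ} {K : Type} [LinearOrder K] (x : Fin n → K) (i : Fin n) : ℕ :=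
  (Finset.univ.filter fun j => x j < x i).card

namespace StaticAlgorithm

variable {n v : ℕ}

/-- The configuration after the first `t` supersteps. -/
def run {K : Type} [LinearOrder K] (A : StaticAlgorithm n v) (x : Fin n → K) (t : ℕ) :
    Config n v A.Data :=
  (A.steps.take t).foldl (fun c S => S.exec x c) A.init

/-- The algorithm obeys the rules of the machine: labels are in range, in an `i`-superstep messages
are exchanged only between processing elements whose indices share the `i` most significant bits,
keys are manipulated legally, and a message carries at most `κ` keys. -/
structure WellFormed (A : StaticAlgorithm n v) (κ : ℕ) : Prop where
  label_lt : ∀ S ∈ A.steps, S.label < max 1 (Nat.log 2 v)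
  cluster : ∀ S ∈ A.steps, ∀ r q : Fin v, S.count r q ≠ 0 →
    proc v (2 ^ S.label) r = proc v (2 ^ S.label) q
  legal : ∀ (K : Type) [LinearOrder K] (x : Fin n → K), Function.Injective x →
    ∀ t : Fin A.steps.length, (A.steps.get t).Legal κ x (A.run x t)

/-- The algorithm labels every key with its rank, for all inputs of `n` distinct keys. -/
def Solves (A : StaticAlgorithm n v) : Prop :=
  ∀ (K : Type) [LinearOrder K] (x : Fin n → K), Function.Injective x → ∀ i : Fin n,
    (∃ r, (i, rank x i) ∈ A.output r (A.run x A.steps.length r)) ∧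
    ∀ r m, (i, m) ∈ A.output r (A.run x A.steps.length r) → m = rank x i

/-- No input key is initially replicated, and at any time there are at most `c` copies of a key
in the whole machine. -/
def LowReplication (A : StaticAlgorithm n v) (c : ℕ) : Prop :=
  (∀ i : Fin n, ∑ r, (A.init r).keys.count i = 1) ∧
  ∀ (K : Type) [LinearOrder K] (x : Fin n → K), Function.Injective x →
    ∀ t ≤ A.steps.length, ∀ i : Fin n, ∑ r, (A.run x t r).keys.count i ≤ c

/-- Comparisons performed by processor `j` in the folding on `p` processors, on input `x`. -/
def comparisons {K : Type} [LinearOrder K] (A : StaticAlgorithm n v) (p : ℕ) (x : Fin n → K)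
    (j : ℕ) : ℕ :=
  ∑ t : Fin A.steps.length, ∑ r : Fin v,
    if proc v p r = j then (((A.steps.get t).work r (A.run x t r)).path x).length else 0

/-- In the folding on `p` processors, no processor ever performs more than `b` comparisons. -/
def ComparisonsAtMost (A : StaticAlgorithm n v) (p : ℕ) (b : ℝ) : Prop :=
  ∀ (K : Type) [LinearOrder K] (x : Fin n → K), Function.Injective x →
    ∀ j < p, (A.comparisons p x j : ℝ) ≤ b

/-- `F^i(n, p)`: cumulative degree of the `i`-supersteps in the folding on `p` processors. -/
def cumDegree (A : StaticAlgorithm n v) (i p : ℕ) : ℕ :=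
  ((A.steps.filter fun S => S.label = i).map fun S => S.degree p).sum

/-- `S^i(n)`: the number of `i`-supersteps. -/
def numSteps (A : StaticAlgorithm n v) (i : ℕ) : ℕ :=
  (A.steps.filter fun S => S.label = i).length

/-- The communication complexity `H(n, p, σ)`. -/
noncomputable def commComplexity (A : StaticAlgorithm n v) (p : ℕ) (σ : ℝ) : ℝ :=
  ∑ i ∈ Finset.range (Nat.log 2 p), ((A.cumDegree i p : ℝ) + (A.numSteps i : ℝ) * σ)

/-- `(α, p)`-wiseness. -/
def Wise (A : StaticAlgorithm n v) (α : ℝ) (p : ℕ) : Prop :=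
  ∀ j : ℕ, 1 ≤ j → j ≤ Nat.log 2 p →
    α * ((p : ℝ) / 2 ^ j) * ∑ i ∈ Finset.range j, (A.cumDegree i p : ℝ) ≤
      ∑ i ∈ Finset.range j, (A.cumDegree i (2 ^ j) : ℝ)

/-- The class of static `n`-sort algorithms in which messages carry at most `κ` keys, no input key
is initially replicated, at most `c` copies of a key exist at any time, and no processor performs
more than `ε n log n` comparisons, all of this also for every folding on at least two processors
(of these properties only the last one depends on the folding). -/
structure InClass (A : StaticAlgorithm n v) (κ c : ℕ) (ε : ℝ) : Prop where
  wellFormed : A.WellFormed κ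
  solves : A.Solves
  lowReplication : A.LowReplication c
  balanced : ∀ a : ℕ, 1 ≤ a → 2 ^ a ≤ v → A.ComparisonsAtMost (2 ^ a) (ε * n * lg n)

end StaticAlgorithm

/-! ### Recursive Columnsort on `2 ^ k` virtual processors

A segment of `2 ^ m` consecutive virtual processors holds, one key each, an `R × S` matrix in
column-major order (entry `(i, j)` is at position `j * R + i` of the segment). Every key carries
a stack of Boolean tags; keys are ordered lexicographically by their tags first and by value only
if the tags agree. The non-key data of a virtual processor is the list of the tags of its keys. -/

/-- The tags of the keys held by a virtual processor. -/
abbrev Tags : Type := List (List Bool)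

/-- Lexicographic order of tag stacks, most recent tag first, `false` before `true`. -/
def tagLt : List Bool → List Bool → Bool
  | a :: s, b :: t => if a = b then tagLt s t else b
  | [], _ :: _ => true
  | _, [] => false

/-- Compare two tagged keys. -/
def less {n : ℕ} (a b : Fin n × List Bool) : CompTree n Bool :=
  if a.2 = b.2 then .cmp a.1 b.1 (.done true) (.done false) else .done (tagLt a.2 b.2)

/-- Insertion into a sorted list of tagged keys. -/
def insertKey {n : ℕ} (a : Fin n × List Bool) :
    List (Fin n × List Bool) → CompTree n (List (Fin n × List Bool))
  | [] => .done [a]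
  | b :: l => (less a b).bind fun u =>
      if u then .done (a :: b :: l) else (insertKey a l).bind fun l' => .done (b :: l')

/-- Insertion sort of a list of tagged keys. -/
def sortKeys {n : ℕ} : List (Fin n × List Bool) → CompTree n (List (Fin n × List Bool))
  | [] => .done []
  | a :: l => (sortKeys l).bind (insertKey a)

/-- Phase 2: the keys are picked up in column-major and set down in row-major order. -/
def transposePos (R S t : ℕ) : ℕ := (t % S) * R + t / S

/-- Phase 4: the keys are picked up diagonal by diagonal and set down in column-major order. -/
def diagPos (R S t : ℕ) : ℕ :=
  ((Finset.range (R * S)).filter fun u =>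
    u % R + u / R < t % R + t / R ∨ (u % R + u / R = t % R + t / R ∧ u / R < t / R)).card

/-- Phase 6: cyclic shift by `R / 2` positions. -/
def shiftPos (R S t : ℕ) : ℕ := (t + R / 2) % (R * S)

/-- Phase 8: the reverse of the cyclic shift. -/
def unshiftPos (R S t : ℕ) : ℕ := (t + (R * S - R / 2)) % (R * S)

/-- The tag pushed on the key that phase 6 moves to position `t`: the keys in the first half of the
first column have to be considered smaller than those in its second half. -/
def shiftTag (R t : ℕ) : Bool := decide (R / 2 ≤ t ∧ t < R)

/-- Dummy messages of a superstep acting on segments of length `2 ^ m`: the `r`-th virtual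
processor sends one to the `(r + 2 ^ m / 2)`-th one, for `r < 2 ^ m / 2`. -/
def dummyCount (m : ℕ) {v : ℕ} (r q : Fin v) : ℕ :=
  if r.val < 2 ^ m / 2 ∧ q.val = r.val + 2 ^ m / 2 then 1 else 0

/-- The empty message, or the empty memory. -/
def emptyStore {n : ℕ} : Store n Tags := ⟨[], []⟩

/-- Received keys are appended to the memory, hence so are their tags. -/
def appendTags {n v : ℕ} (_ : Fin v) (st : Store n Tags) (msgs : List (Fin v × Store n Tags)) :
    Tags :=
  st.data ++ msgs.flatMap fun m => m.2.data

/-- The virtual processor that receives the key of `r` when, in every segment of length `2 ^ m`,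
the keys are permuted according to `f`. -/
def target (m : ℕ) (f : ℕ → ℕ) (r : ℕ) : ℕ := r / 2 ^ m * 2 ^ m + f (r % 2 ^ m)

/-- The superstep that permutes the keys of every segment of length `2 ^ m` according to `f`; the
tags of the key moved to position `t` of the segment are updated by `g t`. -/
def route (k m : ℕ) (f : ℕ → ℕ) (g : ℕ → List Bool → List Bool) :
    Superstep (2 ^ k) (2 ^ k) Tags where
  label := k - m
  count r q := (if q.val = target m f r then 1 else 0) + dummyCount m r q
  work r st := .done (emptyStore, fun q i =>
    if q.val = target m f r ∧ i = 0 then ⟨st.keys, st.data.map (g (f (r % 2 ^ m)))⟩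
    else emptyStore)
  recv := appendTags

/-- Whether `r` and `q` are distinct members of the same segment of length `2 ^ m`. -/
def Mates (m : ℕ) {v : ℕ} (r q : Fin v) : Prop := q ≠ r ∧ q.val / 2 ^ m = r.val / 2 ^ m

instance (m : ℕ) {v : ℕ} (r q : Fin v) : Decidable (Mates m r q) :=
  inferInstanceAs (Decidable (_ ∧ _))

/-- In every segment of (constant) length `2 ^ m`, all keys are sent to all virtual processors. -/
def exchange (k m : ℕ) : Superstep (2 ^ k) (2 ^ k) Tags where
  label := k - m
  count r q := (if Mates m r q then 1 else 0) + dummyCount m r q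
  work r st := .done (st, fun q i => if Mates m r q ∧ i = 0 then st else emptyStore)
  recv := appendTags

/-- Every virtual processor sorts the keys it holds, and retains the one whose rank among them is
its own position in the segment of length `2 ^ m`. -/
def localSort (k m : ℕ) : Superstep (2 ^ k) (2 ^ k) Tags where
  label := k - m
  count r q := dummyCount m r q
  work r st := (sortKeys (st.keys.zip st.data)).bind fun l =>
    let own := (l.drop (r.val % 2 ^ m)).take 1
    .done (⟨own.map Prod.fst, own.map Prod.snd⟩, fun _ _ => emptyStore)
  recv := appendTags

/-- The supersteps that sort, in parallel, all segments of length `2 ^ m`. The matrix has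
`R = 2 ^ ⌈2m/3⌉` rows, the smallest power of two not below `(2 ^ m) ^ (2/3)`. Segments of length
at most 4 are sorted directly. -/
def columnsortSteps (k m : ℕ) : List (Superstep (2 ^ k) (2 ^ k) Tags) :=
  if h : m ≤ 2 then [exchange k m, localSort k m]
  else
    let a := (2 * m + 2) / 3
    let R := 2 ^ a
    let S := 2 ^ (m - a)
    columnsortSteps k a ++ [route k m (transposePos R S) fun _ s => s] ++
    columnsortSteps k a ++ [route k m (diagPos R S) fun _ s => s] ++
    columnsortSteps k a ++ [route k m (shiftPos R S) fun t s => shiftTag R t :: s] ++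
    columnsortSteps k a ++ [route k m (unshiftPos R S) fun _ s => s.tail]
termination_by m
decreasing_by all_goals omega

/-- Recursive Columnsort for `n = 2 ^ k` keys on `n` virtual processors: initially the `r`-th one
holds the `r`-th input key; finally it labels the key it holds with `r`. -/
def columnsort (k : ℕ) : StaticAlgorithm (2 ^ k) (2 ^ k) where
  Data := Tags
  init r := ⟨[r], [[]]⟩
  steps := columnsortSteps k k
  output r st := st.keys.map fun i => (i, r.val)

end NetSort

/-! Correctness is a form of the 0-1 principle. Fix a threshold y; call the keys below y zeros and
the others ones. Sorting a column moves its zeros to the front and keeps their number. Since S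
divides R, transposing sorted columns spreads the zeros evenly: the column counts become
nonincreasing and differ by at most S (`transpose_counts`). In diagonal order at most S(S-1)/2 ones
then precede any zero, and at most that many zeros follow any one. This is at most R/2 because S² ≤
R, which the choice R = 2^⌈2m/3⌉ guarantees (`diag_overlap`). After phase 5 any remaining disorder
lies in the second half of one column and the first half of the next (`overlap_sorted_columns`);
together these are one column of the shifted matrix, which phase 7 sorts (`shifted_columns_sorted`).
If a key were preceded by a larger one at the end, taking the larger one as y would give a
contradiction (`columnsort_phases`). The recursion is handled by induction on m, for arbitrary
tagged keys (`runs_columnsortSteps`).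

Costs: in each superstep a PE sends and receives at most four messages, so the degree on p
processors is O(n/p). The dummy messages make it at least n/p in every superstep that is not local,
and wiseness follows superstep by superstep. The number T(m) of non-local supersteps satisfies T(m)
≤ 4 T(⌈2m/3⌉) + 4 and vanishes once a segment fits into one processor, which gives T(k) = O((log n /
log(n/p))^(log_{3/2} 4)) (`countBelow_le`).

Optimality: an algorithm of the class sends Ω(n) messages between different PEs
(`exists_linear_traffic`). If no PE initially holds almost all keys, there are linearly many
disjoint pairs of keys with different homes. On an input where the members of each pair are adjacent
in the order, each pair must be compared, so one of its keys has to move. If some PE does hold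
almost all keys and few keys move, the execution is determined by the outcomes of the comparisons in
that PE and by the relative order of the few keys that start elsewhere or move. With at most ε n log
n such outcomes there are fewer than n! executions, a contradiction. Hence H = Ω(n/p + σ), and for p
= O(n^(1-δ)) the ratio log n / log(n/p) in the upper bound is bounded. -/

namespace NetSort
open Finset

/-! ### The threshold form of Columnsort -/

/-- A downward closed predicate on `range N` holds exactly below its cardinality. -/
theorem iff_lt_card_of_downward {N : ℕ} {P : ℕ → Prop} [DecidablePred P]
    (h : ∀ t t', t < t' → t' < N → P t' → P t) {t : ℕ} (ht : t < N) :
    P t ↔ t < #{i ∈ range N | P i} := by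
  constructor
  · intro hp
    have : range (t + 1) ⊆ {i ∈ range N | P i} := by
      intro i hi
      simp only [mem_range, mem_filter] at hi ⊢
      refine ⟨by omega, ?_⟩
      rcases Nat.lt_or_ge i t with h1 | h1
      · exact h i t h1 ht hp
      · rwa [show i = t by omega]
    simpa using card_le_card this
  · intro hc
    by_contra hp
    have : {i ∈ range N | P i} ⊆ range t := by
      intro i hi
      simp only [mem_range, mem_filter] at hi ⊢
      by_contra hti
      rcases Nat.lt_or_ge t i with h1 | h1
      · exact hp (h t i h1 hi.1 hi.2)
      · exact hp ((show i = t by omega) ▸ hi.2)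
    have := card_le_card this
    simp at this
    omega

/-! ### Positions in column-major order, and the permutations of phases 2 and 4. -/

theorem column_div {R c i : ℕ} (hi : i < R) : (c * R + i) / R = c := by
  rw [Nat.add_comm, Nat.add_mul_div_right _ _ (by omega), Nat.div_eq_of_lt hi, Nat.zero_add]

theorem column_mod {R c i : ℕ} (hi : i < R) : (c * R + i) % R = i := by
  rw [Nat.add_comm, Nat.add_mul_mod_self_right, Nat.mod_eq_of_lt hi]

theorem column_lt {R S c i : ℕ} (hc : c < S) (hi : i < R) : c * R + i < R * S := by
  calc c * R + i < c * R + R := by omega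
    _ = (c + 1) * R := by ring
    _ ≤ S * R := Nat.mul_le_mul_right _ hc
    _ = R * S := Nat.mul_comm _ _

theorem transposePos_entry {R S i c : ℕ} (hc : c < S) :
    transposePos R S (i * S + c) = c * R + i := by
  rw [transposePos, column_mod hc, column_div hc]

/-- The numbers of zeros in the columns after the transposition of a matrix with sorted columns
are nonincreasing, and they differ by at most the number of columns. -/
theorem transpose_counts {R' S : ℕ} {P1 P2 : ℕ → Prop} [DecidablePred P2]
    (h1 : ∀ c < S, ∃ z, ∀ i < S * R', P1 (c * (S * R') + i) ↔ i < z)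
    (h2 : ∀ t < S * R' * S, P2 (transposePos (S * R') S t) ↔ P1 t) {c c' : ℕ} (hcc : c ≤ c')
    (hc' : c' < S) :
    #{i ∈ range (S * R') | P2 (c' * (S * R') + i)} ≤
        #{i ∈ range (S * R') | P2 (c * (S * R') + i)} ∧
      #{i ∈ range (S * R') | P2 (c * (S * R') + i)} ≤
        #{i ∈ range (S * R') | P2 (c' * (S * R') + i)} + S := by
  choose! z hz using h1
  -- Entry i of the new column d comes from position i * S + d. As a column has S * R' entries, this
  -- is row (i % R') * S + d of the old column i / R'.
  have key : ∀ d < S, ∀ i < S * R', P2 (d * (S * R') + i) ↔ (i % R') * S + d < z (i / R') := by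
    intro d hd i hi
    have hR' : 0 < R' := by
      rcases Nat.eq_zero_or_pos R' with h | h
      · simp [h] at hi
      · exact h
    have hj : i / R' < S := by rw [Nat.div_lt_iff_lt_mul hR']; exact hi
    have hm : i % R' < R' := Nat.mod_lt _ hR'
    rw [← transposePos_entry hd, h2]
    · have hlt : (i % R') * S + d < S * R' := column_lt hm hd
      have : i * S + d = (i / R') * (S * R') + ((i % R') * S + d) := by
        conv_lhs => rw [← Nat.div_add_mod i R']
        ring
      rw [this, hz _ hj _ hlt]
    · have := column_lt (R := S) (S := S * R') hi hd
      linarith [Nat.mul_comm S (S * R')]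
  constructor
  · apply card_le_card
    intro i hi
    simp only [mem_filter, mem_range] at hi ⊢
    refine ⟨hi.1, ?_⟩
    rw [key _ (by omega) _ hi.1]
    rw [key _ hc' _ hi.1] at hi
    omega
  · refine (card_le_card_sdiff_add_card (t := {i ∈ range (S * R') | P2 (c' * (S * R') + i)})).trans ?_
    rw [Nat.add_comm]
    refine Nat.add_le_add_left ?_ _
    conv_rhs => rw [← card_range S]
    -- Each old column contributes at most one row to the difference: the entries it sends to one
    -- new column are S rows apart, and c' - c < S.
    apply card_le_card_of_injOn (fun i => i / R')
    · intro i hi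
      simp only [coe_sdiff, coe_filter, mem_range, Set.mem_sdiff, Set.mem_ofPred_eq] at hi
      simp only [coe_range, Set.mem_Iio]
      exact Nat.div_lt_of_lt_mul (by linarith [hi.1.1, Nat.mul_comm S R'])
    · intro i hi j hj hij
      simp only [coe_sdiff, coe_filter, mem_range, Set.mem_sdiff, Set.mem_ofPred_eq, not_and] at hi hj
      have hi2 := hi.2 hi.1.1
      have hj2 := hj.2 hj.1.1
      have hi1 := hi.1.2
      have hj1 := hj.1.2
      rw [key _ hc' _ hi.1.1] at hi2
      rw [key _ hc' _ hj.1.1] at hj2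
      rw [key _ (by omega) _ hi.1.1] at hi1
      rw [key _ (by omega) _ hj.1.1] at hj1
      simp only at hij
      rw [← hij] at hj1 hj2
      have : i % R' = j % R' := by
        rcases Nat.lt_trichotomy (i % R') (j % R') with h | h | h
        · have := Nat.mul_le_mul_right S h
          rw [Nat.succ_mul] at this
          omega
        · exact h
        · have := Nat.mul_le_mul_right S h
          rw [Nat.succ_mul] at this
          omega
      rw [← Nat.div_add_mod i R', ← Nat.div_add_mod j R', hij, this]

/-- The order in which phase 4 picks up the keys. -/
def DiagLt (R u t : ℕ) : Prop :=
  u % R + u / R < t % R + t / R ∨ (u % R + u / R = t % R + t / R ∧ u / R < t / R)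

instance (R u t : ℕ) : Decidable (DiagLt R u t) := inferInstanceAs (Decidable (_ ∨ _))

theorem diagPos_eq (R S t : ℕ) : diagPos R S t = #{u ∈ range (R * S) | DiagLt R u t} := rfl

theorem DiagLt.trans {R u t w : ℕ} (h : DiagLt R u t) (h' : DiagLt R t w) : DiagLt R u w := by
  unfold DiagLt at *; omega

theorem DiagLt.irrefl (R u : ℕ) : ¬ DiagLt R u u := by
  unfold DiagLt; omega

theorem DiagLt.total {R u t : ℕ} (h : u ≠ t) : DiagLt R u t ∨ DiagLt R t u := by
  unfold DiagLt
  by_contra hc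
  apply h
  have h1 : u / R = t / R := by omega
  have h2 : u % R = t % R := by omega
  rw [← Nat.div_add_mod u R, ← Nat.div_add_mod t R, h1, h2]

theorem diagPos_lt_diagPos {R S u t : ℕ} (hu : u < R * S) (h : DiagLt R u t) :
    diagPos R S u < diagPos R S t := by
  rw [diagPos_eq, diagPos_eq]
  apply card_lt_card
  rw [ssubset_iff_of_subset]
  · exact ⟨u, by simp [hu, h], by simp [DiagLt.irrefl]⟩
  · intro w hw
    simp only [mem_filter] at hw ⊢
    exact ⟨hw.1, hw.2.trans h⟩

theorem diagPos_lt_iff {R S u t : ℕ} (hu : u < R * S) (ht : t < R * S) :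
    diagPos R S u < diagPos R S t ↔ DiagLt R u t := by
  refine ⟨fun h => ?_, diagPos_lt_diagPos hu⟩
  have hne : u ≠ t := by rintro rfl; omega
  rcases DiagLt.total (R := R) hne with h' | h'
  · exact h'
  · exact absurd (diagPos_lt_diagPos ht h') (by omega)

theorem diagPos_lt {R S t : ℕ} (ht : t < R * S) : diagPos R S t < R * S := by
  rw [diagPos_eq]
  conv_rhs => rw [← card_range (R * S)]
  apply card_lt_card
  rw [ssubset_iff_of_subset (filter_subset _ _)]
  exact ⟨t, by simp [ht], by simp [DiagLt.irrefl]⟩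

theorem diagPos_injOn (R S : ℕ) : Set.InjOn (diagPos R S) (Set.Iio (R * S)) := by
  intro u hu t ht h
  by_contra hne
  rcases DiagLt.total (R := R) hne with h' | h'
  · exact absurd (diagPos_lt_diagPos hu h') (by omega)
  · exact absurd (diagPos_lt_diagPos ht h') (by omega)

theorem exists_diagPos_eq {R S p : ℕ} (hp : p < R * S) : ∃ u < R * S, diagPos R S u = p := by
  have := surj_on_of_inj_on_of_card_le (s := range (R * S)) (t := range (R * S))
    (fun u _ => diagPos R S u) (fun u hu => by simpa using diagPos_lt (by simpa using hu))
    (fun a b ha hb h => diagPos_injOn R S (by simpa using ha) (by simpa using hb) h) le_rfl p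
    (by simpa using hp)
  obtain ⟨u, hu, h⟩ := this
  exact ⟨u, by simpa using hu, h.symm⟩

/-- The cyclic distance from j to j₀ is an involution of `range S`, so the distances are 0, ..., S -
1 in some order. -/
theorem sum_cyclic_dist {S j₀ : ℕ} (h : j₀ < S) :
    2 * ∑ j ∈ range S, (if j ≤ j₀ then j₀ - j else S + j₀ - j) = S * (S - 1) := by
  have e : ∑ j ∈ range S, (if j ≤ j₀ then j₀ - j else S + j₀ - j) = ∑ j ∈ range S, j := by
    refine sum_nbij' (fun j => if j ≤ j₀ then j₀ - j else S + j₀ - j)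
      (fun j => if j ≤ j₀ then j₀ - j else S + j₀ - j) ?_ ?_ ?_ ?_ ?_
    all_goals
      intro j hj
      simp only [mem_range] at * <;> split_ifs <;> omega
  rw [e, Nat.mul_comm, sum_range_id_mul_two]

/-- A set of matrix entries with at most `b j` consecutive candidates in column `j`. -/
theorem card_le_sum_columns {R S : ℕ} {A : Finset ℕ} (hA : ∀ u ∈ A, u < R * S) (lo b : ℕ → ℕ)
    (h : ∀ u ∈ A, lo (u / R) ≤ u % R ∧ u % R < lo (u / R) + b (u / R)) :
    #A ≤ ∑ j ∈ range S, b j := by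
  rw [card_eq_sum_card_fiberwise (f := fun u => u / R) (t := range S)]
  · apply sum_le_sum
    intro j _
    have : b j = #(Ico (lo j) (lo j + b j)) := by simp
    rw [this]
    apply card_le_card_of_injOn (fun u => u % R)
    · intro u hu
      simp only [coe_filter, Set.mem_ofPred_eq] at hu
      have := h u hu.1
      rw [hu.2] at this
      simpa using this
    · intro u hu w hw huw
      simp only [coe_filter, Set.mem_ofPred_eq] at hu hw huw
      rw [← Nat.div_add_mod u R, ← Nat.div_add_mod w R, hu.2, hw.2, huw]
  · intro u hu
    simp only [coe_range, Set.mem_Iio]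
    exact Nat.div_lt_of_lt_mul (hA u hu)

/-- In diagonal order, at most `S (S - 1) / 2` ones precede a zero. -/
theorem card_ones_before {R S : ℕ} {Z : ℕ → ℕ} {P : ℕ → Prop} [DecidablePred P]
    (hP : ∀ u < R * S, P u ↔ u % R < Z (u / R))
    (hZ : ∀ c c', c ≤ c' → c' < S → Z c' ≤ Z c ∧ Z c ≤ Z c' + S) {u₀ : ℕ} (hu₀ : u₀ < R * S)
    (h₀ : P u₀) : 2 * #{u ∈ range (R * S) | DiagLt R u u₀ ∧ ¬ P u} ≤ S * (S - 1) := by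
  have hj₀ : u₀ / R < S := Nat.div_lt_of_lt_mul hu₀
  rw [← sum_cyclic_dist hj₀]
  refine Nat.mul_le_mul_left 2 ?_
  -- In column j, a one before u₀ lies fewer rows below the boundary Z j than the cyclic distance
  -- from j to the column of u₀. Left of that column this uses that Z is nonincreasing, right of it
  -- that Z drops by at most S.
  apply card_le_sum_columns (R := R) (lo := Z)
  · intro u hu; simpa using (mem_filter.1 hu).1
  · intro u hu
    simp only [mem_filter, mem_range] at hu
    obtain ⟨hu, hd, hn⟩ := hu
    have hj : u / R < S := Nat.div_lt_of_lt_mul hu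
    rw [hP _ hu] at hn
    rw [hP _ hu₀] at h₀
    refine ⟨by omega, ?_⟩
    unfold DiagLt at hd
    split_ifs with hle
    · have := hZ _ _ hle hj₀
      omega
    · have := hZ (u₀ / R) (u / R) (by omega) hj
      omega

/-- In diagonal order, at most `S (S - 1) / 2` zeros follow a one. -/
theorem card_zeros_after {R S : ℕ} {Z : ℕ → ℕ} {P : ℕ → Prop} [DecidablePred P]
    (hP : ∀ u < R * S, P u ↔ u % R < Z (u / R))
    (hZ : ∀ c c', c ≤ c' → c' < S → Z c' ≤ Z c ∧ Z c ≤ Z c' + S) {u₁ : ℕ} (hu₁ : u₁ < R * S)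
    (h₁ : ¬ P u₁) : 2 * #{u ∈ range (R * S) | DiagLt R u₁ u ∧ P u} ≤ S * (S - 1) := by
  have hj₁ : u₁ / R < S := Nat.div_lt_of_lt_mul hu₁
  have hj : S - 1 - u₁ / R < S := by
    generalize u₁ / R = w at *
    omega
  -- The situation is the mirror image of `card_ones_before`: the distances run the other way, hence
  -- the reflection of the columns, and the zeros lie just above the boundary. Truncation in Z j - b
  -- j is harmless, as rows are nonnegative.
  rw [← sum_cyclic_dist hj, ← sum_range_reflect]
  refine Nat.mul_le_mul_left 2 ?_
  set b : ℕ → ℕ := fun j => if S - 1 - j ≤ S - 1 - u₁ / R then S - 1 - u₁ / R - (S - 1 - j)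
    else S + (S - 1 - u₁ / R) - (S - 1 - j) with hb
  apply card_le_sum_columns (R := R) (lo := fun j => Z j - b j) (b := b)
  · intro u hu; simpa using (mem_filter.1 hu).1
  · intro u hu
    simp only [mem_filter, mem_range] at hu
    obtain ⟨hu, hd, hn⟩ := hu
    have hj : u / R < S := Nat.div_lt_of_lt_mul hu
    rw [hP _ hu] at hn
    rw [hP _ hu₁] at h₁
    unfold DiagLt at hd
    rcases Nat.le_total (u₁ / R) (u / R) with hle | hle
    · have hbe : b (u / R) = u / R - u₁ / R := by
        rw [hb]; simp only; split_ifs <;> omega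
      have := hZ _ _ hle hj
      simp only [hbe]
      omega
    · rcases Nat.eq_or_lt_of_le hle with heq | hlt
      · rw [heq] at hd hn
        omega
      · have hbe : b (u / R) = S + u / R - u₁ / R := by
          rw [hb]; simp only; split_ifs <;> omega
        have := hZ _ _ hle hj₁
        simp only [hbe]
        omega

/-- After phase 4 the zeros and the ones overlap by at most half a column on either side. -/
theorem diag_overlap {R S : ℕ} (hS : S * S ≤ R) {Z : ℕ → ℕ} {P3 P4 : ℕ → Prop}
    [DecidablePred P3] [DecidablePred P4]
    (hP : ∀ u < R * S, P3 u ↔ u % R < Z (u / R))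
    (hZ : ∀ c c', c ≤ c' → c' < S → Z c' ≤ Z c ∧ Z c ≤ Z c' + S)
    (h4 : ∀ t < R * S, P4 (diagPos R S t) ↔ P3 t) :
    (∀ p < R * S, P4 p → 2 * #{q ∈ range (R * S) | q < p ∧ ¬ P4 q} ≤ R) ∧
      ∀ p < R * S, ¬ P4 p → 2 * #{q ∈ range (R * S) | p < q ∧ P4 q} ≤ R := by
  have hSR : S * (S - 1) ≤ R := (Nat.mul_le_mul_left _ (Nat.sub_le _ _)).trans hS
  constructor
  · intro p hp hz
    obtain ⟨u, hu, rfl⟩ := exists_diagPos_eq hp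
    rw [h4 _ hu] at hz
    refine le_trans (Nat.mul_le_mul_left 2 ?_) ((card_ones_before hP hZ hu hz).trans hSR)
    refine le_trans (card_le_card ?_) (card_image_le (f := diagPos R S))
    intro q hq
    simp only [mem_filter, mem_range, mem_image] at hq ⊢
    obtain ⟨w, hw, rfl⟩ := exists_diagPos_eq hq.1
    rw [h4 _ hw, diagPos_lt_iff hw hu] at hq
    exact ⟨w, ⟨hw, hq.2⟩, rfl⟩
  · intro p hp hz
    obtain ⟨u, hu, rfl⟩ := exists_diagPos_eq hp
    rw [h4 _ hu] at hz
    refine le_trans (Nat.mul_le_mul_left 2 ?_) ((card_zeros_after hP hZ hu hz).trans hSR)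
    refine le_trans (card_le_card ?_) (card_image_le (f := diagPos R S))
    intro q hq
    simp only [mem_filter, mem_range, mem_image] at hq ⊢
    obtain ⟨w, hw, rfl⟩ := exists_diagPos_eq hq.1
    rw [h4 _ hw, diagPos_lt_iff hu hw] at hq
    exact ⟨w, ⟨hw, hq.2⟩, rfl⟩

/-- If zeros and ones overlap by at most half a column on either side then, after the columns have
been sorted, the zeros and ones are out of order only in the second half of some column and the
first half of the next one. -/
theorem overlap_sorted_columns {R S : ℕ} (hR : 0 < R) {P4 P5 : ℕ → Prop}
    [DecidablePred P4]
    (hz : ∀ p < R * S, P4 p → 2 * #{q ∈ range (R * S) | q < p ∧ ¬ P4 q} ≤ R)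
    (ho : ∀ p < R * S, ¬ P4 p → 2 * #{q ∈ range (R * S) | p < q ∧ P4 q} ≤ R)
    (h5 : ∀ c < S, ∀ i < R, P5 (c * R + i) ↔ i < #{i ∈ range R | P4 (c * R + i)}) :
    ∃ c, (∀ t < R * S, t / R < c → P5 t) ∧ (∀ t < R * S, c + 1 < t / R → ¬ P5 t) ∧
      ((∀ t < R * S, t / R = c + 1 → ¬ P5 t) ∨
        (∀ t < R * S, t / R = c → 2 * (t % R) < R → P5 t) ∧
          ∀ t < R * S, t / R = c + 1 → R ≤ 2 * (t % R) → ¬ P5 t) := by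
  have h5' : ∀ t < R * S, P5 t ↔ t % R < #{i ∈ range R | P4 (t / R * R + i)} := by
    intro t ht
    have := h5 (t / R) (Nat.div_lt_of_lt_mul ht) (t % R) (Nat.mod_lt _ hR)
    rwa [Nat.div_add_mod'] at this
  have allz : ∀ c < S, (∀ i < R, P4 (c * R + i)) → #{i ∈ range R | P4 (c * R + i)} = R := by
    intro c _ h
    rw [filter_true_of_mem (by simpa using h), card_range]
  have allo : ∀ c < S, (∀ i < R, ¬ P4 (c * R + i)) → #{i ∈ range R | P4 (c * R + i)} = 0 := by
    intro c _ h
    rw [card_eq_zero, filter_eq_empty_iff]; simpa using h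
  by_cases hone : ∃ p, p < R * S ∧ ¬ P4 p
  · classical
    set p := Nat.find hone with hpdef
    obtain ⟨hp, hn⟩ : p < R * S ∧ ¬ P4 p := Nat.find_spec hone
    have hmin : ∀ q < p, P4 q := by
      intro q hq
      by_contra hc
      exact Nat.find_min hone hq ⟨by omega, hc⟩
    have hpr : p = p / R * R + p % R := (Nat.div_add_mod' _ _).symm
    have hpm := Nat.mod_lt p hR
    have hz2 := ho p hp hn
    -- From the first one p to a zero q, every position is a one before q or a zero after p. There
    -- are at most R / 2 of each kind.
    have far : ∀ q < R * S, P4 q → q < p + R := by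
      intro q hq hqz
      by_contra hcon
      have h1 := hz q hq hqz
      have hsub : Icc p q ⊆ {w ∈ range (R * S) | w < q ∧ ¬ P4 w} ∪
          {w ∈ range (R * S) | p < w ∧ P4 w} := by
        intro w hw
        simp only [mem_Icc, mem_union, mem_filter, mem_range] at hw ⊢
        by_cases hwz : P4 w
        · right
          refine ⟨by omega, ?_, hwz⟩
          rcases Nat.eq_or_lt_of_le hw.1 with h | h
          · exact absurd (h ▸ hwz) hn
          · exact h
        · left
          refine ⟨by omega, ?_, hwz⟩
          rcases Nat.eq_or_lt_of_le hw.2 with h | h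
          · exact absurd (h ▸ hqz) hwz
          · exact h
      have := (card_le_card hsub).trans (card_union_le _ _)
      rw [Nat.card_Icc] at this
      omega
    refine ⟨p / R, ?_, ?_, ?_⟩
    · intro t ht htc
      rw [h5' t ht, allz _ (Nat.div_lt_of_lt_mul ht)]
      · exact Nat.mod_lt _ hR
      · intro i hi
        apply hmin
        have := Nat.mul_le_mul_right R htc
        rw [Nat.succ_mul] at this
        omega
    · intro t ht htc
      rw [h5' t ht, allo _ (Nat.div_lt_of_lt_mul ht)]
      · exact Nat.not_lt_zero _
      · intro i hi hc
        have := far _ (column_lt (Nat.div_lt_of_lt_mul ht) hi) hc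
        have := Nat.mul_le_mul_right R htc
        rw [Nat.succ_mul, Nat.succ_mul] at this
        omega
    · by_cases hex : ∃ q, q < R * S ∧ q / R = p / R + 1 ∧ P4 q
      · obtain ⟨q, hq, hqc, hqz⟩ := hex
        have hqr : q = p / R * R + R + q % R := by
          conv_lhs => rw [← Nat.div_add_mod' q R, hqc]
          ring
        right
        constructor
        · intro t ht htc hlt
          rw [h5' t ht, htc]
          have h1 := hz q hq hqz
          have h2 : #{i ∈ range R | ¬ P4 (p / R * R + i)} ≤
              #{w ∈ range (R * S) | w < q ∧ ¬ P4 w} := by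
            apply card_le_card_of_injOn (fun i => p / R * R + i)
            · intro i hi
              simp only [coe_filter, mem_range, Set.mem_ofPred_eq] at hi ⊢
              refine ⟨by omega, by omega, hi.2⟩
            · intro i _ j _ h
              simpa using h
          have h3 := card_filter_add_card_filter_not (s := range R) (fun i => P4 (p / R * R + i))
          rw [card_range] at h3
          omega
        · intro t ht htc hle
          rw [h5' t ht, htc]
          have h2 : #{i ∈ range R | P4 ((p / R + 1) * R + i)} ≤
              #{w ∈ range (R * S) | p < w ∧ P4 w} := by
            apply card_le_card_of_injOn (fun i => (p / R + 1) * R + i)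
            · intro i hi
              simp only [coe_filter, mem_range, Set.mem_ofPred_eq] at hi ⊢
              refine ⟨?_, ?_, hi.2⟩
              · rw [← htc]
                exact column_lt (Nat.div_lt_of_lt_mul ht) hi.1
              · rw [Nat.succ_mul]; omega
            · intro i _ j _ h
              simpa using h
          omega
      · left
        intro t ht htc
        rw [h5' t ht, allo _ (Nat.div_lt_of_lt_mul ht)]
        · exact Nat.not_lt_zero _
        · intro i hi hc
          exact hex ⟨_, column_lt (Nat.div_lt_of_lt_mul ht) hi, (column_div hi).trans htc, hc⟩
  · push Not at hone
    -- Without ones, a column index beyond the matrix leaves only the first condition to check.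
    refine ⟨S, ?_, ?_, Or.inl ?_⟩
    · intro t ht _
      rw [h5' t ht, allz _ (Nat.div_lt_of_lt_mul ht)]
      · exact Nat.mod_lt _ hR
      · intro i hi
        exact hone _ (column_lt (Nat.div_lt_of_lt_mul ht) hi)
    · intro t ht h
      have := Nat.div_lt_of_lt_mul ht
      omega
    · intro t ht h
      have := Nat.div_lt_of_lt_mul ht
      omega

/-- Phases 6 to 8 leave the zeros and ones sorted. -/
theorem shifted_columns_sorted {H S : ℕ} (hH : 0 < H) (hS : 0 < S) {P5 P6 P7 P8 : ℕ → Prop}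
    [DecidablePred P6]
    (h5 : ∀ c < S, ∀ i i', i < i' → i' < 2 * H → P5 (c * (2 * H) + i') → P5 (c * (2 * H) + i))
    (hc : ∃ c, (∀ t < 2 * H * S, t / (2 * H) < c → P5 t) ∧
      (∀ t < 2 * H * S, c + 1 < t / (2 * H) → ¬ P5 t) ∧
      ((∀ t < 2 * H * S, t / (2 * H) = c + 1 → ¬ P5 t) ∨
        (∀ t < 2 * H * S, t / (2 * H) = c → 2 * (t % (2 * H)) < 2 * H → P5 t) ∧
          ∀ t < 2 * H * S, t / (2 * H) = c + 1 → 2 * H ≤ 2 * (t % (2 * H)) → ¬ P5 t))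
    (h6 : ∀ t < 2 * H * S, P6 (shiftPos (2 * H) S t) ↔ P5 t)
    (h70 : ∀ i < 2 * H, P7 i ↔ P6 i)
    (h7 : ∀ c < S, c ≠ 0 → ∀ i < 2 * H, P7 (c * (2 * H) + i) ↔
      i < #{i ∈ range (2 * H) | P6 (c * (2 * H) + i)})
    (h8 : ∀ t < 2 * H * S, P8 (unshiftPos (2 * H) S t) ↔ P7 t) :
    ∀ t t', t < t' → t' < 2 * H * S → P8 t' → P8 t := by
  have hN : 2 * H ≤ 2 * H * S := Nat.le_mul_of_pos_right _ hS
  have half : 2 * H / 2 = H := by omega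
  have e6 : ∀ t, t + H < 2 * H * S → (P6 (t + H) ↔ P5 t) := by
    intro t ht
    rw [← h6 t (by omega), shiftPos, half, Nat.mod_eq_of_lt ht]
  have e6' : ∀ t, t < 2 * H * S → 2 * H * S ≤ t + H → (P6 (t + H - 2 * H * S) ↔ P5 t) := by
    intro t ht ht'
    rw [← h6 t (by omega), shiftPos, half, Nat.mod_eq_sub_mod ht', Nat.mod_eq_of_lt (by omega)]
  have e8 : ∀ t, t + H < 2 * H * S → (P8 t ↔ P7 (t + H)) := by
    intro t ht
    rw [← h8 _ ht, unshiftPos, half, show t + H + (2 * H * S - H) = t + 2 * H * S by omega,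
      Nat.add_mod_right, Nat.mod_eq_of_lt (by omega)]
  have e8' : ∀ t, t < 2 * H * S → 2 * H * S ≤ t + H → (P8 t ↔ P7 (t + H - 2 * H * S)) := by
    intro t ht ht'
    rw [← h8 _ (by omega : t + H - 2 * H * S < 2 * H * S), unshiftPos, half,
      show t + H - 2 * H * S + (2 * H * S - H) = t by omega, Nat.mod_eq_of_lt ht]
  -- The first shifted column consists of the last and the first half column of the original matrix.
  -- It passes through phase 7 unchanged, so phase 8 puts both halves back as they were.
  have hfirst : ∀ t < 2 * H * S, t < H → (P8 t ↔ P5 t) := by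
    intro t ht htH
    rw [e8 t (by omega), h70 _ (by omega), e6 t (by omega)]
  have hlast : ∀ t < 2 * H * S, 2 * H * S ≤ t + H → (P8 t ↔ P5 t) := by
    intro t ht htH
    rw [e8' t ht htH, h70 _ (by omega), e6' t ht htH]
  -- the columns of the shifted matrix
  have hcol : ∀ c < S, c ≠ 0 → ∀ i < 2 * H, H ≤ c * (2 * H) + i ∧
      c * (2 * H) + i - H + H < 2 * H * S := by
    intro c hc h0 i hi
    have h1 := column_lt (R := 2 * H) hc hi
    have h2 : 1 * (2 * H) ≤ c * (2 * H) := Nat.mul_le_mul_right _ (by omega)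
    omega
  have hmid : ∀ c < S, c ≠ 0 → ∀ i < 2 * H, P8 (c * (2 * H) + i - H) ↔
      i < #{i ∈ range (2 * H) | P6 (c * (2 * H) + i)} := by
    intro c hc h0 i hi
    obtain ⟨h1, h2⟩ := hcol c hc h0 i hi
    rw [e8 _ h2, Nat.sub_add_cancel h1, h7 c hc h0 i hi]
  have hP6 : ∀ c < S, c ≠ 0 → ∀ i < 2 * H, P6 (c * (2 * H) + i) ↔ P5 (c * (2 * H) + i - H) := by
    intro c hc h0 i hi
    obtain ⟨h1, h2⟩ := hcol c hc h0 i hi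
    rw [← e6 _ h2, Nat.sub_add_cancel h1]
  have hsame : ∀ c < S, c ≠ 0 → (∀ i i', i < i' → i' < 2 * H →
      P5 (c * (2 * H) + i' - H) → P5 (c * (2 * H) + i - H)) →
      ∀ i < 2 * H, P8 (c * (2 * H) + i - H) ↔ P5 (c * (2 * H) + i - H) := by
    intro c hc h0 hd i hi
    rw [hmid c hc h0 i hi, ← hP6 c hc h0 i hi]
    refine (iff_lt_card_of_downward (P := fun i => P6 (c * (2 * H) + i)) ?_ hi).symm
    intro t t' htt ht' h
    rw [hP6 c hc h0 _ (by omega)]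
    rw [hP6 c hc h0 _ (by omega)] at h
    exact hd t t' htt ht' h
  have hdm : ∀ c < S, ∀ t < 2 * H * S, H ≤ t → t + H < 2 * H * S → (t + H) / (2 * H) = c →
      c ≠ 0 ∧ ∃ i < 2 * H, t = c * (2 * H) + i - H := by
    intro c hc t ht h1 h2 h3
    refine ⟨?_, (t + H) % (2 * H), Nat.mod_lt _ (by omega), ?_⟩
    · rintro rfl
      rw [Nat.div_eq_zero_iff] at h3
      omega
    · rw [← h3, Nat.div_add_mod']; omega
  -- location of a position, from its location in the shifted matrix
  have loc : ∀ t < 2 * H * S, (t / (2 * H) = (t + H) / (2 * H) ∧ t % (2 * H) < H) ∨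
      (t / (2 * H) + 1 = (t + H) / (2 * H) ∧ H ≤ t % (2 * H)) := by
    intro t ht
    have hm := Nat.mod_lt t (show 2 * H > 0 by omega)
    have he := Nat.div_add_mod' t (2 * H)
    rcases Nat.lt_or_ge (t % (2 * H)) H with h | h
    · left
      refine ⟨?_, h⟩
      have := column_div (R := 2 * H) (c := t / (2 * H)) (i := t % (2 * H) + H) (by omega)
      rw [← this]; congr 1; omega
    · right
      refine ⟨?_, h⟩
      have := column_div (R := 2 * H) (c := t / (2 * H) + 1) (i := t % (2 * H) - H) (by omega)
      rw [← this]; congr 1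
      rw [Nat.succ_mul]; omega
  obtain ⟨c, hlo, hhi, hcase⟩ := hc
  rcases hcase with hsort | ⟨ha, hb⟩
  · -- already sorted
    have hd5 : ∀ t t', t < t' → t' < 2 * H * S → P5 t' → P5 t := by
      intro t t' htt ht' h
      have h1 : t' / (2 * H) ≤ c := by
        by_contra hcon
        rcases Nat.lt_or_ge (c + 1) (t' / (2 * H)) with h' | h'
        · exact hhi _ ht' h' h
        · exact hsort _ ht' (by omega) h
      rcases Nat.lt_or_ge (t / (2 * H)) c with h2 | h2
      · exact hlo t (by omega) h2
      · have h3 : t / (2 * H) = t' / (2 * H) :=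
          le_antisymm (Nat.div_le_div_right htt.le) (by omega)
        have ht1 := Nat.div_add_mod' t (2 * H)
        have ht2 := Nat.div_add_mod' t' (2 * H)
        rw [← ht1, h3]
        rw [← ht2] at h
        rw [← h3] at ht2
        exact h5 _ (Nat.div_lt_of_lt_mul ht') _ _ (by omega) (Nat.mod_lt _ (by omega)) h
    have hall : ∀ t < 2 * H * S, P8 t ↔ P5 t := by
      intro t ht
      rcases Nat.lt_or_ge t H with h1 | h1
      · exact hfirst t ht h1
      rcases Nat.lt_or_ge (t + H) (2 * H * S) with h2 | h2
      · obtain ⟨h0, i, hi, hti⟩ := hdm _ (Nat.div_lt_of_lt_mul h2) t ht h1 h2 rfl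
        rw [hti]
        refine hsame _ (Nat.div_lt_of_lt_mul h2) h0 ?_ i hi
        intro i i' hii hi' h
        have q1 := hcol _ (Nat.div_lt_of_lt_mul h2) h0 i (by omega)
        have q2 := hcol _ (Nat.div_lt_of_lt_mul h2) h0 i' (by omega)
        exact hd5 _ _ (by omega) (by omega) h
      · exact hlast t ht h2
    intro t t' htt ht' h
    rw [hall _ (by omega)]
    rw [hall _ ht'] at h
    exact hd5 t t' htt ht' h
  · -- out of order only around the boundary of columns `c` and `c + 1`
    have hlow : ∀ t < 2 * H * S, (t + H) / (2 * H) ≤ c → P5 t := by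
      intro t ht h
      rcases loc t ht with ⟨h1, h2⟩ | ⟨h1, h2⟩
      · rcases Nat.lt_or_ge (t / (2 * H)) c with h3 | h3
        · exact hlo t ht h3
        · exact ha t ht (by omega) (by omega)
      · exact hlo t ht (by omega)
    have hhigh : ∀ t < 2 * H * S, c + 1 < (t + H) / (2 * H) → ¬ P5 t := by
      intro t ht h
      rcases loc t ht with ⟨h1, h2⟩ | ⟨h1, h2⟩
      · exact hhi t ht (by omega)
      · rcases Nat.lt_or_ge (c + 1) (t / (2 * H)) with h3 | h3
        · exact hhi t ht h3
        · exact hb t ht (by omega) (by omega)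
    -- Every shifted column with nonzero index other than c + 1 is constant, so sorting it changes
    -- nothing; the wrapped column is covered by `hfirst` and `hlast`.
    have hoff : ∀ t < 2 * H * S, (t + H) / (2 * H) ≠ c + 1 → (P8 t ↔ P5 t) := by
      intro t ht hne
      rcases Nat.lt_or_ge t H with h1 | h1
      · exact hfirst t ht h1
      rcases Nat.lt_or_ge (t + H) (2 * H * S) with h2 | h2
      · have hSc := Nat.div_lt_of_lt_mul h2
        obtain ⟨h0, i, hi, hti⟩ := hdm _ hSc t ht h1 h2 rfl
        rw [hti]
        refine hsame _ hSc h0 ?_ i hi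
        have hblk : ∀ i < 2 * H, ((t + H) / (2 * H) * (2 * H) + i - H) < 2 * H * S ∧
            ((t + H) / (2 * H) * (2 * H) + i - H + H) / (2 * H) = (t + H) / (2 * H) := by
          intro i hi
          obtain ⟨q1, q2⟩ := hcol _ hSc h0 i hi
          refine ⟨by omega, ?_⟩
          rw [Nat.sub_add_cancel q1, column_div hi]
        intro i i' hii hi' h
        obtain ⟨q1, q2⟩ := hblk i (by omega)
        obtain ⟨q3, q4⟩ := hblk i' hi'
        rcases Nat.lt_or_ge c ((t + H) / (2 * H)) with h3 | h3
        · exact absurd h (hhigh _ q3 (by rw [q4]; omega))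
        · exact hlow _ q1 (by rw [q2]; omega)
      · exact hlast t ht h2
    intro t t' htt ht' h
    have hmono : (t + H) / (2 * H) ≤ (t' + H) / (2 * H) := Nat.div_le_div_right (by omega)
    rcases Nat.lt_trichotomy ((t' + H) / (2 * H)) (c + 1) with h1 | h1 | h1
    · rw [hoff t (by omega) (by omega)]
      exact hlow t (by omega) (by omega)
    · rcases Nat.lt_or_ge ((t + H) / (2 * H)) (c + 1) with h2 | h2
      · rw [hoff t (by omega) (by omega)]
        exact hlow t (by omega) (by omega)
      · have h3 : (t + H) / (2 * H) = c + 1 := by omega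
        have hHt : H ≤ t := by
          by_contra hcon
          have : (t + H) / (2 * H) = 0 := Nat.div_eq_of_lt (by omega)
          omega
        rcases Nat.lt_or_ge (t' + H) (2 * H * S) with h4 | h4
        · have hcS : c + 1 < S := by rw [← h1]; exact Nat.div_lt_of_lt_mul h4
          obtain ⟨h0, i, hi, rfl⟩ := hdm _ hcS t (by omega) hHt (by omega) h3
          obtain ⟨_, i', hi', rfl⟩ := hdm _ hcS t' ht' (by omega) h4 h1
          rw [hmid _ hcS h0 _ hi]
          rw [hmid _ hcS h0 _ hi'] at h
          omega
        · -- the second half of the last column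
          have hS1 : c + 1 = S := by
            apply le_antisymm
            · rw [← h1]
              have : (t' + H) / (2 * H) < S + 1 := by
                apply Nat.div_lt_of_lt_mul
                rw [Nat.mul_add]; omega
              omega
            · rw [← h1, Nat.le_div_iff_mul_le (by omega)]
              linarith [Nat.mul_comm S (2 * H)]
          have h5t : 2 * H * S ≤ t + H := by
            rw [Nat.div_eq_iff (by omega)] at h3
            rw [← hS1]
            linarith [h3.1, Nat.mul_comm (2 * H) (c + 1)]
          rw [hlast t (by omega) h5t]
          rw [hlast t' ht' h4] at h
          have d1 : t / (2 * H) = c := by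
            rcases loc t (by omega) with ⟨q, _⟩ | ⟨q, _⟩
            · have := Nat.div_lt_of_lt_mul (show t < 2 * H * S by omega)
              omega
            · omega
          have d2 : t' / (2 * H) = c := by
            rcases loc t' (by omega) with ⟨q, _⟩ | ⟨q, _⟩
            · have := Nat.div_lt_of_lt_mul ht'
              omega
            · omega
          have ht1 := Nat.div_add_mod' t (2 * H)
          have ht2 := Nat.div_add_mod' t' (2 * H)
          rw [d1] at ht1
          rw [d2] at ht2
          rw [← ht1]
          rw [← ht2] at h
          exact h5 c (by omega) _ _ (by omega) (Nat.mod_lt _ (by omega)) h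
    · rw [hoff t' ht' (by omega)] at h
      exact absurd h (hhigh t' ht' (by omega))

/-- Columnsort, for keys compared with a threshold: `P t` says that the key at position `t` is
smaller than the threshold. -/
theorem columnsort_threshold {R' H S : ℕ} (hS0 : 0 < S) (hRH : S * R' = 2 * H)
    (hH : 0 < H) (hS : S * S ≤ 2 * H) {P1 P2 P3 P4 P5 P6 P7 P8 : ℕ → Prop}
    [DecidablePred P2] [DecidablePred P4] [DecidablePred P6]
    (h1 : ∀ c < S, ∃ z, ∀ i < 2 * H, P1 (c * (2 * H) + i) ↔ i < z)
    (h2 : ∀ t < 2 * H * S, P2 (transposePos (2 * H) S t) ↔ P1 t)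
    (h3 : ∀ c < S, ∀ i < 2 * H, P3 (c * (2 * H) + i) ↔
      i < #{i ∈ range (2 * H) | P2 (c * (2 * H) + i)})
    (h4 : ∀ t < 2 * H * S, P4 (diagPos (2 * H) S t) ↔ P3 t)
    (h5 : ∀ c < S, ∀ i < 2 * H, P5 (c * (2 * H) + i) ↔
      i < #{i ∈ range (2 * H) | P4 (c * (2 * H) + i)})
    (h6 : ∀ t < 2 * H * S, P6 (shiftPos (2 * H) S t) ↔ P5 t)
    (h70 : ∀ i < 2 * H, P7 i ↔ P6 i)
    (h7 : ∀ c < S, c ≠ 0 → ∀ i < 2 * H, P7 (c * (2 * H) + i) ↔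
      i < #{i ∈ range (2 * H) | P6 (c * (2 * H) + i)})
    (h8 : ∀ t < 2 * H * S, P8 (unshiftPos (2 * H) S t) ↔ P7 t) :
    ∀ t t', t < t' → t' < 2 * H * S → P8 t' → P8 t := by
  classical
  have hZ : ∀ c c', c ≤ c' → c' < S → _ := fun c c' hcc hc' =>
    transpose_counts (R' := R') (by rw [hRH]; exact h1) (by rw [hRH]; exact h2) hcc hc'
  rw [hRH] at hZ
  obtain ⟨hz, ho⟩ := diag_overlap (R := 2 * H) (S := S) hS (P3 := P3) (P4 := P4)
    (Z := fun c => #{i ∈ range (2 * H) | P2 (c * (2 * H) + i)}) (fun u hu => by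
      have := h3 (u / (2 * H)) (Nat.div_lt_of_lt_mul hu) (u % (2 * H)) (Nat.mod_lt _ (by omega))
      rwa [Nat.div_add_mod'] at this) hZ h4
  refine shifted_columns_sorted hH hS0 ?_
    (overlap_sorted_columns (by omega) hz ho h5) h6 h70 h7 h8
  intro c hc i i' hii hi' h
  rw [h5 c hc _ (by omega)]
  rw [h5 c hc _ hi'] at h
  omega

/-! ### Block permutations -/

/-- A permutation of the positions that preserves all segments of length `2 ^ m`. -/
def BlockPerm (m : ℕ) (σ : Equiv.Perm ℕ) : Prop := ∀ t, σ t / 2 ^ m = t / 2 ^ m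

/-- Every segment of length `2 ^ m` is sorted. -/
def BlockSorted {α : Type*} [LE α] (m : ℕ) (g : ℕ → α) : Prop :=
  ∀ p p', p ≤ p' → p / 2 ^ m = p' / 2 ^ m → g p ≤ g p'

theorem div_two_pow_of_le {m m' p q : ℕ} (h : m ≤ m') (hpq : p / 2 ^ m = q / 2 ^ m) :
    p / 2 ^ m' = q / 2 ^ m' := by
  obtain ⟨d, rfl⟩ := Nat.exists_eq_add_of_le h
  rw [pow_add, ← Nat.div_div_eq_div_mul, ← Nat.div_div_eq_div_mul, hpq]

theorem lt_two_pow_of_div_eq {m k p q : ℕ} (h : m ≤ k) (hpq : p / 2 ^ m = q / 2 ^ m)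
    (hq : q < 2 ^ k) : p < 2 ^ k := by
  have := div_two_pow_of_le h hpq
  rw [Nat.div_eq_of_lt hq, Nat.div_eq_zero_iff] at this
  rcases this with h | h
  · simp at h
  · exact h

theorem div_eq_of_dvd_add {N b i : ℕ} (hb : N ∣ b) (hi : i < N) : (b + i) / N = b / N := by
  obtain ⟨d, rfl⟩ := hb
  rw [Nat.mul_comm N d, column_div hi, Nat.mul_div_cancel _ (by omega)]

theorem exists_add_of_div_eq {N b p : ℕ} (hN : 0 < N) (hb : N ∣ b) (h : p / N = b / N) :
    ∃ i < N, p = b + i := by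
  obtain ⟨d, rfl⟩ := hb
  refine ⟨p % N, Nat.mod_lt _ hN, ?_⟩
  rw [Nat.mul_div_cancel_left _ hN] at h
  rw [← h, Nat.div_add_mod]

namespace BlockPerm

variable {m : ℕ} {σ τ : Equiv.Perm ℕ}

theorem mono (h : BlockPerm m σ) {m' : ℕ} (hm : m ≤ m') : BlockPerm m' σ := fun t =>
  div_two_pow_of_le hm (h t)

theorem symm (h : BlockPerm m σ) : BlockPerm m σ.symm := fun t => by
  rw [← h (σ.symm t), Equiv.apply_symm_apply]

theorem mul (h : BlockPerm m σ) (h' : BlockPerm m τ) : BlockPerm m (σ * τ) := fun t => by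
  rw [Equiv.Perm.mul_apply, h, h']

theorem lt (h : BlockPerm m σ) {k t : ℕ} (hm : m ≤ k) (ht : t < 2 ^ k) : σ t < 2 ^ k :=
  lt_two_pow_of_div_eq hm (h t) ht

/-- The permutation and its inverse both stay inside the segment that starts at b. This is why the
zeros of a sorted column can be counted before the sorting. -/
theorem card_filter (h : BlockPerm m σ) (P : ℕ → Prop) [DecidablePred P] {b : ℕ}
    (hb : 2 ^ m ∣ b) :
    #{i ∈ range (2 ^ m) | P (σ (b + i))} = #{i ∈ range (2 ^ m) | P (b + i)} := by
  have hN : 0 < 2 ^ m := by positivity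
  have key : ∀ ρ : Equiv.Perm ℕ, BlockPerm m ρ → ∀ i < 2 ^ m,
      ρ (b + i) - b < 2 ^ m ∧ b + (ρ (b + i) - b) = ρ (b + i) := by
    intro ρ hρ i hi
    obtain ⟨j, hj, he⟩ := exists_add_of_div_eq hN hb ((hρ (b + i)).trans (div_eq_of_dvd_add hb hi))
    rw [he]; omega
  refine card_nbij' (fun i => σ (b + i) - b) (fun i => σ.symm (b + i) - b) ?_ ?_ ?_ ?_
  · intro i hi
    simp only [coe_filter, mem_range, Set.mem_ofPred_eq] at hi ⊢
    obtain ⟨h1, h2⟩ := key σ h i hi.1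
    rw [h2]; exact ⟨h1, hi.2⟩
  · intro i hi
    simp only [coe_filter, mem_range, Set.mem_ofPred_eq] at hi ⊢
    obtain ⟨h1, h2⟩ := key _ h.symm i hi.1
    rw [h2, Equiv.apply_symm_apply]; exact ⟨h1, hi.2⟩
  · intro i hi
    simp only [coe_filter, mem_range, Set.mem_ofPred_eq] at hi
    obtain ⟨h1, h2⟩ := key σ h i hi.1
    simp only [h2, Equiv.symm_apply_apply]; omega
  · intro i hi
    simp only [coe_filter, mem_range, Set.mem_ofPred_eq] at hi
    obtain ⟨h1, h2⟩ := key _ h.symm i hi.1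
    simp only [h2, Equiv.apply_symm_apply]; omega

/-- In a sorted segment, the keys below a threshold come first. -/
theorem lt_iff {α : Type*} [LinearOrder α] (h : BlockPerm m σ) {g : ℕ → α} {b : ℕ}
    (hb : 2 ^ m ∣ b)
    (hs : ∀ i j, i < j → j < 2 ^ m → g (σ (b + i)) ≤ g (σ (b + j))) (y : α)
    {t : ℕ} (ht : t < 2 ^ m) :
    g (σ (b + t)) < y ↔ t < #{i ∈ range (2 ^ m) | g (b + i) < y} := by
  rw [← h.card_filter (fun p => g p < y) hb]
  apply iff_lt_card_of_downward (P := fun i => g (σ (b + i)) < y) _ ht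
  intro i j hij hj hy
  exact (hs i j hij hj).trans_lt hy

/-- Sorting a sorted segment changes nothing. -/
theorem apply_eq_of_sorted {α : Type*} [LinearOrder α] (h : BlockPerm m σ) {g : ℕ → α} {b : ℕ}
    (hb : 2 ^ m ∣ b) (hs : ∀ i j, i < j → j < 2 ^ m → g (σ (b + i)) ≤ g (σ (b + j)))
    (hs' : ∀ i j, i < j → j < 2 ^ m → g (b + i) ≤ g (b + j)) {t : ℕ} (ht : t < 2 ^ m) :
    g (σ (b + t)) = g (b + t) := by
  -- By `lt_iff` the same number of keys decides both comparisons with y; two elements of a linear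
  -- order that lie below the same thresholds are equal.
  have key : ∀ y, g (σ (b + t)) < y ↔ g (b + t) < y := fun y =>
    (h.lt_iff hb hs y ht).trans
      (lt_iff (σ := 1) (fun _ => rfl) hb (g := g) (by simpa using hs') y ht).symm
  exact le_antisymm (not_lt.1 fun hlt => lt_irrefl _ ((key _).2 hlt))
    (not_lt.1 fun hlt => lt_irrefl _ ((key _).1 hlt))

end BlockPerm

theorem BlockSorted.add {α : Type*} [LE α] {m : ℕ} {g : ℕ → α} (h : BlockSorted m g) {b : ℕ}
    (hb : 2 ^ m ∣ b) (i j : ℕ) (hij : i < j) (hj : j < 2 ^ m) : g (b + i) ≤ g (b + j) :=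
  h _ _ (by omega) (by rw [div_eq_of_dvd_add hb hj, div_eq_of_dvd_add hb (by omega)])

/-- All segments of a given length can be sorted. -/
theorem exists_blockSorted {α : Type*} [LinearOrder α] (m : ℕ) (g : ℕ → α) :
    ∃ σ, BlockPerm m σ ∧ BlockSorted m (g ∘ σ) := by
  have hN : 0 < 2 ^ m := by positivity
  let ρ : ℕ → Equiv.Perm (Fin (2 ^ m)) := fun q => Tuple.sort fun t => g (q * 2 ^ m + t)
  -- Splitting a position into segment and offset glues the sorting permutations of the single
  -- segments into one permutation of ℕ.
  let e := Nat.divModEquiv (2 ^ m)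
  let σ : Equiv.Perm ℕ := (e.trans (Equiv.prodShear (Equiv.refl ℕ) ρ)).trans e.symm
  have hσ : ∀ p, σ p = p / 2 ^ m * 2 ^ m + (ρ (p / 2 ^ m) ⟨p % 2 ^ m, Nat.mod_lt _ hN⟩ : Fin _) := by
    intro p
    simp only [σ, e, Equiv.trans_apply, Equiv.prodShear_apply, Nat.divModEquiv_apply,
      Nat.divModEquiv_symm_apply, Equiv.refl_apply]
    have : (Fin.ofNat (2 ^ m) p) = ⟨p % 2 ^ m, Nat.mod_lt _ hN⟩ := rfl
    rw [← this]
  refine ⟨σ, ?_, ?_⟩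
  · intro p
    rw [hσ, column_div (Fin.isLt _)]
  · intro p p' hpp hq
    simp only [Function.comp, hσ, hq]
    have hm := Tuple.monotone_sort fun t : Fin (2 ^ m) => g (p' / 2 ^ m * 2 ^ m + t)
    apply hm
    rw [Fin.le_def]
    have h1 := Nat.div_add_mod p (2 ^ m)
    have h2 := Nat.div_add_mod p' (2 ^ m)
    rw [hq] at h1
    simp only
    omega

theorem target_add {m q t : ℕ} {f : ℕ → ℕ} (ht : t < 2 ^ m) :
    target m f (q * 2 ^ m + t) = q * 2 ^ m + f t := by
  rw [target, column_div ht, column_mod ht]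

/-- A permutation of a segment, applied to all segments. -/
theorem exists_perm_target {m : ℕ} {f : ℕ → ℕ} (hf : ∀ t < 2 ^ m, f t < 2 ^ m)
    (hi : Set.InjOn f (Set.Iio (2 ^ m))) :
    ∃ τ : Equiv.Perm ℕ, BlockPerm m τ ∧ ∀ r, τ r = target m f r := by
  have hN : 0 < 2 ^ m := by positivity
  have hd : ∀ r, target m f r / 2 ^ m = r / 2 ^ m := fun r =>
    column_div (hf _ (Nat.mod_lt _ hN))
  have hm : ∀ r, target m f r % 2 ^ m = f (r % 2 ^ m) := fun r =>
    column_mod (hf _ (Nat.mod_lt _ hN))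
  have hb : Function.Bijective (target m f) := by
    constructor
    · intro r r' h
      have h1 : r / 2 ^ m = r' / 2 ^ m := 
        (hd r).symm.trans ((congrArg (· / 2 ^ m) h).trans (hd r'))
      have h2 : r % 2 ^ m = r' % 2 ^ m :=
        hi (Nat.mod_lt _ hN) (Nat.mod_lt _ hN) (by rw [← hm, ← hm, h])
      rw [← Nat.div_add_mod r (2 ^ m), ← Nat.div_add_mod r' (2 ^ m), h1, h2]
    · intro p
      obtain ⟨t, ht, he⟩ := surj_on_of_inj_on_of_card_le (s := range (2 ^ m)) (t := range (2 ^ m))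
        (fun u _ => f u) (fun u hu => by simpa using hf u (by simpa using hu))
        (fun a b ha hb h => hi (by simpa using ha) (by simpa using hb) h) le_rfl (p % 2 ^ m)
        (by simpa using Nat.mod_lt _ hN)
      refine ⟨p / 2 ^ m * 2 ^ m + t, ?_⟩
      rw [target_add (by simpa using ht), ← he, Nat.div_add_mod']
  exact ⟨Equiv.ofBijective _ hb, hd, fun r => rfl⟩

/-! ### Comparison trees -/

namespace CompTree

variable {n : ℕ} {α β K : Type} [LinearOrder K] (x : Fin n → K)

theorem eval_bind (t : CompTree n α) (f : α → CompTree n β) :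
    (t.bind f).eval x = (f (t.eval x)).eval x := by
  induction t with
  | done a => rfl
  | cmp i j t e iht ihe => simp only [bind, eval]; split_ifs <;> assumption

theorem path_bind (t : CompTree n α) (f : α → CompTree n β) :
    (t.bind f).path x = t.path x ++ (f (t.eval x)).path x := by
  induction t with
  | done a => rfl
  | cmp i j t e iht ihe =>
    simp only [bind, eval, path, List.cons_append]
    split_ifs
    · rw [iht]
    · rw [ihe]

end CompTree

/-- The value of a tagged key. -/
def val {n : ℕ} {K : Type} (x : Fin n → K) (a : Fin n × List Bool) : List Bool ×ₗ K :=
  toLex (a.2, x a.1)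

theorem val_injective {n : ℕ} {K : Type} {x : Fin n → K} (hx : Function.Injective x) :
    Function.Injective (val x) := by
  intro a b h
  have h' : (a.2, x a.1) = (b.2, x b.1) := toLex.injective h
  simp only [Prod.mk.injEq] at h'
  exact Prod.ext (hx h'.2) h'.1

/-! ### Local insertion sort of tagged keys. -/

section Sorting

variable {n : ℕ} {K : Type} [LinearOrder K] (x : Fin n → K)

theorem tagLt_iff (s t : List Bool) : tagLt s t = true ↔ s < t := by
  induction s generalizing t with
  | nil => cases t <;> simp [tagLt]
  | cons a s ih =>
    cases t with
    | nil => simp [tagLt]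
    | cons b t =>
      rw [tagLt, List.cons_lt_cons_iff]
      split_ifs with h
      · simp [h, ih]
      · cases a <;> cases b <;> simp_all

theorem eval_less (a b : Fin n × List Bool) : (less a b).eval x = true ↔ val x a < val x b := by
  rw [val, val, Prod.Lex.toLex_lt_toLex, less]
  split_ifs with h
  · simp [CompTree.eval, h]
  · simp [CompTree.eval, tagLt_iff, h]

theorem path_less_length (a b : Fin n × List Bool) : ((less a b).path x).length ≤ 1 := by
  rw [less]
  split_ifs <;> simp [CompTree.path]

theorem mem_path_less {a b : Fin n × List Bool} {ij : Fin n × Fin n}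
    (h : ij ∈ (less a b).path x) : ij = (a.1, b.1) := by
  rw [less] at h
  split_ifs at h
  · simpa [CompTree.path] using h
  · simp [CompTree.path] at h

theorem insertKey_perm (a : Fin n × List Bool) (l : List (Fin n × List Bool)) :
    ((insertKey a l).eval x).Perm (a :: l) := by
  induction l with
  | nil => exact List.Perm.refl _
  | cons b l ih =>
    rw [insertKey, CompTree.eval_bind]
    split_ifs
    · exact List.Perm.refl _
    · rw [CompTree.eval_bind]
      exact (List.Perm.cons b ih).trans (List.Perm.swap a b l)

theorem insertKey_sorted (a : Fin n × List Bool) {l : List (Fin n × List Bool)}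
    (hl : l.Pairwise fun a b => val x a ≤ val x b) :
    ((insertKey a l).eval x).Pairwise fun a b => val x a ≤ val x b := by
  induction l with
  | nil => simp [insertKey, CompTree.eval]
  | cons b l ih =>
    rw [insertKey, CompTree.eval_bind]
    rw [List.pairwise_cons] at hl
    split_ifs with h
    · rw [eval_less] at h
      simp only [CompTree.eval, List.pairwise_cons]
      refine ⟨?_, hl.1, hl.2⟩
      intro c hc
      rcases List.mem_cons.1 hc with rfl | hc
      · exact h.le
      · exact h.le.trans (hl.1 c hc)
    · rw [eval_less, not_lt] at h
      rw [CompTree.eval_bind]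
      simp only [CompTree.eval, List.pairwise_cons]
      refine ⟨?_, ih hl.2⟩
      intro c hc
      rcases List.mem_cons.1 ((insertKey_perm x a l).mem_iff.1 hc) with rfl | hc
      · exact h
      · exact hl.1 c hc

theorem sortKeys_perm (l : List (Fin n × List Bool)) : ((sortKeys l).eval x).Perm l := by
  induction l with
  | nil => exact List.Perm.refl _
  | cons a l ih =>
    rw [sortKeys, CompTree.eval_bind]
    exact (insertKey_perm x a _).trans (List.Perm.cons a ih)

theorem sortKeys_sorted (l : List (Fin n × List Bool)) :
    ((sortKeys l).eval x).Pairwise fun a b => val x a ≤ val x b := by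
  induction l with
  | nil => exact List.Pairwise.nil
  | cons a l ih =>
    rw [sortKeys, CompTree.eval_bind]
    exact insertKey_sorted x a ih

theorem insertKey_path_length (a : Fin n × List Bool) (l : List (Fin n × List Bool)) :
    ((insertKey a l).path x).length ≤ l.length := by
  induction l with
  | nil => simp [insertKey, CompTree.path]
  | cons b l ih =>
    rw [insertKey, CompTree.path_bind, List.length_append]
    have := path_less_length x a b
    have : (CompTree.path x (if (less a b).eval x = true then CompTree.done (a :: b :: l)
        else (insertKey a l).bind fun l' => .done (b :: l'))).length ≤ l.length := by
      split_ifs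
      · simp [CompTree.path]
      · rw [CompTree.path_bind]; simpa [CompTree.path] using ih
    simp only [List.length_cons]
    omega

/-- The crude square suffices: at most four keys are ever sorted locally, which is the origin of the
bound 16 in `StepOK`. -/
theorem sortKeys_path_length (l : List (Fin n × List Bool)) :
    ((sortKeys l).path x).length ≤ l.length * l.length := by
  induction l with
  | nil => simp [sortKeys, CompTree.path]
  | cons a l ih =>
    rw [sortKeys, CompTree.path_bind, List.length_append]
    have h := insertKey_path_length x a ((sortKeys l).eval x)
    rw [(sortKeys_perm x l).length_eq] at h
    simp only [List.length_cons]
    nlinarith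

theorem mem_insertKey_path (a : Fin n × List Bool) (l : List (Fin n × List Bool))
    {ij : Fin n × Fin n} (h : ij ∈ (insertKey a l).path x) :
    ij.1 = a.1 ∧ ij.2 ∈ l.map Prod.fst := by
  induction l with
  | nil => simp [insertKey, CompTree.path] at h
  | cons b l ih =>
    rw [insertKey, CompTree.path_bind, List.mem_append] at h
    rcases h with h | h
    · rw [mem_path_less x h]; simp
    · split_ifs at h
      · simp [CompTree.path] at h
      · rw [CompTree.path_bind] at h
        simp only [CompTree.path, List.append_nil] at h
        have := ih h
        exact ⟨this.1, by simp only [List.map_cons, List.mem_cons]; exact Or.inr this.2⟩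

theorem mem_sortKeys_path (l : List (Fin n × List Bool)) {ij : Fin n × Fin n}
    (h : ij ∈ (sortKeys l).path x) : ij.1 ∈ l.map Prod.fst ∧ ij.2 ∈ l.map Prod.fst := by
  induction l with
  | nil => simp [sortKeys, CompTree.path] at h
  | cons a l ih =>
    rw [sortKeys, CompTree.path_bind, List.mem_append] at h
    simp only [List.map_cons, List.mem_cons]
    rcases h with h | h
    · exact ⟨Or.inr (ih h).1, Or.inr (ih h).2⟩
    · have := mem_insertKey_path x a _ h
      refine ⟨Or.inl this.1, Or.inr ?_⟩
      exact ((sortKeys_perm x l).map Prod.fst).mem_iff.1 this.2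

end Sorting

/-! ### Traces -/

section Trace

variable {n v : ℕ} {D K : Type} [LinearOrder K] (x : Fin n → K)

/-- The supersteps of an execution, with the configurations in which they start. -/
def trace : List (Superstep n v D) → Config n v D → List (Superstep n v D × Config n v D)
  | [], _ => []
  | S :: l, c => (S, c) :: trace l (S.exec x c)

/-- The final configuration. -/
def finalConfig (l : List (Superstep n v D)) (c : Config n v D) : Config n v D :=
  l.foldl (fun c S => S.exec x c) c

theorem trace_append (l l' : List (Superstep n v D)) (c : Config n v D) :
    trace x (l ++ l') c = trace x l c ++ trace x l' (finalConfig x l c) := by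
  induction l generalizing c with
  | nil => rfl
  | cons S l ih => simp [trace, ih, finalConfig]

theorem finalConfig_append (l l' : List (Superstep n v D)) (c : Config n v D) :
    finalConfig x (l ++ l') c = finalConfig x l' (finalConfig x l c) := by
  simp [finalConfig]

/-- The definitions index supersteps by time, whereas inductions run over the list of supersteps;
this identity translates between the two. -/
theorem ofFn_eq_trace (l : List (Superstep n v D)) (c : Config n v D) :
    List.ofFn (fun t : Fin l.length => (l.get t, finalConfig x (l.take t) c)) = trace x l c := by
  induction l generalizing c with
  | nil => rfl
  | cons S l ih =>
    rw [trace, ← ih]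
    simp only [List.length_cons, List.ofFn_succ]
    rfl

theorem run_eq (A : StaticAlgorithm n v) (t : ℕ) :
    A.run x t = finalConfig x (A.steps.take t) A.init := rfl

theorem run_length (A : StaticAlgorithm n v) :
    A.run x A.steps.length = finalConfig x A.steps A.init := by
  rw [run_eq, List.take_length]

theorem mem_trace (A : StaticAlgorithm n v) (t : Fin A.steps.length) :
    (A.steps.get t, A.run x t) ∈ trace x A.steps A.init := by
  rw [← ofFn_eq_trace, List.mem_ofFn]
  exact ⟨t, rfl⟩

theorem exists_of_mem_trace (A : StaticAlgorithm n v) {p : Superstep n v A.Data × Config n v A.Data}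
    (h : p ∈ trace x A.steps A.init) :
    ∃ t : Fin A.steps.length, p = (A.steps.get t, A.run x t) := by
  rw [← ofFn_eq_trace, List.mem_ofFn] at h
  obtain ⟨t, rfl⟩ := h
  exact ⟨t, rfl⟩

theorem sum_eq_trace_sum (A : StaticAlgorithm n v)
    (F : Superstep n v A.Data × Config n v A.Data → ℕ) :
    ∑ t : Fin A.steps.length, F (A.steps.get t, A.run x t) =
      ((trace x A.steps A.init).map F).sum := by
  rw [← ofFn_eq_trace, List.map_ofFn, List.sum_ofFn]
  rfl

end Trace

/-! ### Executions on tagged keys -/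

/-- A memory holding the given tagged keys. -/
def pack {n : ℕ} (l : List (Fin n × List Bool)) : Store n Tags := ⟨l.map Prod.fst, l.map Prod.snd⟩

theorem zip_pack {n : ℕ} (l : List (Fin n × List Bool)) : (pack l).keys.zip (pack l).data = l := by
  simp [pack, List.zip_map']

/-- The configuration in which the `r`-th processing element holds the tagged keys `L r`. -/
def packed {n v : ℕ} (L : ℕ → List (Fin n × List Bool)) : Config n v Tags := fun r => pack (L r)

section Exec

variable {n v : ℕ} {K : Type} [LinearOrder K] (x : Fin n → K)

theorem exec_eq_packed {S : Superstep n v Tags} (hS : S.recv = appendTags) {c : Config n v Tags}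
    {A : Fin v → List (Fin n × List Bool)} {M : Fin v → Fin v → ℕ → List (Fin n × List Bool)}
    (hA : ∀ r, (S.outcome x c r).1 = pack (A r))
    (hM : ∀ r q i, (S.outcome x c r).2 q i = pack (M r q i)) {L : ℕ → List (Fin n × List Bool)}
    (hL : ∀ r : Fin v, A r ++ ((List.finRange v).flatMap fun q =>
      (List.range (S.count q r)).flatMap fun i => M q r i) = L r) :
    S.exec x c = packed L := by
  funext r
  simp only [Superstep.exec, packed, ← hL, hA, Superstep.inbox, hM, hS, appendTags]
  simp [pack, List.flatMap_assoc, List.flatMap_map, List.map_flatMap]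

theorem flatMap_eq_of_unique {α β : Type*} {l : List α} (hl : l.Nodup) {a : α} (ha : a ∈ l)
    {h : α → List β} (h0 : ∀ b ∈ l, b ≠ a → h b = []) : l.flatMap h = h a := by
  induction l with
  | nil => simp at ha
  | cons b l ih =>
    rw [List.nodup_cons] at hl
    rw [List.flatMap_cons]
    rcases List.mem_cons.1 ha with rfl | ha
    · rw [List.flatMap_eq_nil_iff.2, List.append_nil]
      intro c hc
      exact h0 c (by simp [hc]) (by rintro rfl; exact hl.1 hc)
    · rw [h0 b (by simp) (by rintro rfl; exact hl.1 ha), List.nil_append]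
      exact ih hl.2 ha fun c hc => h0 c (by simp [hc])

theorem range_flatMap_ite {β : Type*} {c : ℕ} (hc : 0 < c) (l : List β) :
    ((List.range c).flatMap fun i => if i = 0 then l else []) = l := by
  rw [flatMap_eq_of_unique List.nodup_range (a := 0) (by simpa using hc)]
  · simp
  · intro b _ hb
    simp [hb]

theorem flatMap_ite_singleton {α β : Type*} (l : List α) (p : α → Prop) [DecidablePred p]
    (g : α → β) : (l.flatMap fun a => if p a then [g a] else []) = (l.filter p).map g := by
  induction l with
  | nil => rfl
  | cons a l ih =>
    rw [List.flatMap_cons, ih, List.filter_cons]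
    by_cases h : p a <;> simp [h]

/-- The state in which the `r`-th processing element holds the tagged key `s r`. -/
abbrev state (s : ℕ → Fin n × List Bool) : Config n v Tags := packed fun r => [s r]

/-- What is required of a superstep, in a configuration in which it may start. -/
def StepOK (S : Superstep n v Tags) (c : Config n v Tags) : Prop :=
  S.Legal 1 x c ∧ (∀ i, ∑ r, (c r).keys.count i ≤ 4) ∧
    ∀ r, ((S.work r (c r)).path x).length ≤ 16

/-- The supersteps `l` correctly lead from state `s` to state `s'`. -/
def Runs (l : List (Superstep n v Tags)) (s s' : ℕ → Fin n × List Bool) : Prop :=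
  finalConfig x l (state s) = state s' ∧ ∀ p ∈ trace x l (state s), StepOK x p.1 p.2

variable {x} in
theorem Runs.append {l l' : List (Superstep n v Tags)} {s s' s'' : ℕ → Fin n × List Bool}
    (h : Runs x l s s') (h' : Runs x l' s' s'') : Runs x (l ++ l') s s'' := by
  constructor
  · rw [finalConfig_append, h.1, h'.1]
  · intro p hp
    rw [trace_append, List.mem_append, h.1] at hp
    exact hp.elim (h.2 p) (h'.2 p)

theorem state_count_le {s : ℕ → Fin n × List Bool}
    (hs : Set.InjOn (fun r => (s r).1) (Set.Iio v)) (i : Fin n) :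
    ∑ r : Fin v, (state (v := v) s r).keys.count i ≤ 1 := by
  have : ∀ r : Fin v, (state (v := v) s r).keys.count i = if (s r).1 = i then 1 else 0 := by
    intro r
    simp [state, packed, pack, List.count_singleton]
  simp only [this]
  rw [← card_filter, card_le_one]
  intro a ha b hb
  simp only [mem_filter, mem_univ, true_and] at ha hb
  exact Fin.ext (hs a.isLt b.isLt (ha.trans hb.symm))

end Exec

/-! ### The effect of the individual supersteps of Columnsort. -/

section Steps

variable {k : ℕ} {K : Type} [LinearOrder K] (x : Fin (2 ^ k) → K)

/-- A routing superstep. -/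
theorem runs_route {m : ℕ} (hm : m ≤ k) {f : ℕ → ℕ} (hf : ∀ t < 2 ^ m, f t < 2 ^ m)
    (hi : Set.InjOn f (Set.Iio (2 ^ m))) (g : ℕ → List Bool → List Bool)
    {s : ℕ → Fin (2 ^ k) × List Bool} (hs : Set.InjOn (fun r => (s r).1) (Set.Iio (2 ^ k))) :
    ∃ τ : Equiv.Perm ℕ, BlockPerm m τ ∧ (∀ q, ∀ t < 2 ^ m, τ (q * 2 ^ m + t) = q * 2 ^ m + f t) ∧
      Runs x [route k m f g] s
        fun q => ((s (τ.symm q)).1, g (q % 2 ^ m) (s (τ.symm q)).2) := by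
  have hN : 0 < 2 ^ m := by positivity
  obtain ⟨τ, hτ, hτt⟩ := exists_perm_target hf hi
  refine ⟨τ, hτ, fun q t ht => by rw [hτt, target_add ht], ?_, ?_⟩
  · change (route k m f g).exec x (state s) = _
    refine exec_eq_packed x rfl (A := fun _ => []) (M := fun r q i =>
      if q.val = target m f r ∧ i = 0 then [((s r).1, g (f (r % 2 ^ m)) (s r).2)] else [])
      (fun r => rfl) ?_ ?_
    · intro r q i
      simp only [Superstep.outcome, route, CompTree.eval]
      split_ifs <;> rfl
    · intro r
      have hlt : τ.symm r < 2 ^ k := hτ.symm.lt hm r.isLt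
      have htr : target m f (τ.symm r) = r := by rw [← hτt, Equiv.apply_symm_apply]
      rw [List.nil_append, flatMap_eq_of_unique (List.nodup_finRange _) (a := ⟨τ.symm r, hlt⟩)
        (List.mem_finRange _)]
      · simp only [route, htr, true_and, if_true]
        -- Only message 0 carries the key. If the dummy message has the same destination, it is
        -- message 1 and empty.
        rw [range_flatMap_ite (by omega)]
        congr 3
        have : target m f (τ.symm r) % 2 ^ m = f (τ.symm r % 2 ^ m) :=
          column_mod (hf _ (Nat.mod_lt _ hN))
        rw [← this, htr]
      · intro q _ hq
        have : ¬ r.val = target m f q := by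
          intro h
          apply hq
          apply Fin.ext
          rw [← hτt] at h
          simp [h]
        simp [this]
  · intro p hp
    simp only [trace, List.mem_singleton] at hp
    subst hp
    refine ⟨?_, fun i => (state_count_le hs i).trans (by norm_num), fun r => ?_⟩
    · intro r
      refine ⟨by simp [route, CompTree.path], ?_, ?_⟩
      · simp [Superstep.outcome, route, CompTree.eval, emptyStore]
      · intro q i _
        simp only [Superstep.outcome, route, CompTree.eval]
        split_ifs <;> simp [state, packed, pack, emptyStore]
    · simp [route, CompTree.path]

/-- The tagged keys in a segment, in the order in which `r` collects them. -/
def collected (k m : ℕ) (s : ℕ → Fin (2 ^ k) × List Bool) (r : ℕ) :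
    List (Fin (2 ^ k) × List Bool) :=
  s r :: (List.finRange (2 ^ k)).flatMap fun q : Fin (2 ^ k) =>
    if q.val ≠ r ∧ q.val / 2 ^ m = r / 2 ^ m then [s q] else []

theorem collected_perm {m : ℕ} (hm : m ≤ k) (s : ℕ → Fin (2 ^ k) × List Bool) {r : ℕ}
    (hr : r < 2 ^ k) :
    (collected k m s r).Perm
      ((List.range (2 ^ m)).map fun t => s (r / 2 ^ m * 2 ^ m + t)) := by
  have hN : 0 < 2 ^ m := by positivity
  have h1 : collected k m s r = (r :: ((List.finRange (2 ^ k)).filter fun q =>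
      q.val ≠ r ∧ q.val / 2 ^ m = r / 2 ^ m).map Fin.val).map s := by
    rw [collected, List.map_cons, List.map_map, flatMap_ite_singleton]
    rfl
  have h2 : ((List.range (2 ^ m)).map fun t => s (r / 2 ^ m * 2 ^ m + t)) =
      ((List.range (2 ^ m)).map fun t => r / 2 ^ m * 2 ^ m + t).map s := by
    rw [List.map_map]; rfl
  rw [h1, h2]
  apply List.Perm.map
  rw [List.perm_ext_iff_of_nodup]
  · intro p
    simp only [List.mem_cons, List.mem_map, List.mem_filter, List.mem_finRange, true_and,
      decide_eq_true_eq, List.mem_range]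
    constructor
    · intro h
      have : p / 2 ^ m = r / 2 ^ m := by
        rcases h with rfl | ⟨q, hq, rfl⟩
        · rfl
        · exact hq.2
      exact ⟨p % 2 ^ m, Nat.mod_lt _ hN, by rw [← this, Nat.div_add_mod']⟩
    · rintro ⟨t, ht, rfl⟩
      have hd := column_div (c := r / 2 ^ m) ht
      by_cases he : r / 2 ^ m * 2 ^ m + t = r
      · exact Or.inl he
      · exact Or.inr ⟨⟨_, lt_two_pow_of_div_eq hm hd hr⟩, ⟨he, hd⟩, rfl⟩
  · rw [List.nodup_cons]
    refine ⟨by simp +contextual, ?_⟩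
    exact ((List.nodup_finRange _).filter _).map Fin.val_injective
  · exact List.nodup_range.map fun a b h => by simpa using h

theorem exec_exchange (m : ℕ) (s : ℕ → Fin (2 ^ k) × List Bool) :
    (exchange k m).exec x (state s) = packed (collected k m s) := by
  refine exec_eq_packed x rfl (A := fun r => [s r]) (M := fun r q i =>
    if Mates m r q ∧ i = 0 then [s r] else []) (fun r => rfl) ?_ ?_
  · intro r q i
    simp only [Superstep.outcome, exchange, CompTree.eval]
    split_ifs <;> rfl
  · intro r
    rw [collected, List.singleton_append]
    congr 2
    funext q
    by_cases h : Mates m q r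
    · have h' : q.val ≠ r.val ∧ q.val / 2 ^ m = r.val / 2 ^ m :=
        ⟨fun e => h.1 (Fin.ext e.symm), h.2.symm⟩
      simp only [exchange, h, true_and, if_true]
      rw [range_flatMap_ite (by omega), if_pos h']
    · have h' : ¬ (q.val ≠ r.val ∧ q.val / 2 ^ m = r.val / 2 ^ m) :=
        fun e => h ⟨fun e' => e.1 (by rw [e']), e.2.symm⟩
      simp [h, h']

/-- Both lists are sorted and contain the same tagged keys. Since `val x` is injective the order is
antisymmetric, so the lists coincide; hence all PEs of a segment compute the same list. -/
theorem sortKeys_collected {m : ℕ} (hm : m ≤ k) (hx : Function.Injective x)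
    {s : ℕ → Fin (2 ^ k) × List Bool} {σ : Equiv.Perm ℕ} (hσ : BlockPerm m σ)
    (hs : BlockSorted m (val x ∘ s ∘ σ)) {r : ℕ} (hr : r < 2 ^ k) :
    (sortKeys (collected k m s r)).eval x =
      (List.range (2 ^ m)).map fun t => s (σ (r / 2 ^ m * 2 ^ m + t)) := by
  have hN : 0 < 2 ^ m := by positivity
  have hdvd : 2 ^ m ∣ r / 2 ^ m * 2 ^ m := Dvd.intro_left _ rfl
  refine List.Perm.eq_of_pairwise (le := fun a b => val x a ≤ val x b) ?_
    (sortKeys_sorted x _) ?_ ?_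
  · intro a b _ _ h h'
    exact val_injective hx (le_antisymm h h')
  · rw [List.pairwise_map]
    refine List.pairwise_lt_range.imp_of_mem ?_
    intro i j hi hj hij
    exact hs.add hdvd i j hij (by simpa using hj)
  · refine ((sortKeys_perm x _).trans (collected_perm hm s hr)).trans ?_
    have e : ∀ ρ : ℕ → ℕ, ((List.range (2 ^ m)).map fun t => s (ρ t)) =
      ((List.range (2 ^ m)).map ρ).map s := fun ρ => by rw [List.map_map]; rfl
    rw [e, e]
    apply List.Perm.map
    rw [List.perm_ext_iff_of_nodup]
    · intro p
      simp only [List.mem_map, List.mem_range]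
      constructor
      · rintro ⟨t, ht, rfl⟩
        obtain ⟨i, hi, he⟩ := exists_add_of_div_eq hN hdvd
          ((hσ.symm (r / 2 ^ m * 2 ^ m + t)).trans (div_eq_of_dvd_add hdvd ht))
        exact ⟨i, hi, by rw [← he, Equiv.apply_symm_apply]⟩
      · rintro ⟨t, ht, rfl⟩
        obtain ⟨i, hi, he⟩ := exists_add_of_div_eq hN hdvd
          ((hσ (r / 2 ^ m * 2 ^ m + t)).trans (div_eq_of_dvd_add hdvd ht))
        exact ⟨i, hi, he.symm⟩
    · exact List.nodup_range.map fun a b h => by simpa using h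
    · exact List.nodup_range.map fun a b h => by simpa using h

theorem collected_count_le {m : ℕ} (hm : m ≤ k) {s : ℕ → Fin (2 ^ k) × List Bool}
    (hs : Set.InjOn (fun r => (s r).1) (Set.Iio (2 ^ k))) (i : Fin (2 ^ k)) :
    ∑ r : Fin (2 ^ k), (packed (v := 2 ^ k) (collected k m s) r).keys.count i ≤ 2 ^ m := by
  have hN : 0 < 2 ^ m := by positivity
  have hc : ∀ r : Fin (2 ^ k), (packed (v := 2 ^ k) (collected k m s) r).keys.count i =
      ((List.range (2 ^ m)).map fun t => (s (r.val / 2 ^ m * 2 ^ m + t)).1).count i := by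
    intro r
    have := ((collected_perm hm s r.isLt).map Prod.fst).count_eq i
    rw [List.map_map] at this
    exact this
  have hlt : ∀ r : Fin (2 ^ k), ∀ t < 2 ^ m, r.val / 2 ^ m * 2 ^ m + t < 2 ^ k := fun r t ht =>
    lt_two_pow_of_div_eq hm (column_div ht) r.isLt
  by_cases hex : ∃ p < 2 ^ k, (s p).1 = i
  · obtain ⟨p, hp, hpi⟩ := hex
    have hb : ∀ r : Fin (2 ^ k), (packed (v := 2 ^ k) (collected k m s) r).keys.count i ≤
        if r.val / 2 ^ m = p / 2 ^ m then 1 else 0 := by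
      intro r
      rw [hc]
      split_ifs with h
      · apply List.nodup_iff_count_le_one.1
        refine List.Nodup.map_on ?_ List.nodup_range
        intro a ha b hb hab
        simp only [List.mem_range] at ha hb
        have := hs (hlt r a ha) (hlt r b hb) hab
        omega
      · rw [Nat.le_zero, List.count_eq_zero]
        intro hmem
        obtain ⟨t, ht, he⟩ := List.mem_map.1 hmem
        simp only [List.mem_range] at ht
        have := hs (hlt r t ht) hp (he.trans hpi.symm)
        apply h
        rw [← this, column_div ht]
    -- A key that starts at p is collected once by each of the 2 ^ m PEs of its segment, and by no
    -- other PE.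
    refine (sum_le_sum fun r _ => hb r).trans ?_
    rw [← card_filter]
    conv_rhs => rw [← card_range (2 ^ m)]
    apply card_le_card_of_injOn (fun r => r.val % 2 ^ m)
    · intro r _
      simpa using Nat.mod_lt _ hN
    · intro a ha b hb hab
      simp only [coe_filter, mem_univ, true_and, Set.mem_ofPred_eq] at ha hb hab
      apply Fin.ext
      rw [← Nat.div_add_mod a.val (2 ^ m), ← Nat.div_add_mod b.val (2 ^ m), ha, hb, hab]
  · refine (sum_le_sum (g := fun _ => 0) fun r _ => ?_).trans (by simp)
    rw [hc, Nat.le_zero, List.count_eq_zero]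
    intro hmem
    obtain ⟨t, ht, he⟩ := List.mem_map.1 hmem
    simp only [List.mem_range] at ht
    exact hex ⟨_, hlt r t ht, he⟩

/-- Sorting short segments directly. -/
theorem runs_direct {m : ℕ} (hm : m ≤ k) (hm2 : m ≤ 2) (hx : Function.Injective x)
    {s : ℕ → Fin (2 ^ k) × List Bool} (hs : Set.InjOn (fun r => (s r).1) (Set.Iio (2 ^ k))) :
    ∃ σ, BlockPerm m σ ∧ BlockSorted m (val x ∘ s ∘ σ) ∧
      Runs x [exchange k m, localSort k m] s (s ∘ σ) := by
  have hN : 0 < 2 ^ m := by positivity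
  have hN4 : 2 ^ m ≤ 4 := Nat.pow_le_pow_right (n := 2) (by norm_num) hm2
  obtain ⟨σ, hσ, hsort⟩ := exists_blockSorted m (val x ∘ s)
  have hwork : ∀ r : Fin (2 ^ k), ((localSort k m).work r (packed (collected k m s) r)).eval x =
      (pack [s (σ r)], fun _ _ => emptyStore) := by
    intro r
    simp only [localSort, packed, zip_pack, CompTree.eval_bind, CompTree.eval]
    rw [sortKeys_collected x hm hx hσ hsort r.isLt]
    have : (((List.range (2 ^ m)).map fun t => s (σ (r.val / 2 ^ m * 2 ^ m + t))).drop
        (r.val % 2 ^ m)).take 1 = [s (σ r)] := by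
      rw [List.take_one, List.head?_drop, List.getElem?_map,
        List.getElem?_range (Nat.mod_lt _ hN)]
      simp [Nat.div_add_mod']
    rw [this]
    rfl
  refine ⟨σ, hσ, hsort, ?_, ?_⟩
  · change (localSort k m).exec x ((exchange k m).exec x (state s)) = _
    rw [exec_exchange]
    refine exec_eq_packed x rfl (A := fun r => [s (σ r)]) (M := fun _ _ _ => []) ?_ ?_ ?_
    · intro r
      rw [Superstep.outcome, hwork]
    · intro r q i
      rw [Superstep.outcome, hwork]
      rfl
    · intro r
      simp
  · intro p hp
    simp only [trace, List.mem_cons, List.not_mem_nil, or_false] at hp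
    rcases hp with rfl | rfl
    · refine ⟨?_, fun i => (state_count_le hs i).trans (by norm_num), fun r => ?_⟩
      · intro r
        refine ⟨by simp [exchange, CompTree.path], ?_, ?_⟩
        · simp [Superstep.outcome, exchange, CompTree.eval]
        · intro q i _
          simp only [Superstep.outcome, exchange, CompTree.eval]
          split_ifs <;> simp [state, packed, pack, emptyStore]
      · simp [exchange, CompTree.path]
    · rw [exec_exchange]
      have hlen : ∀ r : Fin (2 ^ k), (collected k m s r).length ≤ 4 := by
        intro r
        rw [(collected_perm hm s r.isLt).length_eq]
        simpa using hN4
      have hpath : ∀ r : Fin (2 ^ k), ((localSort k m).work r (packed (collected k m s) r)).path x =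
          (sortKeys (collected k m s r)).path x := by
        intro r
        simp only [localSort, packed, zip_pack, CompTree.path_bind, CompTree.path, List.append_nil]
      refine ⟨?_, fun i => (collected_count_le hm hs i).trans hN4, fun r => ?_⟩
      · intro r
        refine ⟨?_, ?_, ?_⟩
        · intro ij hij
          rw [hpath] at hij
          exact mem_sortKeys_path x _ hij
        · rw [Superstep.outcome, hwork]
          intro i hi
          simp only [pack, List.map_cons, List.map_nil, List.mem_singleton] at hi
          rw [hi]
          have : s (σ r) ∈ collected k m s r := by
            rw [(collected_perm hm s r.isLt).mem_iff, List.mem_map]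
            refine ⟨σ r % 2 ^ m, by simpa using Nat.mod_lt _ hN, ?_⟩
            rw [← hσ r, Nat.div_add_mod']
          exact List.mem_map_of_mem this
        · intro q i _
          rw [Superstep.outcome, hwork]
          simp [emptyStore]
      · rw [hpath]
        refine (sortKeys_path_length x _).trans ?_
        have := hlen r
        nlinarith

end Steps

/-! ### Correctness of recursive Columnsort -/

theorem transposePos_lt {R S t : ℕ} (ht : t < R * S) : transposePos R S t < R * S := by
  have hS : 0 < S := by
    rcases Nat.eq_zero_or_pos S with h | h
    · simp [h] at ht
    · exact h
  exact column_lt (Nat.mod_lt _ hS) (Nat.div_lt_of_lt_mul (by linarith [Nat.mul_comm R S]))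

theorem transposePos_injOn (R S : ℕ) : Set.InjOn (transposePos R S) (Set.Iio (R * S)) := by
  intro t ht t' ht' h
  simp only [Set.mem_Iio] at ht ht'
  have h1 : t / S < R := Nat.div_lt_of_lt_mul (by linarith [Nat.mul_comm R S])
  have h2 : t' / S < R := Nat.div_lt_of_lt_mul (by linarith [Nat.mul_comm R S])
  have hd := congrArg (· / R) h
  have hm := congrArg (· % R) h
  simp only [transposePos, column_div h1, column_div h2, column_mod h1, column_mod h2] at hd hm
  rw [← Nat.div_add_mod t S, ← Nat.div_add_mod t' S, hd, hm]

theorem add_mod_injOn (N d : ℕ) : Set.InjOn (fun t => (t + d) % N) (Set.Iio N) := by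
  intro t ht t' ht' h
  have : t + d ≡ t' + d [MOD N] := h
  exact (Nat.ModEq.add_right_cancel' d this).eq_of_lt_of_lt ht ht'

section Correct

variable {k : ℕ} {K : Type} [LinearOrder K] (x : Fin (2 ^ k) → K)

theorem val_cons_le {n : ℕ} {x : Fin n → K} {a a' : Fin n × List Bool} {b : Bool} :
    val x (a.1, b :: a.2) ≤ val x (a'.1, b :: a'.2) ↔ val x a ≤ val x a' := by
  simp [val, Prod.Lex.toLex_le_toLex]

theorem val_cons_lt {n : ℕ} {x : Fin n → K} {a a' : Fin n × List Bool} :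
    val x (a.1, false :: a.2) < val x (a'.1, true :: a'.2) := by
  simp [val, Prod.Lex.toLex_lt_toLex, List.cons_lt_cons_iff]

variable {x} in
-- The passage from thresholds to keys. The tag pushed in phase 6 is left out of the comparisons
-- with the threshold: outside the first shifted column it is constant, and the first shifted column
-- is already sorted with respect to the tagged order. The inequality 2m ≤ 3a is S² ≤ R.
theorem columnsort_phases {m a : ℕ} (ham : a < m) (ha : 2 * m ≤ 3 * a) (ha0 : 0 < a)
    {s1 : ℕ → Fin (2 ^ k) × List Bool} (hx : Function.Injective x)
    {τ2 σ3 τ4 σ5 τ6 σ7 τ8 : Equiv.Perm ℕ}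
    (h1 : BlockSorted a (val x ∘ s1))
    (h2 : ∀ q, ∀ t < 2 ^ m, τ2 (q * 2 ^ m + t) = q * 2 ^ m + transposePos (2 ^ a) (2 ^ (m - a)) t)
    (h3 : BlockPerm a σ3) (h3' : BlockSorted a (val x ∘ s1 ∘ τ2.symm ∘ σ3))
    (h4 : ∀ q, ∀ t < 2 ^ m, τ4 (q * 2 ^ m + t) = q * 2 ^ m + diagPos (2 ^ a) (2 ^ (m - a)) t)
    (h5 : BlockPerm a σ5)
    (h5' : BlockSorted a (val x ∘ s1 ∘ τ2.symm ∘ σ3 ∘ τ4.symm ∘ σ5))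
    (h6 : ∀ q, ∀ t < 2 ^ m, τ6 (q * 2 ^ m + t) = q * 2 ^ m + shiftPos (2 ^ a) (2 ^ (m - a)) t)
    {u : ℕ → Fin (2 ^ k) × List Bool} (hu : u = s1 ∘ τ2.symm ∘ σ3 ∘ τ4.symm ∘ σ5 ∘ τ6.symm)
    (h7 : BlockPerm a σ7)
    (h7' : BlockSorted a (val x ∘ (fun p => ((u p).1, shiftTag (2 ^ a) (p % 2 ^ m) :: (u p).2)) ∘ σ7))
    (h8 : ∀ q, ∀ t < 2 ^ m, τ8 (q * 2 ^ m + t) = q * 2 ^ m + unshiftPos (2 ^ a) (2 ^ (m - a)) t) :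
    BlockSorted m (val x ∘ u ∘ σ7 ∘ τ8.symm) := by
  obtain ⟨H, hH⟩ : ∃ H, 2 ^ a = 2 * H := ⟨2 ^ (a - 1), by rw [← pow_succ']; congr 1; omega⟩
  have hH0 : 0 < H := by have : 0 < 2 ^ a := by positivity
                         omega
  set S := 2 ^ (m - a) with hSdef
  have hS0 : 0 < S := by positivity
  have hN : 2 ^ m = 2 * H * S := by rw [← hH, hSdef, ← pow_add]; congr 1; omega
  have hRH : S * 2 ^ (2 * a - m) = 2 * H := by rw [← hH, hSdef, ← pow_add]; congr 1; omega
  have hSS : S * S ≤ 2 * H := by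
    rw [← hH, hSdef, ← pow_add]; exact Nat.pow_le_pow_right (by norm_num) (by omega)
  have hN0 : 0 < 2 ^ m := by positivity
  have hdvd : ∀ q c, 2 ^ a ∣ q * 2 ^ m + c * (2 * H) := by
    intro q c
    rw [hN, ← hH]
    exact ⟨q * S + c, by ring⟩
  have htag : ∀ q t, t < 2 ^ m → (q * 2 ^ m + t) % 2 ^ m = t := fun q t ht => column_mod ht
  -- columns of the shifted matrix, other than the first one
  have hcolS : ∀ q c, c < S → c ≠ 0 → ∀ i < 2 * H,
      shiftTag (2 ^ a) (σ7 (q * 2 ^ m + c * (2 * H) + i) % 2 ^ m) = false := by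
    intro q c hc hc0 i hi
    obtain ⟨j, hj, he⟩ := exists_add_of_div_eq (by positivity) (hdvd q c)
      ((h7 (q * 2 ^ m + c * (2 * H) + i)).trans (div_eq_of_dvd_add (hdvd q c) (hH ▸ hi)))
    rw [hH] at hj
    have hlt := column_lt hc hj
    have h1c : 1 * (2 * H) ≤ c * (2 * H) := Nat.mul_le_mul_right _ (by omega)
    rw [he, Nat.add_assoc, htag _ _ (by omega)]
    simp only [shiftTag, decide_eq_false_iff_not, hH]
    omega
  have hu6 : ∀ q, ∀ t < 2 ^ m, u (q * 2 ^ m + shiftPos (2 ^ a) S t) =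
      s1 (τ2.symm (σ3 (τ4.symm (σ5 (q * 2 ^ m + t))))) := by
    intro q t ht
    rw [← h6 q t ht, hu]
    simp
  -- The first half of the first shifted column is the second half of the last column; its second
  -- half is the first half of the first column.
  have hshift : ∀ q, ∀ i < 2 * H, ∃ c < S, ∃ j < 2 * H, (i < H → c = S - 1 ∧ j = i + H) ∧
      (H ≤ i → c = 0 ∧ j = i - H) ∧
      u (q * 2 ^ m + i) = s1 (τ2.symm (σ3 (τ4.symm (σ5 (q * 2 ^ m + c * (2 * H) + j))))) := by
    intro q i hi
    rcases Nat.lt_or_ge i H with h | h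
    · have hlt := column_lt (R := 2 * H) (c := S - 1) (S := S) (i := i + H) (by omega) (by omega)
      refine ⟨S - 1, by omega, i + H, by omega, fun _ => ⟨rfl, rfl⟩, by omega, ?_⟩
      rw [Nat.add_assoc, ← hu6 q _ (by omega)]
      congr 2
      have e : (S - 1) * (2 * H) + 2 * H = 2 * H * S := by
        rw [← Nat.succ_mul, Nat.succ_eq_add_one, Nat.sub_add_cancel hS0, Nat.mul_comm]
      rw [shiftPos, hH, show 2 * H / 2 = H by omega,
        show (S - 1) * (2 * H) + (i + H) + H = i + 2 * H * S by omega, Nat.add_mod_right,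
        Nat.mod_eq_of_lt]
      have : 2 * H * 1 ≤ 2 * H * S := Nat.mul_le_mul_left _ hS0
      omega
    · have : 2 * H * 1 ≤ 2 * H * S := Nat.mul_le_mul_left _ hS0
      refine ⟨0, hS0, i - H, by omega, by omega, fun _ => ⟨rfl, rfl⟩, ?_⟩
      rw [Nat.add_assoc, ← hu6 q _ (by omega)]
      congr 2
      rw [shiftPos, hH, show 2 * H / 2 = H by omega, show 0 * (2 * H) + (i - H) + H = i by omega,
        Nat.mod_eq_of_lt (by omega)]
  -- the first column of the shifted matrix is not changed in phase 7
  have hcol0 : ∀ q, ∀ i < 2 * H, u (σ7 (q * 2 ^ m + i)) = u (q * 2 ^ m + i) := by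
    intro q i hi
    have hd0 : 2 ^ a ∣ q * 2 ^ m := by simpa using hdvd q 0
    have := h7.apply_eq_of_sorted (g := val x ∘ (fun p => ((u p).1,
      shiftTag (2 ^ a) (p % 2 ^ m) :: (u p).2))) hd0
      (fun i j hij hj => h7'.add hd0 i j hij hj) ?_ (hH ▸ hi)
    · have h' := val_injective hx this
      simp only [Prod.mk.injEq, List.cons.injEq] at h'
      exact Prod.ext h'.1 h'.2.2
    · intro i j hij hj
      rw [hH] at hj
      have hlt : 2 * H * 1 ≤ 2 * H * S := Nat.mul_le_mul_left _ hS0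
      simp only [Function.comp]
      rw [htag _ _ (by omega), htag _ _ (by omega)]
      obtain ⟨c, hc, i', hi', hi1, hi2, hie⟩ := hshift q i (by omega)
      obtain ⟨d, hd, j', hj', hj1, hj2, hje⟩ := hshift q j (by omega)
      by_cases hcase : i < H ∧ H ≤ j
      · have e1 : shiftTag (2 ^ a) i = false := by simp [shiftTag, hH]; omega
        have e2 : shiftTag (2 ^ a) j = true := by simp [shiftTag, hH]; omega
        rw [e1, e2]
        exact val_cons_lt.le
      · have e : shiftTag (2 ^ a) i = shiftTag (2 ^ a) j := by
          simp only [shiftTag, hH, decide_eq_decide]; omega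
        have hcd : c = d ∧ i' < j' := by
          rcases Nat.lt_or_ge i H with h | h
          · have := hi1 h
            have := hj1 (by omega)
            omega
          · have := hi2 h
            have := hj2 (by omega)
            omega
        rw [e, val_cons_le, hie, hje, hcd.1]
        exact h5'.add (hdvd q d) i' j' hcd.2 (hH ▸ hj')
  -- All tags pushed on the keys of such a column are `false`, so they can be dropped from the
  -- comparison.
  have hcolu : ∀ q c, c < S → c ≠ 0 → ∀ i j, i < j → j < 2 ^ a →
      val x (u (σ7 (q * 2 ^ m + c * (2 * H) + i))) ≤
        val x (u (σ7 (q * 2 ^ m + c * (2 * H) + j))) := by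
    intro q c hc hc0 i j hij hj
    have := h7'.add (hdvd q c) i j hij hj
    simp only [Function.comp] at this
    rw [hcolS q c hc hc0 i (by omega), hcolS q c hc hc0 j (by omega)] at this
    exact val_cons_le.1 this
  intro p p' hpp hq
  obtain ⟨q, t', ht', rfl⟩ : ∃ q, ∃ t' < 2 ^ m, q * 2 ^ m + t' = p' :=
    ⟨p' / 2 ^ m, p' % 2 ^ m, Nat.mod_lt _ hN0, Nat.div_add_mod' _ _⟩
  obtain ⟨t, ht, rfl⟩ : ∃ t < 2 ^ m, q * 2 ^ m + t = p :=
    ⟨p % 2 ^ m, Nat.mod_lt _ hN0, by rw [column_div ht'] at hq; rw [← hq, Nat.div_add_mod']⟩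
  by_contra hcon
  rw [not_le] at hcon
  have htt : t < t' := by
    refine lt_of_le_of_ne (by omega) ?_
    rintro rfl
    exact lt_irrefl _ hcon
  -- The larger of the two keys in wrong order serves as the threshold: the later key lies below y,
  -- so the earlier one would also have to, that is y < y.
  set y := val x (u (σ7 (τ8.symm (q * 2 ^ m + t)))) with hy
  have main := columnsort_threshold hS0 hRH hH0 hSS
    (P1 := fun t => val x (s1 (q * 2 ^ m + t)) < y)
    (P2 := fun t => val x (s1 (τ2.symm (q * 2 ^ m + t))) < y)
    (P3 := fun t => val x (s1 (τ2.symm (σ3 (q * 2 ^ m + t)))) < y)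
    (P4 := fun t => val x (s1 (τ2.symm (σ3 (τ4.symm (q * 2 ^ m + t))))) < y)
    (P5 := fun t => val x (s1 (τ2.symm (σ3 (τ4.symm (σ5 (q * 2 ^ m + t)))))) < y)
    (P6 := fun t => val x (u (q * 2 ^ m + t)) < y)
    (P7 := fun t => val x (u (σ7 (q * 2 ^ m + t))) < y)
    (P8 := fun t => val x (u (σ7 (τ8.symm (q * 2 ^ m + t)))) < y)
    ?_ ?_ ?_ ?_ ?_ ?_ ?_ ?_ ?_ t t' htt (by omega) hcon
  · exact lt_irrefl _ main
  · intro c _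
    refine ⟨#{i ∈ range (2 ^ a) | val x (s1 (q * 2 ^ m + c * (2 * H) + i)) < y}, ?_⟩
    intro i hi
    simp only [← Nat.add_assoc]
    exact BlockPerm.lt_iff (σ := 1) (fun _ => rfl) (hdvd q c) (g := val x ∘ s1)
      (h1.add (hdvd q c)) y (hH ▸ hi)
  · intro t ht
    rw [← hH, ← h2 q t (by omega), Equiv.symm_apply_apply]
  · intro c _ i hi
    simp only [← Nat.add_assoc]
    have := h3.lt_iff (hdvd q c) (g := val x ∘ s1 ∘ τ2.symm) (h3'.add (hdvd q c)) y (hH ▸ hi)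
    simpa only [hH, Function.comp_apply] using this
  · intro t ht
    rw [← hH, ← h4 q t (by omega), Equiv.symm_apply_apply]
  · intro c _ i hi
    simp only [← Nat.add_assoc]
    have := h5.lt_iff (hdvd q c) (g := val x ∘ s1 ∘ τ2.symm ∘ σ3 ∘ τ4.symm) (h5'.add (hdvd q c)) y
      (hH ▸ hi)
    simpa only [hH, Function.comp_apply] using this
  · intro t ht
    rw [← hH, hu6 q t (by omega)]
  · intro i hi
    rw [hcol0 q i hi]
  · intro c hc hc0 i hi
    simp only [← Nat.add_assoc]
    have := h7.lt_iff (hdvd q c) (g := val x ∘ u) (hcolu q c hc hc0) y (hH ▸ hi)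
    simpa only [hH, Function.comp_apply] using this
  · intro t ht
    rw [← hH, ← h8 q t (by omega), Equiv.symm_apply_apply]

theorem columnsortSteps_of_le {k m : ℕ} (h : m ≤ 2) :
    columnsortSteps k m = [exchange k m, localSort k m] := by
  rw [columnsortSteps, dif_pos h]

theorem columnsortSteps_of_gt {k m a : ℕ} (h : ¬ m ≤ 2) (ha : a = (2 * m + 2) / 3) :
    columnsortSteps k m =
      columnsortSteps k a ++ [route k m (transposePos (2 ^ a) (2 ^ (m - a))) fun _ s => s] ++
      columnsortSteps k a ++ [route k m (diagPos (2 ^ a) (2 ^ (m - a))) fun _ s => s] ++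
      columnsortSteps k a ++ [route k m (shiftPos (2 ^ a) (2 ^ (m - a)))
        fun t s => shiftTag (2 ^ a) t :: s] ++
      columnsortSteps k a ++ [route k m (unshiftPos (2 ^ a) (2 ^ (m - a))) fun _ s => s.tail] := by
  subst ha
  rw [columnsortSteps, dif_neg h]

theorem injOn_comp_perm {α : Type*} {s : ℕ → α} {m k : ℕ} (hs : Set.InjOn s (Set.Iio (2 ^ k)))
    {σ : Equiv.Perm ℕ} (hσ : BlockPerm m σ) (hm : m ≤ k) :
    Set.InjOn (fun r => s (σ r)) (Set.Iio (2 ^ k)) := by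
  intro a ha b hb h
  exact σ.injective (hs (hσ.lt hm ha) (hσ.lt hm hb) h)

/-- Strong induction on m. The state s has to be arbitrary, tags included, since the four recursive
calls start from permuted states and the last of them also from freshly tagged keys. -/
theorem runs_columnsortSteps (hx : Function.Injective x) (m : ℕ) (hm : m ≤ k)
    (s : ℕ → Fin (2 ^ k) × List Bool) (hs : Set.InjOn (fun r => (s r).1) (Set.Iio (2 ^ k))) :
    ∃ σ, BlockPerm m σ ∧ BlockSorted m (val x ∘ s ∘ σ) ∧
      Runs x (columnsortSteps k m) s (s ∘ σ) := by
  induction m using Nat.strong_induction_on generalizing s with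
  | _ m ih =>
  by_cases hm2 : m ≤ 2
  · rw [columnsortSteps_of_le hm2]
    exact runs_direct x hm hm2 hx hs
  obtain ⟨a, ha⟩ : ∃ a, a = (2 * m + 2) / 3 := ⟨_, rfl⟩
  have ham : a < m := by omega
  have hak : a ≤ k := by omega
  have hN : 2 ^ m = 2 ^ a * 2 ^ (m - a) := by rw [← pow_add]; congr 1; omega
  rw [columnsortSteps_of_gt hm2 ha]
  obtain ⟨σ1, p1, b1, r1⟩ := ih a ham hak s hs
  have i1 := injOn_comp_perm hs p1 hak
  obtain ⟨τ2, p2, e2, r2⟩ := runs_route x hm (f := transposePos (2 ^ a) (2 ^ (m - a)))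
    (by rw [hN]; exact fun t ht => transposePos_lt ht) (by rw [hN]; exact transposePos_injOn _ _)
    (fun _ s => s) (s := s ∘ σ1) i1
  have i2 := injOn_comp_perm i1 p2.symm hm
  obtain ⟨σ3, p3, b3, r3⟩ := ih a ham hak ((s ∘ σ1) ∘ τ2.symm) i2
  have i3 := injOn_comp_perm i2 p3 hak
  obtain ⟨τ4, p4, e4, r4⟩ := runs_route x hm (f := diagPos (2 ^ a) (2 ^ (m - a)))
    (by rw [hN]; exact fun t ht => diagPos_lt ht) (by rw [hN]; exact diagPos_injOn _ _)
    (fun _ s => s) (s := ((s ∘ σ1) ∘ τ2.symm) ∘ σ3) i3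
  have i4 := injOn_comp_perm i3 p4.symm hm
  obtain ⟨σ5, p5, b5, r5⟩ := ih a ham hak ((((s ∘ σ1) ∘ τ2.symm) ∘ σ3) ∘ τ4.symm) i4
  have i5 := injOn_comp_perm i4 p5 hak
  have hpos : 0 < 2 ^ m := by positivity
  obtain ⟨τ6, p6, e6, r6⟩ := runs_route x hm (f := shiftPos (2 ^ a) (2 ^ (m - a)))
    (by rw [hN] at hpos ⊢; exact fun t _ => Nat.mod_lt _ hpos)
    (by rw [hN]; exact add_mod_injOn _ _)
    (fun t s => shiftTag (2 ^ a) t :: s) (s := ((((s ∘ σ1) ∘ τ2.symm) ∘ σ3) ∘ τ4.symm) ∘ σ5) i5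
  have i6 := injOn_comp_perm i5 p6.symm hm
  set u := (((((s ∘ σ1) ∘ τ2.symm) ∘ σ3) ∘ τ4.symm) ∘ σ5) ∘ τ6.symm with hu
  obtain ⟨σ7, p7, b7, r7⟩ := ih a ham hak
    (fun p => ((u p).1, shiftTag (2 ^ a) (p % 2 ^ m) :: (u p).2)) i6
  have i7 := injOn_comp_perm i6 p7 hak
  obtain ⟨τ8, p8, e8, r8⟩ := runs_route x hm (f := unshiftPos (2 ^ a) (2 ^ (m - a)))
    (by rw [hN] at hpos ⊢; exact fun t _ => Nat.mod_lt _ hpos)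
    (by rw [hN]; exact add_mod_injOn _ _) (fun _ s => s.tail)
    (s := (fun p => ((u p).1, shiftTag (2 ^ a) (p % 2 ^ m) :: (u p).2)) ∘ σ7) i7
  refine ⟨σ1 * τ2.symm * σ3 * τ4.symm * σ5 * τ6.symm * σ7 * τ8.symm, ?_, ?_, ?_⟩
  · have hle := ham.le
    exact (((((((p1.mono hle).mul p2.symm).mul (p3.mono hle)).mul p4.symm).mul
      (p5.mono hle)).mul p6.symm).mul (p7.mono hle)).mul p8.symm
  · exact columnsort_phases ham (by omega) (by omega) hx b1 e2 p3 b3 e4 p5 b5 e6 hu p7 b7 e8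
  · exact ((((((r1.append r2).append r3).append r4).append r5).append r6).append r7).append r8

theorem runs_columnsort (hx : Function.Injective x) :
    ∃ σ, BlockPerm k σ ∧ BlockSorted k (val x ∘ (fun r => (Fin.ofNat (2 ^ k) r, [])) ∘ σ) ∧
      Runs x (columnsortSteps k k) (fun r => (Fin.ofNat (2 ^ k) r, []))
        ((fun r => (Fin.ofNat (2 ^ k) r, [])) ∘ σ) := by
  apply runs_columnsortSteps x hx k le_rfl
  intro a ha b hb h
  simpa [Fin.ofNat, Nat.mod_eq_of_lt (Set.mem_Iio.1 ha), Nat.mod_eq_of_lt (Set.mem_Iio.1 hb)] using h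

theorem columnsort_init (k : ℕ) :
    (columnsort k).init = state (fun r => (Fin.ofNat (2 ^ k) r, [])) := by
  funext r
  have : Fin.ofNat (2 ^ k) r = r := Fin.ext (Nat.mod_eq_of_lt r.isLt)
  simp only [columnsort, state, packed, pack, List.map_cons, List.map_nil, this]

theorem columnsort_stepOK (hx : Function.Injective x) {p}
    (hp : p ∈ trace x (columnsort k).steps (columnsort k).init) : StepOK x p.1 p.2 := by
  obtain ⟨σ, _, _, hr⟩ := runs_columnsort x hx
  rw [columnsort_init] at hp
  exact hr.2 p hp

end Correct

/-- At the end the keys increase strictly with the index of the PE, so exactly r keys are smaller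
than the one at PE r. -/
theorem columnsort_solves (k : ℕ) : (columnsort k).Solves := by
  intro K _ x hx i
  obtain ⟨σ, hσ, hsort, hr⟩ := runs_columnsort x hx
  have hlt : ∀ r < 2 ^ k, σ r < 2 ^ k := fun r hr => hσ.lt le_rfl hr
  have hlt' : ∀ r < 2 ^ k, σ.symm r < 2 ^ k := fun r hr => hσ.symm.lt le_rfl hr
  have hfin : (columnsort k).run x (columnsort k).steps.length =
      state ((fun r => (Fin.ofNat (2 ^ k) r, [])) ∘ σ) := by
    rw [run_length, columnsort_init]
    exact hr.1
  have hmono : ∀ a b : Fin (2 ^ k), a ≤ b → x ⟨σ a, hlt _ a.isLt⟩ ≤ x ⟨σ b, hlt _ b.isLt⟩ := by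
    intro a b hab
    have := hsort a b hab (by rw [Nat.div_eq_of_lt a.isLt, Nat.div_eq_of_lt b.isLt])
    have e : ∀ c : Fin (2 ^ k), Fin.ofNat (2 ^ k) (σ c) = ⟨σ c, hlt _ c.isLt⟩ := fun c =>
      Fin.ext (Nat.mod_eq_of_lt (hlt _ c.isLt))
    change val x (Fin.ofNat _ (σ a), []) ≤ val x (Fin.ofNat _ (σ b), []) at this
    rw [e, e] at this
    simpa [val, Prod.Lex.toLex_le_toLex] using this
  let ρ : Fin (2 ^ k) → Fin (2 ^ k) := fun a => ⟨σ a, hlt _ a.isLt⟩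
  have hρinj : Function.Injective ρ := fun a b h =>
    Fin.ext (σ.injective (congrArg Fin.val h))
  have hstrict : StrictMono (x ∘ ρ) :=
    (show Monotone (x ∘ ρ) from hmono).strictMono_of_injective (hx.comp hρinj)
  have hrank : ∀ r, rank x (ρ r) = r := by
    intro r
    rw [rank]
    have : (univ.filter fun j => x j < x (ρ r)) = (Finset.Iio r).image ρ := by
      ext j
      simp only [mem_filter, mem_univ, true_and, mem_image, mem_Iio]
      constructor
      · intro hj
        obtain ⟨b, rfl⟩ := (Finite.injective_iff_surjective.1 hρinj) j
        exact ⟨b, hstrict.lt_iff_lt.1 hj, rfl⟩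
      · rintro ⟨b, hb, rfl⟩
        exact hstrict hb
    rw [this, card_image_of_injective _ hρinj, Fin.card_Iio]
  have hout : ∀ r m, (i, m) ∈ (columnsort k).output r
      ((columnsort k).run x (columnsort k).steps.length r) ↔ i = ρ r ∧ m = r := by
    intro r m
    rw [hfin]
    have e : Fin.ofNat (2 ^ k) (σ r) = ρ r := Fin.ext (Nat.mod_eq_of_lt (hlt _ r.isLt))
    simp only [columnsort, state, packed, pack, Function.comp, List.map_cons, List.map_nil, e,
      List.mem_singleton, Prod.mk.injEq]
  constructor
  · refine ⟨⟨σ.symm i, hlt' _ i.isLt⟩, ?_⟩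
    have hi : ρ ⟨σ.symm i, hlt' _ i.isLt⟩ = i := Fin.ext (by simp [ρ])
    rw [hout]
    refine ⟨hi.symm, ?_⟩
    conv_lhs => rw [← hi]
    rw [hrank]
  · intro r m h
    obtain ⟨rfl, rfl⟩ := (hout r m).1 h
    rw [hrank]

theorem columnsort_lowReplication (k : ℕ) {c : ℕ} (hc : 4 ≤ c) :
    (columnsort k).LowReplication c := by
  constructor
  · intro i
    simp only [columnsort, List.count_singleton, beq_iff_eq]
    simp
  · intro K _ x hx t ht i
    refine le_trans ?_ hc
    rcases Nat.eq_or_lt_of_le ht with rfl | ht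
    · obtain ⟨σ, hσ, _, hr⟩ := runs_columnsort x hx
      rw [run_length, columnsort_init]
      have := hr.1
      change finalConfig x (columnsort k).steps _ = _ at this
      rw [this]
      refine (state_count_le ?_ i).trans (by norm_num)
      intro a ha b hb h
      have ha' := hσ.lt le_rfl (Set.mem_Iio.1 ha)
      have hb' := hσ.lt le_rfl (Set.mem_Iio.1 hb)
      apply σ.injective
      simpa [Fin.ofNat, Nat.mod_eq_of_lt ha', Nat.mod_eq_of_lt hb'] using h
    · exact (columnsort_stepOK x hx (mem_trace x _ ⟨t, ht⟩)).2.1 i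

/-! ### Labels and message counts of recursive Columnsort -/

/-- What the supersteps of recursive Columnsort have in common: the superstep acts on segments of
length `2 ^ m`, only PEs in the same segment communicate, and every PE sends and receives at most
four messages, the dummy messages being among those sent. -/
structure ActsOn (k m : ℕ) (S : Superstep (2 ^ k) (2 ^ k) Tags) : Prop where
  label : S.label = k - m
  segment : ∀ r q, S.count r q ≠ 0 → r.val / 2 ^ m = q.val / 2 ^ m
  sent : ∀ r, ∑ q, S.count r q ≤ 4
  received : ∀ q, ∑ r, S.count r q ≤ 4
  dummy : ∀ r q, dummyCount m r q ≤ S.count r q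

theorem dummyCount_segment {m v : ℕ} {r q : Fin v} (h : dummyCount m r q ≠ 0) :
    r.val / 2 ^ m = q.val / 2 ^ m := by
  unfold dummyCount at h
  split_ifs at h with h'
  · rw [Nat.div_eq_of_lt (by omega), Nat.div_eq_of_lt (by omega)]
  · exact absurd rfl h

theorem dummyCount_sent {m v : ℕ} (r : Fin v) : ∑ q : Fin v, dummyCount m r q ≤ 1 := by
  simp only [dummyCount]
  rw [← card_filter, card_le_one]
  intro a ha b hb
  simp only [mem_filter, mem_univ, true_and] at ha hb
  exact Fin.ext (by omega)

theorem dummyCount_received {m v : ℕ} (q : Fin v) : ∑ r : Fin v, dummyCount m r q ≤ 1 := by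
  simp only [dummyCount]
  rw [← card_filter, card_le_one]
  intro a ha b hb
  simp only [mem_filter, mem_univ, true_and] at ha hb
  exact Fin.ext (by omega)

theorem card_mates_le {m v : ℕ} (r : Fin v) :
    #{q : Fin v | q ≠ r ∧ q.val / 2 ^ m = r.val / 2 ^ m} ≤ 2 ^ m - 1 := by
  have hN : 0 < 2 ^ m := by positivity
  have : 2 ^ m - 1 = #((range (2 ^ m)).erase (r.val % 2 ^ m)) := by
    rw [card_erase_of_mem (by simpa using Nat.mod_lt _ hN), card_range]
  rw [this]
  apply card_le_card_of_injOn (fun q => q.val % 2 ^ m)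
  · intro q hq
    simp only [coe_filter, mem_univ, true_and, Set.mem_ofPred_eq] at hq
    simp only [coe_erase, coe_range, Set.mem_sdiff, Set.mem_Iio, Set.mem_singleton_iff]
    refine ⟨Nat.mod_lt _ hN, fun h => hq.1 (Fin.ext ?_)⟩
    rw [← Nat.div_add_mod q.val (2 ^ m), ← Nat.div_add_mod r.val (2 ^ m), hq.2, h]
  · intro a ha b hb h
    simp only [coe_filter, mem_univ, true_and, Set.mem_ofPred_eq] at ha hb h
    apply Fin.ext
    rw [← Nat.div_add_mod a.val (2 ^ m), ← Nat.div_add_mod b.val (2 ^ m), ha.2, hb.2, h]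

theorem actsOn_route {k m : ℕ} {f : ℕ → ℕ} (hf : ∀ t < 2 ^ m, f t < 2 ^ m)
    (hi : Set.InjOn f (Set.Iio (2 ^ m))) (g : ℕ → List Bool → List Bool) :
    ActsOn k m (route k m f g) := by
  obtain ⟨τ, hτ, hτt⟩ := exists_perm_target hf hi
  refine ⟨rfl, ?_, ?_, ?_, fun r q => Nat.le_add_left _ _⟩
  · intro r q h
    by_cases hd : dummyCount m r q = 0
    · simp only [route, hd, Nat.add_zero, ne_eq, ite_eq_right_iff, one_ne_zero, imp_false,
        not_not] at h
      rw [h, ← hτt, hτ]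
    · exact dummyCount_segment hd
  · intro r
    simp only [route, sum_add_distrib]
    have h1 := dummyCount_sent (m := m) r
    have h2 : ∑ q : Fin (2 ^ k), (if q.val = target m f r then 1 else 0) ≤ 1 := by
      rw [← card_filter, card_le_one]
      intro a ha b hb
      simp only [mem_filter, mem_univ, true_and] at ha hb
      exact Fin.ext (by omega)
    omega
  · intro q
    simp only [route, sum_add_distrib]
    have h1 := dummyCount_received (m := m) q
    have h2 : ∑ r : Fin (2 ^ k), (if q.val = target m f r then 1 else 0) ≤ 1 := by
      rw [← card_filter, card_le_one]
      intro a ha b hb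
      simp only [mem_filter, mem_univ, true_and, ← hτt] at ha hb
      exact Fin.ext (τ.injective (ha.symm.trans hb))
    omega

theorem actsOn_exchange {k m : ℕ} (hm : m ≤ 2) : ActsOn k m (exchange k m) := by
  have hN4 : 2 ^ m ≤ 4 := Nat.pow_le_pow_right (n := 2) (by norm_num) hm
  refine ⟨rfl, ?_, ?_, ?_, fun r q => Nat.le_add_left _ _⟩
  · intro r q h
    by_cases hd : dummyCount m r q = 0
    · simp only [exchange, hd, Nat.add_zero, ne_eq, ite_eq_right_iff, one_ne_zero, imp_false,
        not_not] at h
      exact h.2.symm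
    · exact dummyCount_segment hd
  · intro r
    simp only [exchange, sum_add_distrib]
    have h1 := dummyCount_sent (m := m) r
    have h2 : ∑ q : Fin (2 ^ k), (if Mates m r q then 1 else 0) ≤ 3 := by
      rw [← card_filter]
      exact (card_mates_le r).trans (by omega)
    omega
  · intro q
    simp only [exchange, sum_add_distrib]
    have h1 := dummyCount_received (m := m) q
    have h2 : ∑ r : Fin (2 ^ k), (if Mates m r q then 1 else 0) ≤ 3 := by
      rw [← card_filter]
      refine le_trans (card_le_card ?_) ((card_mates_le (m := m) q).trans (by omega))
      intro r hr
      have hr := (mem_filter.1 hr).2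
      exact mem_filter.2 ⟨mem_univ _, hr.1.symm, hr.2.symm⟩
    omega

theorem actsOn_localSort (k m : ℕ) : ActsOn k m (localSort k m) :=
  ⟨rfl, fun _ _ => dummyCount_segment, fun r => (dummyCount_sent r).trans (by norm_num),
    fun q => (dummyCount_received q).trans (by norm_num), fun _ _ => le_rfl⟩

theorem actsOn_columnsortSteps {k m : ℕ} (hm : 1 ≤ m) {S} (hS : S ∈ columnsortSteps k m) :
    ∃ m', 1 ≤ m' ∧ m' ≤ m ∧ ActsOn k m' S := by
  induction m using Nat.strong_induction_on with
  | _ m ih =>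
  by_cases hm2 : m ≤ 2
  · rw [columnsortSteps_of_le hm2] at hS
    simp only [List.mem_cons, List.not_mem_nil, or_false] at hS
    refine ⟨m, hm, le_rfl, ?_⟩
    rcases hS with rfl | rfl
    · exact actsOn_exchange hm2
    · exact actsOn_localSort k m
  obtain ⟨a, ha⟩ : ∃ a, a = (2 * m + 2) / 3 := ⟨_, rfl⟩
  have hrec : S ∈ columnsortSteps k a → ∃ m', 1 ≤ m' ∧ m' ≤ m ∧ ActsOn k m' S := by
    intro h
    obtain ⟨m', h1, h2, h3⟩ := ih a (by omega) (by omega) h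
    exact ⟨m', h1, by omega, h3⟩
  have hN : 2 ^ m = 2 ^ a * 2 ^ (m - a) := by rw [← pow_add]; congr 1; omega
  have hpos : 0 < 2 ^ m := by positivity
  rw [columnsortSteps_of_gt hm2 ha] at hS
  simp only [List.mem_append, List.mem_singleton] at hS
  rcases hS with ((((((h | h) | h) | h) | h) | h) | h) | h
  · exact hrec h
  · refine ⟨m, hm, le_rfl, h ▸ actsOn_route ?_ ?_ _⟩
    · rw [hN]; exact fun t ht => transposePos_lt ht
    · rw [hN]; exact transposePos_injOn _ _
  · exact hrec h
  · refine ⟨m, hm, le_rfl, h ▸ actsOn_route ?_ ?_ _⟩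
    · rw [hN]; exact fun t ht => diagPos_lt ht
    · rw [hN]; exact diagPos_injOn _ _
  · exact hrec h
  · refine ⟨m, hm, le_rfl, h ▸ actsOn_route ?_ ?_ _⟩
    · rw [hN] at hpos ⊢; exact fun t _ => Nat.mod_lt _ hpos
    · rw [hN]; exact add_mod_injOn _ _
  · exact hrec h
  · refine ⟨m, hm, le_rfl, h ▸ actsOn_route ?_ ?_ _⟩
    · rw [hN] at hpos ⊢; exact fun t _ => Nat.mod_lt _ hpos
    · rw [hN]; exact add_mod_injOn _ _

theorem proc_two_pow {k a : ℕ} (ha : a ≤ k) (r : Fin (2 ^ k)) :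
    proc (2 ^ k) (2 ^ a) r = r.val / 2 ^ (k - a) := by
  rw [proc, Nat.pow_div ha (by norm_num)]

theorem columnsort_wellFormed {k : ℕ} (hk : 1 ≤ k) : (columnsort k).WellFormed 1 := by
  refine ⟨?_, ?_, ?_⟩
  · intro S hS
    obtain ⟨m, h1, h2, h3⟩ := actsOn_columnsortSteps hk hS
    rw [h3.label, Nat.log_pow (by norm_num)]
    omega
  · intro S hS r q h
    obtain ⟨m, h1, h2, h3⟩ := actsOn_columnsortSteps hk hS
    rw [h3.label, proc_two_pow (by omega), proc_two_pow (by omega), Nat.sub_sub_self h2]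
    exact h3.segment r q h
  · intro K _ x hx t
    exact (columnsort_stepOK x hx (mem_trace x _ t)).1

/-! ### Communication complexity -/

/-- Sums over labels become sums over the list of non-local supersteps, which can then be estimated
term by term. -/
theorem sum_range_filter_label {n v : ℕ} {D : Type} (l : List (Superstep n v D)) (a : ℕ)
    (f : Superstep n v D → ℝ) :
    ∑ i ∈ range a, ((l.filter fun S => S.label = i).map f).sum =
      ((l.filter fun S => S.label < a).map f).sum := by
  induction l with
  | nil => simp
  | cons S l ih =>
    have : ∀ i, (((S :: l).filter fun S => S.label = i).map f).sum =
        (if S.label = i then f S else 0) + ((l.filter fun S => S.label = i).map f).sum := by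
      intro i
      rw [List.filter_cons]
      by_cases h : S.label = i <;> simp [h]
    simp only [this, sum_add_distrib, ih, sum_ite_eq, mem_range]
    rw [List.filter_cons]
    by_cases h : S.label < a <;> simp [h]

theorem sum_cumDegree {n v : ℕ} (A : StaticAlgorithm n v) (a p : ℕ) :
    ∑ i ∈ range a, (A.cumDegree i p : ℝ) =
      ((A.steps.filter fun S => S.label < a).map fun S => (S.degree p : ℝ)).sum := by
  rw [← sum_range_filter_label]
  apply sum_congr rfl
  intro i _
  rw [StaticAlgorithm.cumDegree, Nat.cast_list_sum, List.map_map]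
  rfl

theorem sum_numSteps {n v : ℕ} (A : StaticAlgorithm n v) (a : ℕ) :
    ∑ i ∈ range a, (A.numSteps i : ℝ) = ((A.steps.filter fun S => S.label < a).length : ℝ) := by
  have := sum_range_filter_label A.steps a fun _ => 1
  simpa [StaticAlgorithm.numSteps] using this

theorem commComplexity_eq {n v : ℕ} (A : StaticAlgorithm n v) (p : ℕ) (σ : ℝ) :
    A.commComplexity p σ =
      ((A.steps.filter fun S => S.label < Nat.log 2 p).map fun S => (S.degree p : ℝ)).sum +
        ((A.steps.filter fun S => S.label < Nat.log 2 p).length : ℝ) * σ := by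
  rw [StaticAlgorithm.commComplexity, sum_add_distrib, sum_cumDegree, ← sum_mul, sum_numSteps]

theorem card_proc_le {k a : ℕ} (ha : a ≤ k) (j : ℕ) :
    #{r : Fin (2 ^ k) | proc (2 ^ k) (2 ^ a) r = j} ≤ 2 ^ (k - a) := by
  have hN : 0 < 2 ^ (k - a) := by positivity
  conv_rhs => rw [← card_range (2 ^ (k - a))]
  apply card_le_card_of_injOn (fun r => r.val % 2 ^ (k - a))
  · intro r _
    simpa using Nat.mod_lt _ hN
  · intro r hr q hq h
    simp only [coe_filter, mem_univ, true_and, Set.mem_ofPred_eq, proc_two_pow ha] at hr hq h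
    apply Fin.ext
    rw [← Nat.div_add_mod r.val (2 ^ (k - a)), ← Nat.div_add_mod q.val (2 ^ (k - a)), hr, hq, h]

/-- A processor stands for at most 2 ^ (k - a) PEs, each of which sends and receives at most four
messages. -/
theorem ActsOn.degree_le {k m a : ℕ} {S} (h : ActsOn k m S) (ha : a ≤ k) :
    S.degree (2 ^ a) ≤ 4 * 2 ^ (k - a) := by
  rw [Superstep.degree, Finset.sup_le_iff]
  intro j _
  have key : ∀ f : Fin (2 ^ k) → Fin (2 ^ k) → ℕ, (∀ r, ∑ q, f r q ≤ 4) →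
      (∑ r, ∑ q, if proc (2 ^ k) (2 ^ a) r = j then f r q else 0) ≤ 4 * 2 ^ (k - a) := by
    intro f hf
    calc (∑ r, ∑ q, if proc (2 ^ k) (2 ^ a) r = j then f r q else 0)
        ≤ ∑ r, if proc (2 ^ k) (2 ^ a) r = j then 4 else 0 := by
          apply sum_le_sum
          intro r _
          split_ifs
          · exact hf r
          · simp
      _ = #{r : Fin (2 ^ k) | proc (2 ^ k) (2 ^ a) r = j} * 4 := by
          rw [← sum_filter, sum_const, smul_eq_mul]
      _ ≤ 4 * 2 ^ (k - a) := by
          rw [Nat.mul_comm]; exact Nat.mul_le_mul_left _ (card_proc_le ha j)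
  apply max_le
  · refine le_trans ?_ (key (fun r q => S.count r q) h.sent)
    refine sum_le_sum fun r _ => sum_le_sum fun q _ => ?_
    by_cases h1 : proc (2 ^ k) (2 ^ a) r = j
    · rw [if_pos h1]; split_ifs <;> omega
    · rw [if_neg h1, if_neg (fun h => h1 h.1)]
  · rw [Superstep.received, sum_comm]
    refine le_trans ?_ (key (fun r q => S.count q r) h.received)
    refine sum_le_sum fun r _ => sum_le_sum fun q _ => ?_
    by_cases h1 : proc (2 ^ k) (2 ^ a) r = j
    · rw [if_pos h1]; split_ifs <;> omega
    · rw [if_neg h1, if_neg (fun h => h1 h.2)]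

/-- Processor 0 alone achieves this: half a segment is at least as long as its block of PEs, so each
of them sends its dummy message to a PE outside the block. -/
theorem ActsOn.le_degree {k m j : ℕ} {S} (h : ActsOn k m S) (hj : j ≤ k) (hmk : m ≤ k)
    (hm : k - j < m) : 2 ^ (k - j) ≤ S.degree (2 ^ j) := by
  have hN : 0 < 2 ^ (k - j) := by positivity
  have hhalf : 2 ^ m / 2 = 2 ^ (m - 1) := by
    obtain ⟨d, rfl⟩ : ∃ d, m = d + 1 := ⟨m - 1, by omega⟩
    simp [pow_succ]
  have hle : 2 ^ (k - j) ≤ 2 ^ m / 2 := by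
    rw [hhalf]; exact Nat.pow_le_pow_right (by norm_num) (by omega)
  have hmk' : 2 ^ m ≤ 2 ^ k := Nat.pow_le_pow_right (by norm_num) hmk
  have h0 : S.sent (2 ^ j) 0 ≤ S.degree (2 ^ j) :=
    (le_max_left _ _).trans (Finset.le_sup (f := fun j' => max (S.sent (2 ^ j) j')
      (S.received (2 ^ j) j')) (by simp))
  refine le_trans ?_ h0
  have hcard : 2 ^ (k - j) ≤ #{r : Fin (2 ^ k) | r.val < 2 ^ (k - j)} := by
    conv_lhs => rw [← card_range (2 ^ (k - j))]
    apply card_le_card_of_injOn (fun i => Fin.ofNat (2 ^ k) i)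
    · intro i hi
      simp only [coe_range, Set.mem_Iio] at hi
      simp only [coe_filter, mem_univ, true_and, Set.mem_ofPred_eq, Fin.ofNat]
      rwa [Nat.mod_eq_of_lt (by omega)]
    · intro i hi i' hi' he
      simp only [coe_range, Set.mem_Iio] at hi hi'
      simpa [Fin.ofNat, Nat.mod_eq_of_lt (show i < 2 ^ k by omega),
        Nat.mod_eq_of_lt (show i' < 2 ^ k by omega)] using he
  refine hcard.trans ?_
  rw [card_filter, Superstep.sent]
  apply sum_le_sum
  intro r _
  split_ifs with hr
  · have hq : r.val + 2 ^ m / 2 < 2 ^ k := by omega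
    refine le_trans ?_ (single_le_sum (f := fun q => if proc (2 ^ k) (2 ^ j) r = 0 ∧
      proc (2 ^ k) (2 ^ j) q ≠ 0 then S.count r q else 0) (fun _ _ => Nat.zero_le _)
      (mem_univ ⟨r.val + 2 ^ m / 2, hq⟩))
    simp only [proc_two_pow hj]
    rw [if_pos]
    · refine le_trans ?_ (h.dummy _ _)
      simp only [dummyCount]
      rw [if_pos ⟨by omega, trivial⟩]
    · refine ⟨Nat.div_eq_of_lt hr, ?_⟩
      rw [Nat.div_ne_zero_iff]
      omega
  · exact Nat.zero_le _

/-- The inequality holds for each superstep with label below j: its degree is at most 4 on n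
processors and at least n / 2 ^ j on 2 ^ j processors. -/
theorem columnsort_wise {k : ℕ} (hk : 1 ≤ k) : (columnsort k).Wise (1 / 4) (2 ^ k) := by
  intro j hj hjk
  rw [Nat.log_pow (by norm_num)] at hjk
  rw [sum_cumDegree, sum_cumDegree, ← List.sum_map_mul_left]
  apply List.sum_le_sum
  intro S hS
  rw [List.mem_filter, decide_eq_true_eq] at hS
  obtain ⟨m, h1, h2, h3⟩ := actsOn_columnsortSteps hk hS.1
  have hlab := h3.label
  have hd : (S.degree (2 ^ k) : ℝ) ≤ 4 := by
    have := h3.degree_le (le_refl k)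
    simp only [Nat.sub_self, pow_zero, Nat.mul_one] at this
    exact_mod_cast this
  have hd' : (2 : ℝ) ^ (k - j) ≤ S.degree (2 ^ j) := by
    exact_mod_cast h3.le_degree hjk h2 (by omega)
  have hq : (((2 ^ k : ℕ) : ℝ)) / 2 ^ j = 2 ^ (k - j) := by
    push_cast
    rw [div_eq_iff (by positivity), ← pow_add, Nat.sub_add_cancel hjk]
  rw [hq]
  have : (0 : ℝ) < 2 ^ (k - j) := by positivity
  nlinarith

/-! ### The number of supersteps -/

/-- The number of supersteps with label less than `a`. -/
def countBelow {n v : ℕ} {D : Type} (l : List (Superstep n v D)) (a : ℕ) : ℕ :=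
  (l.filter fun S => S.label < a).length

theorem countBelow_append {n v : ℕ} {D : Type} (l l' : List (Superstep n v D)) (a : ℕ) :
    countBelow (l ++ l') a = countBelow l a + countBelow l' a := by
  simp [countBelow]

theorem countBelow_le_length {n v : ℕ} {D : Type} (l : List (Superstep n v D)) (a : ℕ) :
    countBelow l a ≤ l.length := List.length_filter_le _ _

/-- The exponent of the complexity of recursive Columnsort. -/
noncomputable abbrev sortExp : ℝ := Real.logb (3 / 2) 4

theorem sortExp_nonneg : 0 ≤ sortExp := Real.logb_nonneg (by norm_num) (by norm_num)

theorem rpow_sortExp : (3 / 2 : ℝ) ^ sortExp = 4 :=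
  Real.rpow_logb (by norm_num) (by norm_num) (by norm_num)

/-- A segment that fits into the block of one processor is sorted without communication. -/
theorem countBelow_eq_zero {k m a : ℕ} (hm : 1 ≤ m) (hmb : m ≤ k - a) :
    countBelow (columnsortSteps k m) a = 0 := by
  rw [countBelow, List.length_eq_zero_iff, List.filter_eq_nil_iff]
  intro S hS
  obtain ⟨m', _, h2, h3⟩ := actsOn_columnsortSteps hm hS
  rw [h3.label, decide_eq_true_eq]
  omega

theorem countBelow_rec {k m a c : ℕ} (hm : ¬ m ≤ 2) (hc : c = (2 * m + 2) / 3) :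
    countBelow (columnsortSteps k m) a ≤ 4 * countBelow (columnsortSteps k c) a + 4 := by
  rw [columnsortSteps_of_gt hm hc]
  simp only [countBelow_append]
  have : ∀ S : Superstep (2 ^ k) (2 ^ k) Tags, countBelow [S] a ≤ 1 := fun S =>
    countBelow_le_length _ _
  have h1 := this (route k m (transposePos (2 ^ c) (2 ^ (m - c))) fun _ s => s)
  have h2 := this (route k m (diagPos (2 ^ c) (2 ^ (m - c))) fun _ s => s)
  have h3 := this (route k m (shiftPos (2 ^ c) (2 ^ (m - c))) fun t s => shiftTag (2 ^ c) t :: s)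
  have h4 := this (route k m (unshiftPos (2 ^ c) (2 ^ (m - c))) fun _ s => s.tail)
  omega

theorem countBelow_short {k m a : ℕ} (hm : m ≤ 2) :
    countBelow (columnsortSteps k m) a ≤ 2 := by
  rw [columnsortSteps_of_le hm]
  exact countBelow_le_length _ _

/-- The summand 4 / 3 turns T ≤ 4 T' + 4 into T + 4 / 3 ≤ 4 (T' + 4 / 3), and the factor 4 is
absorbed by (3 / 2) ^ `sortExp` = 4. The constant 40 / 3 = 4 · 2 + 4 + 4 / 3 covers the case in
which the columns are sorted directly. -/
theorem countBelow_long {k a m : ℕ} (hm : 3 ≤ m) (hmb : k - a < m) :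
    (countBelow (columnsortSteps k m) a : ℝ) + 4 / 3 ≤
      40 / 3 * (((m : ℝ) - 2) / max 1 (((k - a : ℕ) : ℝ) - 1)) ^ sortExp := by
  induction m using Nat.strong_induction_on with
  | _ m ih =>
  obtain ⟨c, hc⟩ : ∃ c, c = (2 * m + 2) / 3 := ⟨_, rfl⟩
  have hrec : (countBelow (columnsortSteps k m) a : ℝ) ≤
      4 * countBelow (columnsortSteps k c) a + 4 := by
    exact_mod_cast countBelow_rec (by omega) hc
  set D : ℝ := max 1 (((k - a : ℕ) : ℝ) - 1) with hD
  have hD1 : 1 ≤ D := le_max_left _ _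
  have hm3 : (3 : ℝ) ≤ m := by exact_mod_cast hm
  have hmb' : ((k - a : ℕ) : ℝ) + 1 ≤ m := by exact_mod_cast hmb
  have hone : 1 ≤ ((m : ℝ) - 2) / D := by
    rw [one_le_div (by linarith)]
    exact max_le (by linarith) (by linarith)
  have hpow := Real.one_le_rpow hone sortExp_nonneg
  by_cases hcb : c ≤ k - a
  · rw [countBelow_eq_zero (by omega) hcb] at hrec
    rw [Nat.cast_zero] at hrec
    linarith
  rcases Nat.lt_or_ge 2 c with hc2 | hc2
  · have := ih c (by omega) (by omega) (by omega)
    -- Measuring lengths by m - 2 absorbs the rounding up in c = ⌈2m/3⌉.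
    have hcm : (c : ℝ) - 2 ≤ 2 / 3 * ((m : ℝ) - 2) := by
      have : 3 * c ≤ 2 * m + 2 := by omega
      have : (3 : ℝ) * c ≤ 2 * m + 2 := by exact_mod_cast this
      linarith
    have hc3 : (3 : ℝ) ≤ c := by exact_mod_cast hc2
    have h1 : (((c : ℝ) - 2) / D) ^ sortExp ≤ (((m : ℝ) - 2) / D / (3 / 2)) ^ sortExp := by
      apply Real.rpow_le_rpow (div_nonneg (by linarith) (by linarith)) _ sortExp_nonneg
      rw [div_right_comm]
      apply div_le_div_of_nonneg_right _ (by linarith)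
      linarith
    rw [Real.div_rpow (x := ((m : ℝ) - 2) / D) (by linarith) (by norm_num), rpow_sortExp] at h1
    linarith
  · have h2 := countBelow_short (k := k) (a := a) hc2
    have h2' : (countBelow (columnsortSteps k c) a : ℝ) ≤ 2 := by exact_mod_cast h2
    linarith

/-- The constant in the bound on the number of supersteps. -/
noncomputable abbrev stepConst : ℝ := 14 * 2 ^ sortExp

theorem stepConst_pos : 0 < stepConst := by positivity

theorem one_le_two_rpow : (1 : ℝ) ≤ 2 ^ sortExp :=
  Real.one_le_rpow (by norm_num) sortExp_nonneg

/-- Replacing (m - 2) / max 1 (k - a - 1) by m / max 1 (k - a) costs at most a factor 2 in the base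
of the power; 40 / 3 is rounded up to 14. -/
theorem countBelow_le {k a m : ℕ} (hm : 1 ≤ m) :
    (countBelow (columnsortSteps k m) a : ℝ) ≤
      stepConst * ((m : ℝ) / max 1 ((k - a : ℕ) : ℝ)) ^ sortExp := by
  have hmax : (1 : ℝ) ≤ max 1 ((k - a : ℕ) : ℝ) := le_max_left _ _
  have hm1 : (1 : ℝ) ≤ m := by exact_mod_cast hm
  have hC := one_le_two_rpow
  rcases Nat.lt_or_ge (k - a) m with hmb | hmb
  · have hmb' : ((k - a : ℕ) : ℝ) + 1 ≤ m := by exact_mod_cast hmb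
    rcases Nat.lt_or_ge 2 m with h3 | h3
    · have h := countBelow_long h3 hmb
      have hm3 : (3 : ℝ) ≤ m := by exact_mod_cast h3
      set D : ℝ := max 1 (((k - a : ℕ) : ℝ) - 1) with hD
      have hD1 : 1 ≤ D := le_max_left _ _
      have hle : ((m : ℝ) - 2) / D ≤ 2 * ((m : ℝ) / max 1 ((k - a : ℕ) : ℝ)) := by
        rw [← mul_div_assoc, div_le_div_iff₀ (by linarith) (by linarith)]
        have : max 1 ((k - a : ℕ) : ℝ) ≤ 2 * D := by
          apply max_le (by linarith)
          have : ((k - a : ℕ) : ℝ) - 1 ≤ D := le_max_right _ _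
          linarith
        nlinarith
      have h1 := Real.rpow_le_rpow (div_nonneg (by linarith) (by linarith)) hle sortExp_nonneg
      rw [Real.mul_rpow (by norm_num) (by positivity)] at h1
      have : 0 ≤ (2 : ℝ) ^ sortExp * ((m : ℝ) / max 1 ((k - a : ℕ) : ℝ)) ^ sortExp := by positivity
      rw [stepConst, mul_assoc]
      linarith
    · have h2 : (countBelow (columnsortSteps k m) a : ℝ) ≤ 2 := by
        exact_mod_cast countBelow_short h3
      have hone : 1 ≤ (m : ℝ) / max 1 ((k - a : ℕ) : ℝ) := by
        rw [one_le_div (by linarith)]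
        exact max_le hm1 (by linarith)
      have hpow := Real.one_le_rpow hone sortExp_nonneg
      rw [stepConst]
      nlinarith
  · rw [countBelow_eq_zero hm hmb]
    rw [Nat.cast_zero]; positivity

theorem lg_two_pow {k : ℕ} : lg (2 ^ k) = max 1 (k : ℝ) := by
  rw [lg, Real.logb_pow, Real.logb_self_eq_one (by norm_num), mul_one]

theorem two_pow_div {k a : ℕ} (ha : a ≤ k) : (2 : ℝ) ^ k / 2 ^ a = 2 ^ (k - a) := by
  rw [div_eq_iff (by positivity), ← pow_add, Nat.sub_add_cancel ha]

theorem columnsort_commComplexity_le {k a : ℕ} (ha1 : 1 ≤ a) (ha : a ≤ k) {σ : ℝ} (hσ : 0 ≤ σ) :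
    (columnsort k).commComplexity (2 ^ a) σ ≤
      4 * stepConst * (((2 ^ k : ℝ) / 2 ^ a + σ) *
        (lg (2 ^ k) / lg ((2 ^ k : ℝ) / 2 ^ a)) ^ sortExp) := by
  have hk : (1 : ℝ) ≤ k := by exact_mod_cast ha1.trans ha
  rw [two_pow_div ha, lg_two_pow, lg_two_pow, max_eq_right hk, commComplexity_eq,
    Nat.log_pow (by norm_num)]
  have hc := countBelow_le (k := k) (a := a) (m := k) (ha1.trans ha)
  change (((columnsort k).steps.filter fun S => S.label < a).length : ℝ) ≤ _ at hc
  set l := (columnsort k).steps.filter fun S => S.label < a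
  have hsum : (l.map fun S => (S.degree (2 ^ a) : ℝ)).sum ≤ l.length * (4 * 2 ^ (k - a)) := by
    rw [← nsmul_eq_mul, ← List.length_map (as := l) fun S => (S.degree (2 ^ a) : ℝ)]
    apply List.sum_le_card_nsmul
    intro y hy
    obtain ⟨S, hS, rfl⟩ := List.mem_map.1 hy
    obtain ⟨m, _, _, h3⟩ := actsOn_columnsortSteps (ha1.trans ha) (List.mem_filter.1 hS).1
    exact_mod_cast h3.degree_le ha
  have h2 : (0 : ℝ) < 2 ^ (k - a) := by positivity
  calc _ ≤ (l.length : ℝ) * (4 * (2 ^ (k - a) + σ)) := by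
        have : (0 : ℝ) ≤ l.length * σ := by positivity
        linarith
    _ ≤ (stepConst * ((k : ℝ) / max 1 ((k - a : ℕ) : ℝ)) ^ sortExp) * (4 * (2 ^ (k - a) + σ)) :=
        mul_le_mul_of_nonneg_right hc (by positivity)
    _ = _ := by ring

theorem columnsort_comparisons_le {k a : ℕ} (hk : 1 ≤ k) (ha : a ≤ k) {c : ℕ}
    (hc : 16 * stepConst ≤ c) : (columnsort k).ComparisonsAtMost (2 ^ a)
      (c * ((2 ^ k : ℝ) / 2 ^ a) * lg (2 ^ k) ^ sortExp) := by
  intro K _ x hx j _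
  have hk1 : (1 : ℝ) ≤ k := by exact_mod_cast hk
  rw [two_pow_div ha, lg_two_pow, max_eq_right hk1]
  have hlen : ((columnsort k).steps.length : ℝ) ≤ stepConst * (k : ℝ) ^ sortExp := by
    have h := countBelow_le (k := k) (a := k) (m := k) hk
    simp only [Nat.sub_self, Nat.cast_zero, zero_le_one, max_eq_left, div_one] at h
    rw [countBelow, List.filter_eq_self.2] at h
    · exact h
    · intro S hS
      obtain ⟨m, h1, h2, h3⟩ := actsOn_columnsortSteps hk hS
      rw [h3.label, decide_eq_true_eq]
      omega
  have hcmp : (columnsort k).comparisons (2 ^ a) x j ≤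
      (columnsort k).steps.length * (16 * 2 ^ (k - a)) := by
    rw [StaticAlgorithm.comparisons]
    refine (sum_le_sum fun t _ => ?_).trans_eq
      (by rw [sum_const, card_univ, Fintype.card_fin, smul_eq_mul])
    calc _ ≤ ∑ r, if proc (2 ^ k) (2 ^ a) r = j then 16 else 0 := by
          apply sum_le_sum
          intro r _
          split_ifs
          · exact (columnsort_stepOK x hx (mem_trace x _ t)).2.2 r
          · exact le_rfl
      _ = #{r : Fin (2 ^ k) | proc (2 ^ k) (2 ^ a) r = j} * 16 := by
          rw [← sum_filter, sum_const, smul_eq_mul]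
      _ ≤ 16 * 2 ^ (k - a) := by
          rw [Nat.mul_comm]; exact Nat.mul_le_mul_left _ (card_proc_le ha j)
  have hcmp' : ((columnsort k).comparisons (2 ^ a) x j : ℝ) ≤
      (columnsort k).steps.length * (16 * 2 ^ (k - a)) := by exact_mod_cast hcmp
  calc _ ≤ _ := hcmp'
    _ ≤ (stepConst * (k : ℝ) ^ sortExp) * (16 * 2 ^ (k - a)) :=
        mul_le_mul_of_nonneg_right hlen (by positivity)
    _ = (16 * stepConst) * (2 ^ (k - a) * (k : ℝ) ^ sortExp) := by ring
    _ ≤ c * (2 ^ (k - a) * (k : ℝ) ^ sortExp) := mul_le_mul_of_nonneg_right hc (by positivity)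
    _ = _ := by ring

/-! ### Executions on two inputs -/

namespace CompTree

variable {n : ℕ} {α K : Type} [LinearOrder K] {x x' : Fin n → K}

theorem eval_eq_of_agree (T : CompTree n α)
    (h : ∀ ij ∈ T.path x, (x ij.1 < x ij.2 ↔ x' ij.1 < x' ij.2)) : T.eval x' = T.eval x := by
  induction T with
  | done a => rfl
  | cmp i j t e iht ihe =>
    simp only [path, List.mem_cons, forall_eq_or_imp] at h
    simp only [eval, ← h.1]
    split_ifs with hij
    · rw [if_pos hij] at h; exact iht h.2
    · rw [if_neg hij] at h; exact ihe h.2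

/-- The outcomes of the comparisons. -/
def bits (x : Fin n → K) : CompTree n α → List Bool
  | done _ => []
  | cmp i j t e => decide (x i < x j) :: if x i < x j then t.bits x else e.bits x

theorem length_bits (T : CompTree n α) : (T.bits x).length = (T.path x).length := by
  induction T with
  | done a => rfl
  | cmp i j t e iht ihe =>
    simp only [bits, path, List.length_cons]
    split_ifs
    · rw [iht]
    · rw [ihe]

/-- The outcomes form a self-delimiting code: they tell at each node which way to go and hence where
the computation stops, so nothing has to mark the end. -/
theorem eval_eq_of_bits (T : CompTree n α) {l l' : List Bool}
    (h : T.bits x ++ l = T.bits x' ++ l') : T.eval x' = T.eval x ∧ l = l' := by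
  induction T with
  | done a => exact ⟨rfl, h⟩
  | cmp i j t e iht ihe =>
    simp only [bits, List.cons_append, List.cons.injEq, decide_eq_decide] at h
    simp only [eval, ← h.1]
    simp only [← h.1] at h
    split_ifs with hij
    · rw [if_pos hij, if_pos hij] at h; exact iht h.2
    · rw [if_neg hij, if_neg hij] at h; exact ihe h.2

end CompTree

section Lower

variable {n v : ℕ} {D K : Type} [LinearOrder K]

theorem exec_congr {S : Superstep n v D} {x x' : Fin n → K} {c : Config n v D}
    (h : ∀ r, S.outcome x' c r = S.outcome x c r) : S.exec x' c = S.exec x c := by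
  funext r
  simp only [Superstep.exec, Superstep.inbox, h]

theorem finalConfig_eq_of_agree {x x' : Fin n → K} (l : List (Superstep n v D)) (c : Config n v D)
    (h : ∀ p ∈ trace x l c, ∀ r, ∀ ij ∈ (p.1.work r (p.2 r)).path x,
      (x ij.1 < x ij.2 ↔ x' ij.1 < x' ij.2)) : finalConfig x' l c = finalConfig x l c := by
  induction l generalizing c with
  | nil => rfl
  | cons S l ih =>
    simp only [trace, List.mem_cons, forall_eq_or_imp] at h
    have he : S.exec x' c = S.exec x c :=
      exec_congr fun r => CompTree.eval_eq_of_agree _ (h.1 r)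
    simp only [finalConfig, List.foldl_cons, he]
    exact ih _ h.2

/-- The output is a function of the final configuration and has no further access to the input
values. -/
theorem rank_eq_of_finalConfig_eq {A : StaticAlgorithm n v} (hA : A.Solves) {x x' : Fin n → K}
    (hx : Function.Injective x) (hx' : Function.Injective x')
    (h : finalConfig x' A.steps A.init = finalConfig x A.steps A.init) (i : Fin n) :
    rank x i = rank x' i := by
  obtain ⟨⟨r, hr⟩, _⟩ := hA K x hx i
  obtain ⟨_, h2⟩ := hA K x' hx' i
  rw [run_length, h] at h2
  rw [run_length] at hr
  exact h2 r _ hr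

/-! ### Keys that move -/

/-- The keys that a processing element sends to another one. -/
def moved (x : Fin n → K) (S : Superstep n v D) (c : Config n v D) : Finset (Fin n) :=
  univ.biUnion fun q => univ.biUnion fun r => (range (if r = q then 0 else S.count q r)).biUnion
    fun k => ((S.outcome x c q).2 r k).keys.toFinset

/-- The keys that a processing element sends to another one during an execution. -/
def allMoved (x : Fin n → K) : List (Superstep n v D) → Config n v D → Finset (Fin n)
  | [], _ => ∅
  | S :: l, c => moved x S c ∪ allMoved x l (S.exec x c)

/-- The number of messages between different processing elements. -/
def traffic (S : Superstep n v D) : ℕ := ∑ q, ∑ r, if r = q then 0 else S.count q r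

theorem card_moved_le {x : Fin n → K} {S : Superstep n v D} {c : Config n v D} {κ : ℕ}
    (h : S.Legal κ x c) : #(moved x S c) ≤ κ * traffic S := by
  rw [traffic, mul_sum]
  refine card_biUnion_le.trans (sum_le_sum fun q _ => ?_)
  rw [mul_sum]
  refine card_biUnion_le.trans (sum_le_sum fun r _ => ?_)
  refine (card_biUnion_le_card_mul _ _ κ ?_).trans (by rw [card_range, Nat.mul_comm])
  intro k hk
  refine (List.toFinset_card_le _).trans ((h q).2.2 r k ?_).2
  rw [mem_range] at hk
  split_ifs at hk
  · omega
  · exact hk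

theorem card_allMoved_le {x : Fin n → K} {κ : ℕ} (l : List (Superstep n v D)) (c : Config n v D)
    (h : ∀ p ∈ trace x l c, p.1.Legal κ x p.2) :
    #(allMoved x l c) ≤ κ * (l.map traffic).sum := by
  induction l generalizing c with
  | nil => simp [allMoved]
  | cons S l ih =>
    simp only [trace, List.mem_cons, forall_eq_or_imp] at h
    rw [allMoved, List.map_cons, List.sum_cons, Nat.mul_add]
    exact (card_union_le _ _).trans (Nat.add_le_add (card_moved_le h.1) (ih _ h.2))

theorem mem_exec_keys {x : Fin n → K} {S : Superstep n v D} {c : Config n v D} {κ : ℕ}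
    (h : S.Legal κ x c) {r : Fin v} {i : Fin n} (hi : i ∈ (S.exec x c r).keys) :
    i ∈ (c r).keys ∨ i ∈ moved x S c := by
  simp only [Superstep.exec, List.mem_append, List.mem_flatMap, Superstep.inbox, List.mem_map,
    List.mem_finRange, true_and, List.mem_range] at hi
  rcases hi with hi | ⟨m, ⟨q, k, hk, rfl⟩, hi⟩
  · exact Or.inl ((h r).2.1 i hi)
  · by_cases hq : r = q
    · subst hq
      exact Or.inl (((h r).2.2 r k hk).1 i hi)
    · right
      simp only [moved, mem_biUnion, mem_univ, true_and, mem_range, List.mem_toFinset]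
      exact ⟨q, r, k, by rwa [if_neg hq], hi⟩

/-- A key can reach a PE only by message, so a key found where it did not start has been sent
between different PEs. -/
theorem mem_trace_keys {x : Fin n → K} {κ : ℕ} (l : List (Superstep n v D)) (c : Config n v D)
    (h : ∀ p ∈ trace x l c, p.1.Legal κ x p.2) {p} (hp : p ∈ trace x l c) {r : Fin v} {i : Fin n}
    (hi : i ∈ (p.2 r).keys) : i ∈ (c r).keys ∨ i ∈ allMoved x l c := by
  induction l generalizing c with
  | nil => simp [trace] at hp
  | cons S l ih =>
    simp only [trace, List.mem_cons, forall_eq_or_imp] at h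
    simp only [trace, List.mem_cons] at hp
    rw [allMoved, mem_union]
    rcases hp with rfl | hp
    · exact Or.inl hi
    · rcases ih _ h.2 hp with h' | h'
      · rcases mem_exec_keys h.1 h' with h'' | h''
        · exact Or.inl h''
        · exact Or.inr (Or.inl h'')
      · exact Or.inr (Or.inr h')

theorem traffic_le (S : Superstep n v D) : traffic S ≤ v * S.degree v := by
  have hproc : ∀ r : Fin v, proc v v r = r := by
    intro r
    rw [proc, Nat.div_self r.pos, Nat.div_one]
  calc traffic S = ∑ q : Fin v, S.sent v q := by
        apply sum_congr rfl
        intro q _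
        symm
        rw [Superstep.sent, sum_eq_single q]
        · apply sum_congr rfl
          intro r _
          simp only [hproc, true_and, ne_eq, ite_not, Fin.val_inj]
        · intro r _ hr
          apply sum_eq_zero
          intro r' _
          rw [if_neg]
          simp only [hproc, not_and]
          exact fun h => absurd (Fin.ext h) hr
        · simp
    _ ≤ ∑ _q : Fin v, S.degree v := by
        apply sum_le_sum
        intro q _
        exact (le_max_left _ _).trans (Finset.le_sup (f := fun j' => max (S.sent v j')
          (S.received v j')) (by simp))
    _ = v * S.degree v := by simp

end Lower

/-! ### Keys of adjacent ranks have to be compared -/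

theorem rank_comp_perm {n : ℕ} {K : Type} [LinearOrder K] (x : Fin n → K)
    (π : Equiv.Perm (Fin n)) (i : Fin n) : rank (x ∘ π) i = rank x (π i) := by
  refine card_nbij' π π.symm ?_ ?_ ?_ ?_
  · intro j hj; simpa using hj
  · intro j hj; simpa using hj
  · intro j _; simp
  · intro j _; simp

theorem rank_lt_rank {n : ℕ} {K : Type} [LinearOrder K] {x : Fin n → K} {i j : Fin n}
    (h : x i < x j) : rank x i < rank x j := by
  apply card_lt_card
  rw [ssubset_iff_of_subset]
  · exact ⟨i, by simpa using h, by simp⟩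
  · intro a ha
    simp only [mem_filter, mem_univ, true_and] at ha ⊢
    exact ha.trans h

/-- Exchanging two adjacent values changes the outcome of no other comparison. Without a comparison
of a and b both inputs would lead to the same final configuration, although the rank of a differs.
-/
theorem exists_compared {n v : ℕ} {A : StaticAlgorithm n v} (hA : A.Solves) {x : Fin n → ℕ}
    (hx : Function.Injective x) {a b : Fin n} (hab : x b = x a + 1) :
    ∃ p ∈ trace x A.steps A.init, ∃ r,
      (a, b) ∈ (p.1.work r (p.2 r)).path x ∨ (b, a) ∈ (p.1.work r (p.2 r)).path x := by
  by_contra hcon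
  push Not at hcon
  have hfin := finalConfig_eq_of_agree (x := x) (x' := x ∘ Equiv.swap a b) A.steps A.init (by
    intro p hp r ij hij
    obtain ⟨h1, h2⟩ := hcon p hp r
    obtain ⟨i, j⟩ := ij
    have hne1 : ¬ (i = a ∧ j = b) := by rintro ⟨rfl, rfl⟩; exact h1 hij
    have hne2 : ¬ (i = b ∧ j = a) := by rintro ⟨rfl, rfl⟩; exact h2 hij
    have ia := hx.eq_iff (a := i) (b := a)
    have ib := hx.eq_iff (a := i) (b := b)
    have ja := hx.eq_iff (a := j) (b := a)
    have jb := hx.eq_iff (a := j) (b := b)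
    simp only [Function.comp, Equiv.swap_apply_def]
    split_ifs <;> simp_all <;> omega)
  have hr := rank_eq_of_finalConfig_eq hA hx (hx.comp (Equiv.injective _)) hfin a
  rw [rank_comp_perm, Equiv.swap_apply_left] at hr
  exact absurd (rank_lt_rank (show x a < x b by omega)) (by omega)

/-! ### Keys that have to leave their home. -/

section WellFormed

variable {n v κ : ℕ} {A : StaticAlgorithm n v}

theorem legal_of_mem_trace (hA : A.WellFormed κ) {K : Type} [LinearOrder K] {x : Fin n → K}
    (hx : Function.Injective x) {p} (hp : p ∈ trace x A.steps A.init) : p.1.Legal κ x p.2 := by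
  obtain ⟨t, rfl⟩ := exists_of_mem_trace x A hp
  exact hA.legal K x hx t

/-- The total degree of an algorithm on its own machine. -/
def totalDegree (A : StaticAlgorithm n v) : ℕ := (A.steps.map fun S => S.degree v).sum

theorem card_allMoved_le_totalDegree (hA : A.WellFormed κ) {K : Type} [LinearOrder K]
    {x : Fin n → K} (hx : Function.Injective x) :
    #(allMoved x A.steps A.init) ≤ κ * (v * totalDegree A) := by
  refine (card_allMoved_le _ _ fun p hp => legal_of_mem_trace hA hx hp).trans ?_
  refine Nat.mul_le_mul_left κ ?_
  rw [totalDegree, ← List.sum_map_mul_left]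
  exact List.sum_le_sum fun S _ => traffic_le S

/-- If many disjoint pairs of keys are initially held by different processing elements, then many
keys have to move. -/
theorem le_of_separated_pairs (hA : A.WellFormed κ) (hs : A.Solves) {home : Fin n → Fin v}
    (hhome : ∀ r i, i ∈ (A.init r).keys → r = home i) (e : Equiv.Perm (Fin n)) {h : ℕ}
    (hn : 2 * h ≤ n)
    (hsep : ∀ i j : Fin n, i.val < h → j.val = i + (n - h) → home (e i) ≠ home (e j)) :
    h ≤ κ * (v * totalDegree A) := by
  -- The i-th pair receives the adjacent values 2i and 2i + 1; all other keys are larger.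
  let ρ : ℕ → ℕ := fun t => if t < h then 2 * t else if n - h ≤ t then 2 * (t - (n - h)) + 1
    else 2 * n + t
  have hρ : ∀ s t, s < n → t < n → ρ s = ρ t → s = t := by
    intro s t hs ht h
    simp only [ρ] at h
    split_ifs at h <;> omega
  let x : Fin n → ℕ := fun i => ρ (e.symm i)
  have hx : Function.Injective x := by
    intro i j hij
    exact e.symm.injective (Fin.ext (hρ _ _ (Fin.isLt _) (Fin.isLt _) hij))
  refine le_trans ?_ (card_allMoved_le_totalDegree hA hx)
  have key : ∀ i : Fin h, ∃ a ∈ allMoved x A.steps A.init,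
      (e.symm a).val = i ∨ (e.symm a).val = i + (n - h) := by
    intro i
    have hi := i.isLt
    let a : Fin n := e ⟨i, by omega⟩
    let b : Fin n := e ⟨i + (n - h), by omega⟩
    have hxab : x b = x a + 1 := by
      simp only [x, a, b, ρ, Equiv.symm_apply_apply]
      split_ifs <;> omega
    obtain ⟨p, hp, r, hr⟩ := exists_compared hs hx hxab
    have hl := legal_of_mem_trace hA hx hp
    have hmem : a ∈ (p.2 r).keys ∧ b ∈ (p.2 r).keys := by
      rcases hr with hr | hr
      · exact (hl r).1 _ hr
      · exact ((hl r).1 _ hr).symm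
    have hlegal := fun q hq => legal_of_mem_trace (p := q) hA hx hq
    rcases mem_trace_keys _ _ hlegal hp hmem.1 with h1 | h1
    · rcases mem_trace_keys _ _ hlegal hp hmem.2 with h2 | h2
      · exact absurd ((hhome r a h1).symm.trans (hhome r b h2)) (hsep _ _ hi rfl)
      · exact ⟨b, h2, Or.inr (by simp [b])⟩
    · exact ⟨a, h1, Or.inl (by simp [a])⟩
  choose f hf hfe using key
  -- The pairs are disjoint because 2h ≤ n, so they yield different moving keys.
  have : #(univ : Finset (Fin h)) ≤ #(allMoved x A.steps A.init) := by
    apply card_le_card_of_injOn f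
    · intro i _; exact hf i
    · intro i _ j _ hij
      have h1 := hfe i
      have h2 := hfe j
      rw [hij] at h1
      apply Fin.ext
      omega
  simpa using this

end WellFormed

/-! ### Counting the executions of an algorithm that keeps most keys in one place -/

section Counting

variable {n v : ℕ} {D : Type}

/-- The outcomes of all comparisons performed by `r₀`. -/
def transcript {K : Type} [LinearOrder K] (x : Fin n → K) (r₀ : Fin v)
    (l : List (Superstep n v D)) (c : Config n v D) : List Bool :=
  (trace x l c).flatMap fun p => (p.1.work r₀ (p.2 r₀)).bits x

theorem length_transcript {K : Type} [LinearOrder K] (A : StaticAlgorithm n v) (x : Fin n → K)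
    (r₀ : Fin v) : (transcript x r₀ A.steps A.init).length = A.comparisons v x r₀ := by
  have hproc : ∀ r : Fin v, proc v v r = r := by
    intro r
    rw [proc, Nat.div_self r.pos, Nat.div_one]
  have := sum_eq_trace_sum x A fun p => ∑ r : Fin v,
    if proc v v r = r₀ then ((p.1.work r (p.2 r)).path x).length else 0
  rw [StaticAlgorithm.comparisons, this, transcript, List.length_flatMap]
  congr 2
  funext p
  rw [CompTree.length_bits, sum_eq_single r₀]
  · simp [hproc]
  · intro r _ hr
    rw [if_neg]
    rw [hproc]
    exact fun h => hr (Fin.ext h)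
  · simp

theorem finalConfig_eq_of_transcript {K : Type} [LinearOrder K] {x x' : Fin n → K} {κ : ℕ}
    (r₀ : Fin v) (Q : Finset (Fin n))
    (hQ : ∀ i ∈ Q, ∀ j ∈ Q, (x i < x j ↔ x' i < x' j)) (l : List (Superstep n v D))
    (c : Config n v D) (hl : ∀ p ∈ trace x l c, p.1.Legal κ x p.2)
    (hk : ∀ p ∈ trace x l c, ∀ r ≠ r₀, ∀ i ∈ (p.2 r).keys, i ∈ Q) {w w' : List Bool}
    (hw : transcript x r₀ l c ++ w = transcript x' r₀ l c ++ w') :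
    finalConfig x' l c = finalConfig x l c := by
  induction l generalizing c with
  | nil => rfl
  | cons S l ih =>
    simp only [trace, List.mem_cons, forall_eq_or_imp] at hl hk
    simp only [transcript, trace, List.flatMap_cons, List.append_assoc] at hw
    obtain ⟨h1, h2⟩ := CompTree.eval_eq_of_bits _ hw
    have he : S.exec x' c = S.exec x c := by
      apply exec_congr
      intro r
      by_cases hr : r = r₀
      · subst hr; exact h1
      · apply CompTree.eval_eq_of_agree
        intro ij hij
        have := (hl.1 r).1 ij hij
        exact hQ _ (hk.1 r hr _ this.1) _ (hk.1 r hr _ this.2)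
    simp only [finalConfig, List.foldl_cons, he]
    rw [he] at h2
    exact ih _ hl.2 hk.2 h2

/-- A set of keys, listed in increasing order. -/
def orderList (x : Equiv.Perm (Fin n)) (Q : Finset (Fin n)) : List (Fin n) :=
  ((Q.map x.toEmbedding).sort).map x.symm

theorem mem_orderList {x : Equiv.Perm (Fin n)} {Q : Finset (Fin n)} {i : Fin n} :
    i ∈ orderList x Q ↔ i ∈ Q := by
  simp only [orderList, List.mem_map, mem_sort, mem_map_equiv]
  exact ⟨fun ⟨a, ha, hi⟩ => hi ▸ ha, fun hi => ⟨x i, by simpa using hi, by simp⟩⟩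

theorem length_orderList (x : Equiv.Perm (Fin n)) (Q : Finset (Fin n)) :
    (orderList x Q).length = #Q := by
  simp [orderList]

theorem orderList_pairwise (x : Equiv.Perm (Fin n)) (Q : Finset (Fin n)) :
    (orderList x Q).Pairwise fun a b => x a < x b := by
  rw [orderList, List.pairwise_map]
  simpa using (sortedLT_sort (Q.map x.toEmbedding)).pairwise

theorem lt_iff_of_pairwise {l : List (Fin n)} {x x' : Equiv.Perm (Fin n)}
    (h : l.Pairwise fun a b => x a < x b) (h' : l.Pairwise fun a b => x' a < x' b) {i j : Fin n}
    (hi : i ∈ l) (hj : j ∈ l) : x i < x j ↔ x' i < x' j := by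
  obtain ⟨p, hp, rfl⟩ := List.getElem_of_mem hi
  obtain ⟨q, hq, rfl⟩ := List.getElem_of_mem hj
  rw [List.pairwise_iff_getElem] at h h'
  rcases Nat.lt_trichotomy p q with hpq | rfl | hpq
  · exact iff_of_true (h p q hp hq hpq) (h' p q hp hq hpq)
  · simp
  · exact iff_of_false (h q p hq hp hpq).not_gt (h' q p hq hp hpq).not_gt

/-- A list, padded to a given length. -/
def padded {α : Type*} (a : α) (l : List α) {N : ℕ} (h : l.length ≤ N) : List.Vector α N :=
  ⟨l ++ List.replicate (N - l.length) a, by simp; omega⟩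

theorem rank_perm (x : Equiv.Perm (Fin n)) (i : Fin n) : rank x i = x i := by
  have := rank_comp_perm (fun j : Fin n => j) x i
  rw [show (fun j : Fin n => j) ∘ x = x from rfl] at this
  rw [this, rank]
  have : (univ.filter fun j => j < x i) = Iio (x i) := by ext; simp
  rw [this, Fin.card_Iio]

/-- An encoding argument: a permutation can be recovered from the comparison outcomes of r₀ and from
the ordered list of the keys that start elsewhere or move. That list records the set, which depends
on the input, together with its order. -/
theorem factorial_le {κ : ℕ} {A : StaticAlgorithm n v} (hA : A.WellFormed κ) (hs : A.Solves)
    {home : Fin n → Fin v} (hhome : ∀ r i, i ∈ (A.init r).keys → r = home i) (r₀ : Fin v) {L q : ℕ}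
    (hL : ∀ x : Equiv.Perm (Fin n), A.comparisons v x r₀ ≤ L)
    (hq : #{i | home i ≠ r₀} + κ * (v * totalDegree A) ≤ q) :
    n.factorial ≤ 2 ^ L * (n + 1) ^ q := by
  let Q : Equiv.Perm (Fin n) → Finset (Fin n) := fun x =>
    univ.filter (fun i => home i ≠ r₀) ∪ allMoved x A.steps A.init
  have hQ : ∀ x, (orderList x (Q x)).length ≤ q := by
    intro x
    rw [length_orderList]
    exact ((card_union_le _ _).trans (Nat.add_le_add_left
      (card_allMoved_le_totalDegree hA x.injective) _)).trans hq
  have hT : ∀ x : Equiv.Perm (Fin n), (transcript x r₀ A.steps A.init).length ≤ L := by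
    intro x
    rw [length_transcript]
    exact hL x
  let f : Equiv.Perm (Fin n) → List.Vector Bool L × List.Vector (Option (Fin n)) q := fun x =>
    (padded false _ (hT x), padded none ((orderList x (Q x)).map some) (by simpa using hQ x))
  have hf : Function.Injective f := by
    intro x x' hxx
    simp only [f, Prod.mk.injEq] at hxx
    obtain ⟨h1, h2⟩ := hxx
    have h1' := congrArg Subtype.val h1
    have h2' := congrArg (fun u => List.reduceOption (Subtype.val u)) h2
    simp only [padded, List.reduceOption_append, List.reduceOption_replicate_none,
      List.append_nil] at h1' h2'
    have hred : ∀ l : List (Fin n), (l.map some).reduceOption = l := by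
      intro l; induction l with
      | nil => rfl
      | cons a l ih => rw [List.map_cons, List.reduceOption_cons_of_some, ih]
    rw [hred, hred] at h2'
    have hfin := finalConfig_eq_of_transcript (κ := κ) r₀ (Q x) (x := x) (x' := x') ?_
      A.steps A.init (fun p hp => legal_of_mem_trace hA x.injective hp) ?_ h1'
    · ext i
      rw [← rank_perm, ← rank_perm]
      exact rank_eq_of_finalConfig_eq hs x.injective x'.injective hfin i
    · intro i hi j hj
      rw [← mem_orderList (x := x)] at hi hj
      exact lt_iff_of_pairwise (orderList_pairwise x (Q x))
        (h2' ▸ orderList_pairwise x' (Q x')) hi hj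
    · intro p hp r hr i hi
      rcases mem_trace_keys _ _ (fun p hp => legal_of_mem_trace hA x.injective hp) hp hi with h | h
      · refine mem_union_left _ ?_
        simp only [mem_filter, mem_univ, true_and]
        rw [← hhome r i h]
        exact hr
      · exact mem_union_right _ h
  have := Fintype.card_le_of_injective f hf
  rwa [Fintype.card_perm, Fintype.card_fin, Fintype.card_prod, card_vector, card_vector,
    Fintype.card_bool, Fintype.card_option, Fintype.card_fin] at this

end Counting

/-! ### The lower bound -/

theorem exists_home {n v : ℕ} {D : Type} {c : Config n v D}
    (h : ∀ i : Fin n, ∑ r, (c r).keys.count i = 1) :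
    ∃ home : Fin n → Fin v, ∀ r i, i ∈ (c r).keys → r = home i := by
  have hex : ∀ i : Fin n, ∃ r, i ∈ (c r).keys := by
    intro i
    by_contra hcon
    push Not at hcon
    have := h i
    rw [sum_eq_zero fun r _ => List.count_eq_zero.2 (hcon r)] at this
    omega
  choose home hhome using hex
  refine ⟨home, fun r i hi => ?_⟩
  by_contra hne
  have h1 := sum_le_sum_of_subset (f := fun r => (c r).keys.count i) (subset_univ {r, home i})
  rw [h i, sum_pair hne] at h1
  have h2 := List.count_pos_iff.2 hi
  have h3 := List.count_pos_iff.2 (hhome i)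
  omega

theorem lg_eq_logb {y : ℝ} (hy : 2 ≤ y) : lg y = Real.logb 2 y := by
  rw [lg, max_eq_right]
  rw [Real.le_logb_iff_rpow_le (by norm_num) (by linarith), Real.rpow_one]
  exact hy

/-- Few comparisons in one place and few keys elsewhere do not suffice for sorting. -/
theorem lg_le_of_factorial_le {n L q : ℕ} {ε : ℝ} (hε0 : 0 < ε) (hε : ε < 1) (hn : 2 ≤ n)
    (h : n.factorial ≤ 2 ^ L * (n + 1) ^ q) (hL : (L : ℝ) ≤ ε * n * lg n)
    (hq : (q : ℝ) ≤ (1 - ε) / 2 * n) : lg n ≤ 5 / (1 - ε) := by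
  have hn2 : (2 : ℝ) ≤ n := by exact_mod_cast hn
  have hn0 : (0 : ℝ) < n := by linarith
  rw [lg_eq_logb hn2] at hL ⊢
  -- This uses n! ≥ (n / e)^n with e < 4, and n + 1 ≤ 2n.
  have h1 : (n : ℝ) ^ n ≤ 4 ^ n * (2 ^ L * (2 * n) ^ q) := by
    have he : (n : ℝ) ^ n / n.factorial ≤ 4 ^ n := by
      refine (Real.pow_div_factorial_le_exp n (by linarith) n).trans ?_
      rw [← mul_one (n : ℝ), Real.exp_nat_mul]
      refine pow_le_pow_left₀ (Real.exp_pos 1).le ?_ n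
      linarith [Real.exp_one_lt_d9]
    rw [div_le_iff₀ (by positivity)] at he
    refine he.trans (mul_le_mul_of_nonneg_left ?_ (by positivity))
    calc (n.factorial : ℝ) ≤ 2 ^ L * ((n : ℝ) + 1) ^ q := by exact_mod_cast h
      _ ≤ 2 ^ L * (2 * n) ^ q := by
        refine mul_le_mul_of_nonneg_left ?_ (by positivity)
        exact pow_le_pow_left₀ (by linarith) (by linarith) q
  have h2 := Real.logb_le_logb_of_le (b := 2) (by norm_num) (by positivity) h1
  rw [Real.logb_mul (by positivity) (by positivity), Real.logb_mul (by positivity) (by positivity),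
    Real.logb_pow, Real.logb_pow, Real.logb_pow, Real.logb_pow,
    Real.logb_mul (by norm_num) (by positivity), Real.logb_self_eq_one (by norm_num),
    show (4 : ℝ) = 2 ^ 2 by norm_num, Real.logb_pow, Real.logb_self_eq_one (by norm_num)] at h2
  push_cast at h2
  have hlog : 1 ≤ Real.logb 2 n := by
    rw [Real.le_logb_iff_rpow_le (by norm_num) hn0, Real.rpow_one]; exact hn2
  have h3 : (q : ℝ) * (1 + Real.logb 2 n) ≤ (1 - ε) / 2 * n * (1 + Real.logb 2 n) :=
    mul_le_mul_of_nonneg_right hq (by linarith)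
  -- Inserting the bounds on L and q into n log n ≤ 2n + L + q (1 + log n). As 2 + (1 - ε) / 2 < 5 /
  -- 2, the bound 5 / (1 - ε) results.
  have h4 : (n : ℝ) * ((1 - ε) / 2 * Real.logb 2 n) ≤ n * (2 + (1 - ε) / 2) := by nlinarith
  have h5 := le_of_mul_le_mul_left h4 hn0
  rw [le_div_iff₀ (by linarith)]
  linarith

/-- The dichotomy of the lower bound: a PE that starts with all but ηn keys performs too few
comparisons (`factorial_le`); otherwise many pairs of keys are separated (`le_of_separated_pairs`).
-/
theorem exists_linear_traffic (κ : ℕ) {ε : ℝ} (hε0 : 0 < ε) (hε : ε < 1) :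
    ∃ c : ℝ, 0 < c ∧ ∃ n₀ : ℕ, ∀ n v : ℕ, n₀ ≤ n → ∀ A : StaticAlgorithm n v, A.WellFormed κ →
      A.Solves → (∀ i : Fin n, ∑ r, (A.init r).keys.count i = 1) →
      A.ComparisonsAtMost v (ε * n * lg n) → c * n ≤ v * totalDegree A := by
  obtain ⟨η, hη⟩ : ∃ η, η = (1 - ε) / 4 := ⟨_, rfl⟩
  have hη0 : 0 < η := by linarith
  have hη4 : η < 1 / 4 := by linarith
  have hκ : (0 : ℝ) < (κ : ℝ) + 1 := by positivity
  -- With this constant, traffic below the bound moves at most ηn / 2 keys; κ + 1 avoids division by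
  -- zero. The choice of n₀ ensures log n > 5 / (1 - ε) and ηn > 2, one for each case.
  refine ⟨η / (2 * (κ + 1)), by positivity,
    ⌈(2 : ℝ) ^ (5 / (1 - ε) + 1 : ℝ) + 2 / η⌉₊ + 2, ?_⟩
  intro n v hn A hA hs hinit hcmp
  by_contra hcon
  rw [not_le] at hcon
  have hnR : (2 : ℝ) ^ (5 / (1 - ε) + 1 : ℝ) + 2 / η + 2 ≤ n := by
    have h1 : ((⌈(2 : ℝ) ^ (5 / (1 - ε) + 1 : ℝ) + 2 / η⌉₊ + 2 : ℕ) : ℝ) ≤ n := by exact_mod_cast hn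
    push_cast at h1
    have := Nat.le_ceil ((2 : ℝ) ^ (5 / (1 - ε) + 1 : ℝ) + 2 / η)
    linarith
  have hpow0 : 0 < (2 : ℝ) ^ (5 / (1 - ε) + 1 : ℝ) := by positivity
  have hdiv0 : 0 < 2 / η := by positivity
  have hn0 : (0 : ℝ) < n := by linarith
  have hmoves : ((κ * (v * totalDegree A) : ℕ) : ℝ) ≤ η * n / 2 := by
    push_cast
    have h1 : (κ : ℝ) * (v * totalDegree A) ≤ (κ + 1) * (v * totalDegree A) :=
      mul_le_mul_of_nonneg_right (by linarith) (by positivity)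
    have h2 : ((κ : ℝ) + 1) * (v * totalDegree A) ≤ (κ + 1) * (η / (2 * (κ + 1)) * n) :=
      mul_le_mul_of_nonneg_left hcon.le hκ.le
    have h3 : ((κ : ℝ) + 1) * (η / (2 * (κ + 1)) * n) = η * n / 2 := by field_simp
    linarith
  obtain ⟨home, hhome⟩ := exists_home hinit
  by_cases hcase : ∃ r₀ : Fin v, (#{i | home i ≠ r₀} : ℝ) ≤ η * n
  · obtain ⟨r₀, hr₀⟩ := hcase
    have hlg0 : 0 ≤ lg n := le_trans zero_le_one (le_max_left _ _)
    have hfac := factorial_le hA hs hhome r₀ (L := ⌊ε * n * lg n⌋₊)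
      (q := #{i | home i ≠ r₀} + κ * (v * totalDegree A))
      (fun x => Nat.le_floor (hcmp (Fin n) x x.injective r₀ r₀.isLt)) le_rfl
    -- Here q ≤ ηn + ηn / 2 ≤ 2ηn = (1 - ε) n / 2.
    have hlog := lg_le_of_factorial_le hε0 hε (by omega) hfac (Nat.floor_le (by positivity)) (by
      rw [Nat.cast_add]
      rw [hη] at hr₀ hmoves
      nlinarith)
    rw [lg_eq_logb (by linarith), Real.logb_le_iff_le_rpow (by norm_num) hn0] at hlog
    have : (2 : ℝ) ^ (5 / (1 - ε)) ≤ 2 ^ (5 / (1 - ε) + 1) :=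
      Real.rpow_le_rpow_of_exponent_le (by norm_num) (by linarith)
    linarith
  · push Not at hcase
    have hh : (⌊η * n⌋₊ : ℝ) ≤ η * n := Nat.floor_le (by positivity)
    have h2h : 2 * ⌊η * n⌋₊ ≤ n := by
      have : (2 * ⌊η * n⌋₊ : ℝ) ≤ n := by nlinarith
      exact_mod_cast this
    -- In the list of keys sorted by home, let h = ⌊ηn⌋. If positions i and i + (n - h) had the same
    -- home, so would everything between them, and fewer than h keys would be elsewhere.
    have hle := le_of_separated_pairs hA hs hhome (Tuple.sort home) h2h (by
      intro i j hi hj heq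
      have hmono := Tuple.monotone_sort home
      have hsub : (univ.filter fun a => home a ≠ home (Tuple.sort home i)) ⊆
          ((Icc i j)ᶜ).map (Tuple.sort home).toEmbedding := by
        intro a ha
        simp only [mem_filter, mem_univ, true_and] at ha
        rw [mem_map_equiv, mem_compl, mem_Icc]
        rintro ⟨h1, h2⟩
        apply ha
        have h3 := hmono h1
        have h4 := hmono h2
        simp only [Function.comp, Equiv.apply_symm_apply] at h3 h4
        exact le_antisymm (h4.trans heq.ge) h3
      have hcard := card_le_card hsub
      rw [card_map, card_compl, Fintype.card_fin, Fin.card_Icc] at hcard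
      have h5 := hcase (home (Tuple.sort home i))
      have h6 : #(univ.filter fun a => home a ≠ home (Tuple.sort home i)) ≤ ⌊η * n⌋₊ := by omega
      have h7 : (#(univ.filter fun a => home a ≠ home (Tuple.sort home i)) : ℝ) ≤ ⌊η * n⌋₊ := by
        exact_mod_cast h6
      linarith)
    have h1 : (⌊η * n⌋₊ : ℝ) ≤ ((κ * (v * totalDegree A) : ℕ) : ℝ) := by exact_mod_cast hle
    have h2 := Nat.lt_floor_add_one (η * n)
    have h3 : 2 / η < n := by linarith
    rw [div_lt_iff₀ hη0] at h3
    linarith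

/-- On its own machine no superstep is local: all labels are below log p. -/
theorem commComplexity_eq_totalDegree {n a κ : ℕ} (ha : 1 ≤ a) {A : StaticAlgorithm n (2 ^ a)}
    (hA : A.WellFormed κ) (σ : ℝ) :
    A.commComplexity (2 ^ a) σ = totalDegree A + A.steps.length * σ := by
  rw [commComplexity_eq, List.filter_eq_self.2, totalDegree, Nat.cast_list_sum, List.map_map]
  · rfl
  · intro S hS
    have := hA.label_lt S hS
    rw [Nat.log_pow (by norm_num), max_eq_right ha] at this
    rw [Nat.log_pow (by norm_num), decide_eq_true_eq]
    exact this

/-- The lower bound for the class of algorithms under consideration. -/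
theorem exists_commComplexity_ge (κ c : ℕ) {ε : ℝ} (hε0 : 0 < ε) (hε : ε < 1) :
    ∃ b : ℝ, 0 < b ∧ ∃ n₀ : ℕ, ∀ k a : ℕ, n₀ ≤ 2 ^ k → 1 ≤ a → ∀ σ : ℝ, 0 ≤ σ →
      ∀ B : StaticAlgorithm (2 ^ k) (2 ^ a), B.InClass κ c ε →
        b * ((2 ^ k : ℝ) / 2 ^ a + σ) ≤ B.commComplexity (2 ^ a) σ := by
  obtain ⟨b, hb, n₀, h⟩ := exists_linear_traffic κ hε0 hε
  refine ⟨min b 1, lt_min hb one_pos, n₀, ?_⟩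
  intro k a hk ha σ hσ B hB
  have hdeg := h (2 ^ k) (2 ^ a) hk B hB.wellFormed hB.solves hB.lowReplication.1
    (hB.balanced a ha le_rfl)
  rw [commComplexity_eq_totalDegree ha hB.wellFormed]
  push_cast at hdeg
  have h2a : (0 : ℝ) < 2 ^ a := by positivity
  have h2k : (0 : ℝ) < 2 ^ k := by positivity
  have hdeg' : b * ((2 : ℝ) ^ k / 2 ^ a) ≤ totalDegree B := by
    rw [← mul_div_assoc, div_le_iff₀ h2a]
    linarith
  -- Positive total degree forces at least one superstep, which pays for the term σ.
  have hlen : (1 : ℝ) ≤ B.steps.length := by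
    have : B.steps ≠ [] := by
      intro hnil
      rw [totalDegree, hnil] at hdeg'
      have : 0 < b * ((2 : ℝ) ^ k / 2 ^ a) := by positivity
      simp at hdeg'
      linarith
    exact_mod_cast List.length_pos_iff.2 this
  have h1 : min b 1 * ((2 : ℝ) ^ k / 2 ^ a) ≤ b * ((2 : ℝ) ^ k / 2 ^ a) :=
    mul_le_mul_of_nonneg_right (min_le_left _ _) (by positivity)
  have h2 : min b 1 * σ ≤ 1 * σ := mul_le_mul_of_nonneg_right (min_le_right _ _) hσ
  have h3 : 1 * σ ≤ B.steps.length * σ := mul_le_mul_of_nonneg_right hlen hσ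
  linarith

/-- If `p = O(n ^ (1 - δ))` then `log n = O(log (n / p))`. -/
theorem exists_lg_div_le {δ M : ℝ} (hδ : 0 < δ) (hM : 0 < M) :
    ∃ n₀ : ℕ, ∀ k a : ℕ, n₀ ≤ 2 ^ k → 1 ≤ a → a ≤ k →
      (2 ^ a : ℝ) ≤ M * (2 ^ k : ℝ) ^ (1 - δ) →
        lg (2 ^ k) / lg ((2 ^ k : ℝ) / 2 ^ a) ≤ 2 / δ := by
  -- From a ≤ log M + (1 - δ) k it follows that k - a ≥ δk - log M, which is at least δk / 2 as soon
  -- as k ≥ 2 log M / δ.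
  refine ⟨2 ^ ⌈2 * Real.logb 2 M / δ⌉₊, ?_⟩
  intro k a hk ha hak hp
  have hk' := (Nat.pow_le_pow_iff_right (by norm_num : 1 < 2)).1 hk
  have hkR : 2 * Real.logb 2 M / δ ≤ k := (Nat.le_ceil _).trans (by exact_mod_cast hk')
  rw [div_le_iff₀ hδ] at hkR
  have h1 : (1 : ℝ) ≤ k := by exact_mod_cast ha.trans hak
  have h2 := Real.logb_le_logb_of_le (b := 2) (by norm_num) (by positivity) hp
  rw [Real.logb_pow, Real.logb_self_eq_one (by norm_num), Real.logb_mul (by positivity)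
    (by positivity), Real.logb_rpow_eq_mul_logb_of_pos (by positivity), Real.logb_pow,
    Real.logb_self_eq_one (by norm_num)] at h2
  have h3 : ((k - a : ℕ) : ℝ) = k - a := Nat.cast_sub hak
  rw [two_pow_div hak, lg_two_pow, lg_two_pow, max_eq_right h1, h3]
  have h4 : (k : ℝ) - a ≤ max 1 ((k : ℝ) - a) := le_max_right _ _
  have h5 : (1 : ℝ) ≤ max 1 ((k : ℝ) - a) := le_max_left _ _
  rw [div_le_div_iff₀ (by linarith) hδ]
  nlinarith

end NetSort
-- Assembly of the four claims.
theorem mainTheorem7 :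
    -- it is a legal static algorithm for `n`-sort; initially no key is replicated, and the number
    -- of copies per key is bounded at any time; its comparisons are balanced
    (∃ c : ℕ, ∀ k : ℕ, 1 ≤ k →
      (NetSort.columnsort k).WellFormed 1 ∧ (NetSort.columnsort k).Solves ∧
      (NetSort.columnsort k).LowReplication c ∧
      ∀ a : ℕ, a ≤ k → (NetSort.columnsort k).ComparisonsAtMost (2 ^ a)
        (c * ((2 ^ k : ℝ) / 2 ^ a) * NetSort.lg (2 ^ k) ^ Real.logb (3 / 2) 4)) ∧
    -- communication complexity for `n = 2 ^ k` and `p = 2 ^ a`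
    (∃ C : ℝ, 0 < C ∧ ∀ k a : ℕ, 1 ≤ a → a ≤ k → ∀ σ : ℝ, 0 ≤ σ →
      (NetSort.columnsort k).commComplexity (2 ^ a) σ ≤
        C * (((2 ^ k : ℝ) / 2 ^ a + σ) *
          (NetSort.lg (2 ^ k) / NetSort.lg ((2 ^ k : ℝ) / 2 ^ a)) ^ Real.logb (3 / 2) 4)) ∧
    -- wiseness
    (∃ α : ℝ, 0 < α ∧ α ≤ 1 ∧ ∀ k : ℕ, 1 ≤ k → (NetSort.columnsort k).Wise α (2 ^ k)) ∧
    -- optimality, for `p ≤ M n ^ (1 - δ)`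
    (∀ (κ c : ℕ) (ε δ M : ℝ), 0 < ε → ε < 1 → 0 < δ → δ < 1 → 0 < M →
      ∃ β : ℝ, 0 < β ∧ β ≤ 1 ∧ ∃ n₀ : ℕ, ∀ k a : ℕ, n₀ ≤ 2 ^ k → 1 ≤ a → a ≤ k →
        (2 ^ a : ℝ) ≤ M * (2 ^ k : ℝ) ^ (1 - δ) → ∀ σ : ℝ, 0 ≤ σ →
          ∀ B : NetSort.StaticAlgorithm (2 ^ k) (2 ^ a), B.InClass κ c ε →
            (NetSort.columnsort k).commComplexity (2 ^ a) σ ≤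
              1 / β * B.commComplexity (2 ^ a) σ) := by

  refine ⟨⟨⌈16 * NetSort.stepConst⌉₊ + 4, fun k hk => ⟨NetSort.columnsort_wellFormed hk,
      NetSort.columnsort_solves k, NetSort.columnsort_lowReplication k (Nat.le_add_left _ _),
      fun a ha => NetSort.columnsort_comparisons_le hk ha ?_⟩⟩,
    ⟨4 * NetSort.stepConst, mul_pos (by norm_num) NetSort.stepConst_pos,
      fun k a ha hak σ hσ => NetSort.columnsort_commComplexity_le ha hak hσ⟩,
    ⟨1 / 4, by norm_num, by norm_num, fun k hk => NetSort.columnsort_wise hk⟩, ?_⟩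
  · rw [Nat.cast_add]
    have := Nat.le_ceil (16 * NetSort.stepConst)
    have h4 : (0 : ℝ) ≤ (4 : ℕ) := Nat.cast_nonneg _
    linarith
  · intro κ c ε δ M hε0 hε hδ _ hM
    obtain ⟨b, hb, n₁, h₁⟩ := NetSort.exists_commComplexity_ge κ c hε0 hε
    obtain ⟨n₂, h₂⟩ := NetSort.exists_lg_div_le hδ hM
    obtain ⟨T, hT⟩ : ∃ T, T = 4 * NetSort.stepConst * (2 / δ) ^ NetSort.sortExp := ⟨_, rfl⟩
    have hT0 : 0 < T := by
      rw [hT]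
      exact mul_pos (mul_pos (by norm_num) NetSort.stepConst_pos)
        (Real.rpow_pos_of_pos (by positivity) _)
    -- The upper bound is T (n/p + σ), the lower bound b (n/p + σ); their quotient is capped at 1
    -- because β ≤ 1 is required.
    refine ⟨min 1 (b / T), lt_min one_pos (by positivity), min_le_left _ _, max n₁ n₂, ?_⟩
    intro k a hk ha hak hp σ hσ B hB
    have hlow := h₁ k a ((le_max_left _ _).trans hk) ha σ hσ B hB
    have hlg := h₂ k a ((le_max_right _ _).trans hk) ha hak hp
    have hup := NetSort.columnsort_commComplexity_le ha hak hσ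
    have hlg0 : 0 ≤ NetSort.lg (2 ^ k) / NetSort.lg ((2 ^ k : ℝ) / 2 ^ a) :=
      div_nonneg (zero_le_one.trans (le_max_left _ _)) (zero_le_one.trans (le_max_left _ _))
    have hpow := Real.rpow_le_rpow hlg0 hlg NetSort.sortExp_nonneg
    have hX : (0 : ℝ) ≤ (2 ^ k : ℝ) / 2 ^ a + σ := by positivity
    have hup' : (NetSort.columnsort k).commComplexity (2 ^ a) σ ≤
        T * ((2 ^ k : ℝ) / 2 ^ a + σ) := by
      refine hup.trans ?_
      have := mul_le_mul_of_nonneg_left hpow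
        (mul_nonneg (mul_pos four_pos NetSort.stepConst_pos).le hX)
      rw [hT]
      linarith
    rw [one_div, inv_mul_eq_div, le_div_iff₀ (lt_min one_pos (by positivity))]
    calc _ ≤ (T * ((2 ^ k : ℝ) / 2 ^ a + σ)) * (b / T) :=
          mul_le_mul hup' (min_le_right _ _) (le_min zero_le_one (by positivity)) (by positivity)
      _ = b * ((2 ^ k : ℝ) / 2 ^ a + σ) := by field_simp
      _ ≤ _ := hlow
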